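/- All ordinals below are ordinals $<\varepsilon_0$, given by (codes of) their hereditary Cantor normal forms, and the following fundamental sequences are used for $n\in\mathbb N$: $\{0\}(n)=0$, $\{\beta+1\}(n)=\beta$, $\{\beta+\omega^{\gamma+1}\}(n)=\beta+\omega^{\gamma}\cdot(n+1)$, and $\{\beta+\omega^{\gamma}\}(n)=\beta+\omega^{\{\gamma\}(n)}$ if $\gamma$ is a limit (where $\beta+\omega^{\gamma+1}$ resp. $\beta+\omega^{\gamma}$ is in Cantor normal form with the displayed power as last summand). An ordinal $\alpha$ meshes with $\gamma$ if $\alpha=0$ or $\gamma<\omega^{\alpha_0+1}$, where $\alpha_0$ is the smallest exponent in the Cantor normal form of $\alpha$. Step-down arguments are finite terms $s^{\beta}_{\alpha}$ typed by pairs of ordinals (start $\beta$, end $\alpha$), inductively generated as follows: (i) $\mathsf f(m)^{\beta}_{\alpha}$ is a step-down argument if $\alpha=\{\beta\}(m)$; (ii) if $s^{\beta}_{\alpha}$ and $t^{\gamma}_{\beta}$ are step-down arguments, so is $(s*t)^{\gamma}_{\alpha}$; (iii) if $s^{\gamma}_{\beta}$ is a step-down argument and $\alpha$ meshes with $\gamma$,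 then $(\alpha+s)^{\alpha+\gamma}_{\alpha+\beta}$ is a step-down argument; (iv) if $s^{\beta}_{\alpha}$ is a step-down argument, so is $(\omega^{s})^{\omega^{\beta}}_{\omega^{\alpha}}$. The base of $s$ is the maximal $m$ such that some $\mathsf f(m)$ occurs in $s$. Write $s\vdash\beta\le_n\alpha$ if $s$ is a step-down argument with start $\alpha$, end $\beta$ and base at most $n$. Let $f(\alpha,n,0)=\alpha$ and $f(\alpha,n,x+1)=\{f(\alpha,n,x)\}(n)$, and write $\alpha\searrow_n\beta$ if there are $x$ and $y\le x$ with $f(\alpha,n,y)=\beta$. **Proposition.** The theory $\mathbf{I\Sigma}_1$ (the fragment of Peano arithmetic with induction for $\Sigma_1$-formulas) proves, under the standard arithmetization of these notions: 1. for all $s,\beta,n,\alpha$: if $s$ is a step-down argument with $s\vdash\beta\le_n\alpha$, then $\alpha\searrow_n\beta$; 2. for every $\alpha<\varepsilon_0$ and every $n$: $\alpha\searrow_n 0$. -/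

import Mathlib

namespace StepDown

open FirstOrder FirstOrder.Language

/-! ## Formal provability in first-order logic -/

section Provability

variable {L : FirstOrder.Language.{0, 0}}

/-- The instance `φ[t]` of the body of a quantified formula `∀' φ`. Bound variables are
de Bruijn indices, so no variable of `t` can be captured. -/
def inst (φ : L.BoundedFormula ℕ 1) (t : L.Term ℕ) : L.Formula ℕ :=
  BoundedFormula.subst φ.toFormula (Sum.elim Term.var fun _ => t)

/-- Natural deduction for classical first-order logic with equality, for formulas whose free
variables are numbered by `ℕ`. The primitive connectives are falsum, implication, universal
quantification and equality; the others are abbreviations in terms of these. -/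
inductive Derives : Set (L.Formula ℕ) → L.Formula ℕ → Prop
  | assumption {Γ : Set (L.Formula ℕ)} {φ : L.Formula ℕ} : φ ∈ Γ → Derives Γ φ
  | weakening {Γ Δ : Set (L.Formula ℕ)} {φ : L.Formula ℕ} : Γ ⊆ Δ → Derives Γ φ → Derives Δ φ
  | impIntro {Γ : Set (L.Formula ℕ)} {φ ψ : L.Formula ℕ} :
      Derives (insert φ Γ) ψ → Derives Γ (φ.imp ψ)
  | impElim {Γ : Set (L.Formula ℕ)} {φ ψ : L.Formula ℕ} :
      Derives Γ (φ.imp ψ) → Derives Γ φ → Derives Γ ψ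
  | byContradiction {Γ : Set (L.Formula ℕ)} {φ : L.Formula ℕ} :
      Derives (insert φ.not Γ) ⊥ → Derives Γ φ
  | allIntro {Γ : Set (L.Formula ℕ)} {φ : L.BoundedFormula ℕ 1} (x : ℕ) :
      (∀ ψ ∈ Γ, x ∉ ψ.freeVarFinset) → x ∉ φ.freeVarFinset →
      Derives Γ (inst φ (Term.var x)) → Derives Γ φ.all
  | allElim {Γ : Set (L.Formula ℕ)} {φ : L.BoundedFormula ℕ 1} (t : L.Term ℕ) :
      Derives Γ φ.all → Derives Γ (inst φ t)
  | eqRefl {Γ : Set (L.Formula ℕ)} (t : L.Term ℕ) : Derives Γ (t.equal t)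
  | eqSubst {Γ : Set (L.Formula ℕ)} (φ : L.BoundedFormula ℕ 1) {s t : L.Term ℕ} :
      Derives Γ (s.equal t) → Derives Γ (inst φ s) → Derives Γ (inst φ t)

/-- `T ⊢ σ`: the sentence `σ` is formally derivable from the axioms in `T`. -/
def Provable (T : L.Theory) (σ : L.Sentence) : Prop :=
  Derives ((fun τ : L.Sentence => Formula.relabel (Empty.elim : Empty → ℕ) τ) '' T)
    (Formula.relabel (Empty.elim : Empty → ℕ) σ)

/-- `∀ y₀ … yₘ₋₁, φ`, the `yᵢ` being the variables `Sum.inr i`. -/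
def allF {α : Type} {m : ℕ} (φ : L.Formula (α ⊕ Fin m)) : L.Formula α :=
  BoundedFormula.alls (n := m) (BoundedFormula.relabel (id : α ⊕ Fin m → α ⊕ Fin m) φ)

/-- `∃ y₀ … yₘ₋₁, φ`, the `yᵢ` being the variables `Sum.inr i`. -/
def exF {α : Type} {m : ℕ} (φ : L.Formula (α ⊕ Fin m)) : L.Formula α :=
  BoundedFormula.exs (n := m) (BoundedFormula.relabel (id : α ⊕ Fin m → α ⊕ Fin m) φ)

/-- The universal closure of a formula in the variables `0, …, k - 1`. -/
def univClosure {k : ℕ} (φ : L.Formula (Fin k)) : L.Sentence :=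
  allF (φ.relabel (Sum.inr : Fin k → Empty ⊕ Fin k))

/-- A term regarded as a term over a longer list of variables. -/
def lift {α : Type} {m : ℕ} (t : L.Term α) : L.Term (α ⊕ Fin m) := t.relabel Sum.inl

/-- The quantified variable `yᵢ` below `allF` or `exF`. -/
def bv {α : Type} {m : ℕ} (i : Fin m) : L.Term (α ⊕ Fin m) := Term.var (Sum.inr i)

/-- The conjunction `φ₀ ∧ (φ₁ ∧ …)`. -/
def conj {α : Type} {m : ℕ} (φ : Fin m → L.Formula α) : L.Formula α :=
  (List.ofFn φ).foldr (· ⊓ ·) ⊤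

end Provability

/-! ## The theory `IΣ₁` -/

inductive ArithFunc : ℕ → Type
  | zero : ArithFunc 0
  | succ : ArithFunc 1
  | add : ArithFunc 2
  | mul : ArithFunc 2

inductive ArithRel : ℕ → Type
  | lt : ArithRel 2

/-- The language `0, S, +, ·, <` of first-order arithmetic. -/
abbrev arith : FirstOrder.Language.{0, 0} := ⟨ArithFunc, ArithRel⟩

section Arithmetic

variable {α : Type}

def zeroT : arith.Term α := Constants.term (L := arith) ArithFunc.zero
def succT (t : arith.Term α) : arith.Term α := Functions.apply₁ (L := arith) ArithFunc.succ t
def addT (s t : arith.Term α) : arith.Term α := Functions.apply₂ (L := arith) ArithFunc.add s t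
def mulT (s t : arith.Term α) : arith.Term α := Functions.apply₂ (L := arith) ArithFunc.mul s t
def ltF (s t : arith.Term α) : arith.Formula α := Relations.formula₂ (L := arith) ArithRel.lt s t

/-- `s ≤ t`, expressed as `s < S t`. -/
def leF (s t : arith.Term α) : arith.Formula α := ltF s (succT t)

/-- The atomic formula `s < t` in the presence of de Bruijn variables. -/
def ltB {n : ℕ} (s t : arith.Term (α ⊕ Fin n)) : arith.BoundedFormula α n :=
  Relations.boundedFormula₂ (L := arith) ArithRel.lt s t

/-- Bounded formulas: they are built from atomic formulas by connectives and by the quantifiers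
`∀ x < t` and `∃ x < t`, where `t` does not contain `x`. -/
inductive IsDelta0 : {n : ℕ} → arith.BoundedFormula α n → Prop
  | falsum {n : ℕ} : IsDelta0 (BoundedFormula.falsum : arith.BoundedFormula α n)
  | equal {n : ℕ} (s t : arith.Term (α ⊕ Fin n)) : IsDelta0 (BoundedFormula.equal s t)
  | rel {n l : ℕ} (R : arith.Relations l) (ts : Fin l → arith.Term (α ⊕ Fin n)) :
      IsDelta0 (BoundedFormula.rel R ts)
  | imp {n : ℕ} {φ ψ : arith.BoundedFormula α n} :
      IsDelta0 φ → IsDelta0 ψ → IsDelta0 (φ.imp ψ)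
  | ball {n : ℕ} (t : arith.Term (α ⊕ Fin n)) {φ : arith.BoundedFormula α (n + 1)} :
      IsDelta0 φ →
      IsDelta0 ((ltB (Term.var (Sum.inr (Fin.last n)))
        (t.relabel (Sum.map id Fin.castSucc))).imp φ).all
  | bex {n : ℕ} (t : arith.Term (α ⊕ Fin n)) {φ : arith.BoundedFormula α (n + 1)} :
      IsDelta0 φ →
      IsDelta0 (ltB (Term.var (Sum.inr (Fin.last n)))
        (t.relabel (Sum.map id Fin.castSucc)) ⊓ φ).ex

/-- `Σ₁`-formulas: `∃ x, θ` with `θ` bounded. -/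
def IsSigma1 (φ : arith.Formula α) : Prop :=
  ∃ θ : arith.BoundedFormula α 1, IsDelta0 θ ∧ φ = θ.ex

/-- The universal closure of `φ(0) → (∀ x, φ(x) → φ(S x)) → ∀ x, φ(x)`, where `x` is the variable
`Sum.inr 0` and the other variables of `φ` are parameters. -/
def inductionAxiom {k : ℕ} (φ : arith.Formula (Fin k ⊕ Fin 1)) : arith.Sentence :=
  univClosure
    ((BoundedFormula.subst φ (Sum.elim Term.var fun _ => zeroT) : arith.Formula (Fin k)).imp
      ((allF (φ.imp (BoundedFormula.subst φ
          (Sum.elim (fun i => Term.var (Sum.inl i)) fun _ => succT (bv 0))))).imp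
        (allF φ)))

/-- The variable with number `i`. -/
def x {k : ℕ} (i : Fin k) : arith.Term (Fin k) := Term.var i

/-- The axioms on `0, S, +, ·, <` other than induction. -/
def elementaryAxioms : arith.Theory :=
  { univClosure (k := 1) ((succT (x 0)).equal zeroT).not,
    univClosure (k := 2) (((succT (x 0)).equal (succT (x 1))).imp ((x 0).equal (x 1))),
    univClosure (k := 1) ((addT (x 0) zeroT).equal (x 0)),
    univClosure (k := 2) ((addT (x 0) (succT (x 1))).equal (succT (addT (x 0) (x 1)))),
    univClosure (k := 1) ((mulT (x 0) zeroT).equal zeroT),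
    univClosure (k := 2) ((mulT (x 0) (succT (x 1))).equal (addT (mulT (x 0) (x 1)) (x 0))),
    univClosure (k := 1) (ltF (x 0) zeroT).not,
    univClosure (k := 2) ((ltF (x 0) (succT (x 1))).imp (ltF (x 0) (x 1) ⊔ (x 0).equal (x 1))),
    univClosure (k := 1) (ltF zeroT (succT (x 0))),
    univClosure (k := 2) ((ltF (x 0) (x 1)).imp (ltF (succT (x 0)) (succT (x 1)))),
    univClosure (k := 2) ((ltF (succT (x 0)) (x 1)).imp (ltF (x 0) (x 1))),
    univClosure (k := 1) (ltF (x 0) (succT (x 0))) }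

/-- The theory `IΣ₁` of `Σ₁`-induction. -/
def ISigma1 : arith.Theory :=
  elementaryAxioms ∪
    {σ | ∃ (k : ℕ) (φ : arith.Formula (Fin k ⊕ Fin 1)), IsSigma1 φ ∧ σ = inductionAxiom φ}

end Arithmetic

/-! ## Primitive recursive functions and their graphs in the language of arithmetic -/

/-- Programs for (primitive recursive) functions in `k` variables.

Here `fst` and `snd` are the inverses of the pairing `Nat.pair`, `ifLe a b c d` is
`if a ≤ b then c else d`, and `courseRec h₁ h₂ g` is the course-of-values recursion
`F (i, p) = g (i, F (h₁ i, p), F (h₂ i, p), p)`, where `F (hⱼ i, p)` is replaced by `0`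
unless `hⱼ i < i`. -/
inductive Prog : ℕ → Type
  | var {k : ℕ} (i : Fin k) : Prog k
  | zero {k : ℕ} : Prog k
  | succ {k : ℕ} (a : Prog k) : Prog k
  | pred {k : ℕ} (a : Prog k) : Prog k
  | pair {k : ℕ} (a b : Prog k) : Prog k
  | fst {k : ℕ} (a : Prog k) : Prog k
  | snd {k : ℕ} (a : Prog k) : Prog k
  | ifLe {k : ℕ} (a b c d : Prog k) : Prog k
  | comp {k m : ℕ} (f : Prog m) (g : Fin m → Prog k) : Prog k
  | courseRec {k : ℕ} (h₁ h₂ : Prog 1) (g : Prog (k + 3)) : Prog (k + 1)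

section Graph

variable {α : Type}

/-- `p = Nat.pair a b`. -/
def pairF (a b p : arith.Term α) : arith.Formula α :=
  (ltF a b ⊓ p.equal (addT (mulT b b) a)) ⊔
    (leF b a ⊓ p.equal (addT (addT (mulT a a) a) b))

/-- Gödel's `β`-function: `y` is the remainder of `c` modulo `1 + (i + 1) · d`. The pair `(c, d)`
codes the sequence of these remainders. -/
def entryF (c d i y : arith.Term α) : arith.Formula α :=
  ltF y (succT (mulT (succT i) d)) ⊓
    exF (m := 1) ((lift c).equal
      (addT (mulT (bv 0) (lift (succT (mulT (succT i) d)))) (lift y)))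

/-- In the sequence coded by `(c, d)`, the value `u` is the entry with index `a`, if `a < j`,
and `u = 0` otherwise. -/
def prevF (c d j a u : arith.Term α) : arith.Formula α :=
  (ltF a j ⊓ entryF c d a u) ⊔ (leF j a ⊓ u.equal zeroT)

/-- `f.graph v y` is the formula `f (v) = y`. For a recursion it says that some
coded sequence satisfies the recursive clause at all indices `j ≤ i` and has `y` as its entry
with index `i`. -/
def Prog.graph : {k : ℕ} → Prog k → {α : Type} → (Fin k → arith.Term α) → arith.Term α →
    arith.Formula α
  | _, .var i, _, v, y => (v i).equal y
  | _, .zero, _, _, y => y.equal zeroT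
  | _, .succ a, _, v, y =>
      exF (m := 1) (a.graph (fun i => lift (v i)) (bv 0) ⊓ (lift y).equal (succT (bv 0)))
  | _, .pred a, _, v, y =>
      exF (m := 1) (a.graph (fun i => lift (v i)) (bv 0) ⊓
        (((bv 0).equal zeroT ⊓ (lift y).equal zeroT) ⊔ (bv 0).equal (succT (lift y))))
  | _, .pair a b, _, v, y =>
      exF (m := 2) (a.graph (fun i => lift (v i)) (bv 0) ⊓
        (b.graph (fun i => lift (v i)) (bv 1) ⊓ pairF (bv 0) (bv 1) (lift y)))
  | _, .fst a, _, v, y =>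
      exF (m := 2) (a.graph (fun i => lift (v i)) (bv 0) ⊓ pairF (lift y) (bv 1) (bv 0))
  | _, .snd a, _, v, y =>
      exF (m := 2) (a.graph (fun i => lift (v i)) (bv 0) ⊓ pairF (bv 1) (lift y) (bv 0))
  | _, .ifLe a b c d, _, v, y =>
      exF (m := 2) (a.graph (fun i => lift (v i)) (bv 0) ⊓
        (b.graph (fun i => lift (v i)) (bv 1) ⊓
          ((leF (bv 0) (bv 1) ⊓ c.graph (fun i => lift (v i)) (lift y)) ⊔
            (ltF (bv 1) (bv 0) ⊓ d.graph (fun i => lift (v i)) (lift y)))))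
  | _, .comp (m := m) f g, _, v, y =>
      exF (m := m) (conj (fun j => (g j).graph (fun i => lift (v i)) (bv j)) ⊓
        f.graph bv (lift y))
  | _, .courseRec h₁ h₂ g, _, v, y =>
      -- `c = bv 0` and `d = bv 1` code the sequence
      exF (m := 2) (entryF (bv 0) (bv 1) (lift (v 0)) (lift y) ⊓
        allF (m := 1) ((leF (bv 0) (lift (lift (v 0)))).imp
          -- the index is `j`; `bv 0, …, bv 4` are `h₁ j`, `h₂ j`, the two values used, the entry
          (exF (m := 5) (conj
            ![h₁.graph (fun _ => lift (bv 0)) (bv 0),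
              h₂.graph (fun _ => lift (bv 0)) (bv 1),
              prevF (lift (lift (bv 0))) (lift (lift (bv 1))) (lift (bv 0)) (bv 0) (bv 2),
              prevF (lift (lift (bv 0))) (lift (lift (bv 1))) (lift (bv 0)) (bv 1) (bv 3),
              g.graph (Matrix.vecCons (lift (bv 0)) (Matrix.vecCons (bv 2) (Matrix.vecCons (bv 3)
                (fun i => lift (lift (lift (v i.succ))))))) (bv 4),
              entryF (lift (lift (bv 0))) (lift (lift (bv 1))) (lift (bv 0)) (bv 4)]))))

end Graph

/-! ## Ordinal notations below `ε₀`

The notation `0` is the number `0`, and `ω ^ a + b` is coded by `Nat.pair a b + 1`. A number is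
a notation if it is hereditarily in Cantor normal form (without coefficients: equal summands are
repeated). Truth values are `0` and `1`. -/

namespace Prog

variable {k : ℕ}

def one : Prog k := succ zero
def ifEq (a b c d : Prog k) : Prog k := ifLe a b (ifLe b a c d) d
/-- `if a = 0 then c else d`. -/
def ifZero (a c d : Prog k) : Prog k := ifLe a zero c d
def two : Prog k := succ one
def three : Prog k := succ two

/-- `ω ^ a + b`. -/
def node (a b : Prog k) : Prog k := succ (pair a b)
/-- The leading exponent `a` of `ω ^ a + b`. -/
def hd (a : Prog k) : Prog k := fst (pred a)
/-- The remainder `b` of `ω ^ a + b`. -/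
def tl (a : Prog k) : Prog k := snd (pred a)
/-- The ordinal `ω ^ a`. -/
def omegaPow (a : Prog k) : Prog k := node a zero
/-- The ordinal `1 = ω ^ 0`. -/
def ordOne : Prog k := omegaPow zero

/-- Recursion on ordinal notations: in the step `g`, variable `0` is the notation
`ω ^ a + b`, variables `1` and `2` are the values at `a` and at `b`, and the remaining
variables are the parameters. -/
def ordRec (g : Prog (k + 3)) : Prog (k + 1) := courseRec (hd (var 0)) (tl (var 0)) g

/-- Comparison of the notations `a` and `b`, given as `Nat.pair a b`: the value is `0` for `<`,
`1` for `=` and `2` for `>`. -/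
def cmpPair : Prog 1 :=
  courseRec (k := 0)
    (pair (hd (fst (var 0))) (hd (snd (var 0))))
    (pair (tl (fst (var 0))) (tl (snd (var 0))))
    (ifZero (fst (var 0)) (ifZero (snd (var 0)) one zero)
      (ifZero (snd (var 0)) two
        (ifEq (var 1) one (var 2) (var 1))))

def cmp (a b : Prog k) : Prog k := comp cmpPair ![pair a b]

/-- `if a < b then c else d`, for ordinals `a` and `b`. -/
def ifOrdLt (a b c d : Prog k) : Prog k := ifLe (cmp a b) zero c d
/-- `if a ≤ b then c else d`, for ordinals `a` and `b`. -/
def ifOrdLe (a b c d : Prog k) : Prog k := ifLe (cmp a b) one c d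

/-- Truth value of "variable `0` is (the notation of) an ordinal below `ε₀`". -/
def isOrdF : Prog 1 :=
  ordRec (k := 0)
    (ifZero (var 0) one
      (ifEq (var 1) one
        (ifEq (var 2) one
          (ifZero (tl (var 0)) one
            (ifOrdLe (hd (tl (var 0))) (hd (var 0)) one zero)) zero) zero))

def isOrd (a : Prog k) : Prog k := comp isOrdF ![a]

/-- The smallest exponent in the Cantor normal form of a nonzero ordinal. -/
def lastExpF : Prog 1 :=
  ordRec (k := 0) (ifZero (tl (var 0)) (hd (var 0)) (var 2))

def lastExp (a : Prog k) : Prog k := comp lastExpF ![a]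

/-- Ordinal addition. In `(ω ^ a + b) + c` the summand `ω ^ a` is absorbed if and only if `b + c`
is nonzero with leading exponent greater than `a`. -/
def addF : Prog 2 :=
  ordRec (k := 1)
    (ifZero (var 0) (var 3)
      (ifZero (var 2) (node (hd (var 0)) (var 2))
        (ifOrdLe (hd (var 2)) (hd (var 0)) (node (hd (var 0)) (var 2)) (var 2))))

def add (a b : Prog k) : Prog k := comp addF ![a, b]

/-- `ω ^ a · n` as a function of `n` (variable `0`) and `a` (variable `1`). -/
def omegaPowMulF : Prog 2 :=
  courseRec (k := 1) (pred (var 0)) zero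
    (ifZero (var 0) zero (node (var 3) (var 1)))

/-- `ω ^ a · n`. -/
def omegaPowMul (a n : Prog k) : Prog k := comp omegaPowMulF ![n, a]

/-- The fundamental sequences `{α}(n)`, as a function of `α` (variable `0`) and `n`
(variable `1`):
`{0}(n) = 0`, `{β + 1}(n) = β`, `{β + ω ^ (γ + 1)}(n) = β + ω ^ γ · (n + 1)` and
`{β + ω ^ γ}(n) = β + ω ^ {γ}(n)` for limits `γ`. -/
def fundF : Prog 2 :=
  ordRec (k := 1)
    (ifZero (var 0) zero
      (ifZero (tl (var 0))
        (ifZero (hd (var 0)) zero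
          (ifZero (lastExp (hd (var 0)))
            (omegaPowMul (var 1) (succ (var 3)))
            (omegaPow (var 1))))
        (node (hd (var 0)) (var 2))))

/-- `{a}(n)`. -/
def fund (a n : Prog k) : Prog k := comp fundF ![a, n]

/-- The `x`-fold iteration of `α ↦ {α}(n)`, as a function of `x` (variable `0`), `α`
(variable `1`) and `n` (variable `2`). -/
def fundIter : Prog 3 :=
  courseRec (k := 2) (pred (var 0)) zero
    (ifZero (var 0) (var 3) (fund (var 1) (var 4)))

/-- `if a meshes with c then t else e`, i.e. if `a = 0` or `c < ω ^ (a₀ + 1)` with `a₀` the smallest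
exponent in the Cantor normal form of `a`. -/
def ifMesh (a c t e : Prog k) : Prog k :=
  ifZero a t (ifOrdLt c (omegaPow (add (lastExp a) ordOne)) t e)

/-! ## Step-down arguments

The expressions are coded as follows; the ordinal tags can be computed and are not part of the
code.

* `Nat.pair 0 (Nat.pair m β) + 1` codes the basic step from `β` to `{β}(m)`,
* `Nat.pair 1 (Nat.pair s t) + 1` codes `s * t`, which uses `t` first and then `s`,
* `Nat.pair 2 (Nat.pair α s) + 1` codes `α + s`,
* `Nat.pair 3 (Nat.pair 0 s) + 1` codes `ω ^ s`. -/

def tag (a : Prog k) : Prog k := fst (pred a)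
def arg₁ (a : Prog k) : Prog k := fst (snd (pred a))
def arg₂ (a : Prog k) : Prog k := snd (snd (pred a))

/-- Recursion on the construction of step-down arguments, by cases on the outermost constructor.
In each case, variable `0` is the code, and variables `1` and `2` are the values at the two
components of the expression, where these are step-down arguments. -/
def argRec (basic star plus power : Prog 3) : Prog 1 :=
  courseRec (k := 0) (arg₁ (var 0)) (arg₂ (var 0))
    (ifZero (var 0) zero
      (ifEq (tag (var 0)) zero basic
        (ifEq (tag (var 0)) one star
          (ifEq (tag (var 0)) two plus
            (ifEq (tag (var 0)) three power zero)))))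

/-- The ordinal from which a step-down argument starts. -/
def topF : Prog 1 :=
  argRec (arg₂ (var 0)) (var 2) (add (arg₁ (var 0)) (var 2)) (omegaPow (var 2))

/-- The ordinal at which a step-down argument ends. -/
def botF : Prog 1 :=
  argRec (fund (arg₂ (var 0)) (arg₁ (var 0))) (var 1) (add (arg₁ (var 0)) (var 2))
    (omegaPow (var 2))

/-- The base: the maximal `m` that occurs in a basic step. -/
def baseF : Prog 1 :=
  argRec (arg₁ (var 0)) (ifLe (var 1) (var 2) (var 2) (var 1)) (var 2) (var 2)

def top (a : Prog k) : Prog k := comp topF ![a]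
def bot (a : Prog k) : Prog k := comp botF ![a]

/-- Truth value of "variable `0` is a step-down argument". -/
def isArgF : Prog 1 :=
  argRec
    (isOrd (arg₂ (var 0)))
    (ifEq (var 1) one (ifEq (var 2) one
      (ifEq (top (arg₁ (var 0))) (bot (arg₂ (var 0))) one zero) zero) zero)
    (ifEq (isOrd (arg₁ (var 0))) one (ifEq (var 2) one
      (ifMesh (arg₁ (var 0)) (top (arg₂ (var 0))) one zero) zero) zero)
    (ifZero (arg₁ (var 0)) (ifEq (var 2) one one zero) zero)

end Prog

/-! ## The formalized assertions -/

section Formulas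

variable {α : Type}

/-- The formula `a < ε₀` (`a` is an ordinal notation). -/
def ordinalF (a : arith.Term α) : arith.Formula α := Prog.isOrdF.graph ![a] (succT zeroT)

/-- The formula `s ⊢ b ≤ₙ a`: `s` is a step-down argument which starts at `a`, ends at `b` and has
base at most `n`. -/
def argumentF (s b n a : arith.Term α) : arith.Formula α :=
  conj
    ![Prog.isArgF.graph ![s] (succT zeroT),
      Prog.topF.graph ![s] a,
      Prog.botF.graph ![s] b,
      exF (m := 1) (Prog.baseF.graph ![lift s] (bv 0) ⊓ leF (bv 0) (lift n))]

/-- The formula `a ↘ₙ b`: there are `x` and `y ≤ x` such that `y` iterations of `{·}(n)`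
lead from `a` to `b`. -/
def stepsDownF (a n b : arith.Term α) : arith.Formula α :=
  exF (m := 1) (exF (m := 1) (leF (bv 0) (lift (bv 0)) ⊓
    Prog.fundIter.graph ![bv 0, lift (lift a), lift (lift n)] (lift (lift b))))

/-- The sentence "for all `s`, `β`, `n` and `α`: if `s ⊢ β ≤ₙ α` then `α ↘ₙ β`". -/
def stepDownFromArgument : arith.Sentence :=
  univClosure (k := 4) ((argumentF (x 0) (x 1) (x 2) (x 3)).imp (stepsDownF (x 3) (x 2) (x 1)))

/-- The sentence "for all `α < ε₀` and all `n`: `α ↘ₙ 0`". -/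
def stepDownToZero : arith.Sentence :=
  univClosure (k := 2) ((ordinalF (x 0)).imp (stepsDownF (x 0) (x 1) zeroT))

end Formulas

end StepDown

/-! By Gödel's completeness theorem (`provable_of_models`) it suffices that both sentences hold in
every model `M` of `IΣ₁`. The elements of `M` may be nonstandard, so an induction inside `M` is
available only for sets of low complexity. The classes `Sig`, `Pi` and `SigF` record definability by
`Σ₁`-formulas, and instance search checks the complexity of each induction.

The model is first shown to support primitive recursion. It is an ordered semiring and satisfies
`Σ₁`-collection, and Gödel's β-function codes all sequences with a `Σ₁`-definition (`exists_code`).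
Hence course-of-values recursion has a solution, every program has a value `ev` with `Σ₁`-graph, and
the graph formula defines this value (`realize_graph`). Recursion equations such as `mfund_nd` then
hold for all elements of `M`.

The rest is the combinatorics of the `Σ₁`-relation `Reaches n a b`, that `b` arises from `a` by
iterating `{·}(n)`. Since `n` is fixed, no transfinite induction is needed: `Reaches.zero` shows by
induction on the code that everything descends to `0`. In `ω ^ a + b` the summand `b` is run down
first. For `ω ^ a` one follows the path from `a` to `0` backwards: with `g' = {g}(n)`, one step
leads from `ω ^ g` to `ω ^ g'` or to `ω ^ g' · (n + 1)`, and if `ω ^ g'` descends to `0`, then the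
finitely many copies do so one after the other.

Running down all copies but one shows that `ω ^ g` reaches `ω ^ g'` in both cases, so the relation
is preserved by `ω ^ ·` (`Reaches.nd_left`). It also contains the steps to `{a}(m)` for `m ≤ n`
(`Reaches.fund_of_le`), and it is preserved by `α + ·` under meshing, because then `{α + γ}(n) = α +
{γ}(n)` for `γ ≠ 0` (`mfund_madd`). Together with transitivity these facts match the four rules for
step-down arguments, and `Σ₁`-induction on the code of the argument (`reaches_of_misArg`) gives the
first claim. -/

namespace StepDown

open FirstOrder FirstOrder.Language

/-! ## Simultaneous substitution for free and bound variables -/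

section Substitution

variable {L : FirstOrder.Language.{0, 0}} {α β γ : Type}

/-- A substitution, pushed below a quantifier. -/
def upSubst {n m : ℕ} (σ : α ⊕ Fin n → L.Term (β ⊕ Fin m)) :
    α ⊕ Fin (n + 1) → L.Term (β ⊕ Fin (m + 1)) :=
  Sum.elim (fun a => (σ (.inl a)).relabel (Sum.map id Fin.castSucc))
    (Fin.lastCases (Term.var (.inr (Fin.last m)))
      (fun i => (σ (.inr i)).relabel (Sum.map id Fin.castSucc)))

/-- Simultaneous substitution of terms for all variables in scope. -/
def bsubst : {n m : ℕ} → L.BoundedFormula α n → (α ⊕ Fin n → L.Term (β ⊕ Fin m)) →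
    L.BoundedFormula β m
  | _, _, .falsum, _ => .falsum
  | _, _, .equal s t, σ => .equal (s.subst σ) (t.subst σ)
  | _, _, .rel R ts, σ => .rel R fun i => (ts i).subst σ
  | _, _, .imp φ ψ, σ => .imp (bsubst φ σ) (bsubst ψ σ)
  | _, _, .all φ, σ => .all (bsubst φ (upSubst σ))

theorem term_subst_subst (t : L.Term α) (σ : α → L.Term β) (τ : β → L.Term γ) :
    (t.subst σ).subst τ = t.subst fun a => (σ a).subst τ := by
  induction t with
  | var => rfl
  | func f ts ih => simp [ih]

theorem term_relabel_eq_subst (t : L.Term α) (g : α → β) :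
    t.relabel g = t.subst fun a => Term.var (g a) := by
  induction t with
  | var => rfl
  | func f ts ih => simp [ih]

theorem term_subst_var (t : L.Term α) : t.subst Term.var = t := by
  induction t with
  | var => rfl
  | func f ts ih => simp [ih]

theorem upSubst_subst {n m k : ℕ} (σ : α ⊕ Fin n → L.Term (β ⊕ Fin m))
    (τ : β ⊕ Fin m → L.Term (γ ⊕ Fin k)) :
    (fun a => (upSubst σ a).subst (upSubst τ)) = upSubst fun a => (σ a).subst τ := by
  have key : ∀ t : L.Term (β ⊕ Fin m), (t.relabel (Sum.map id Fin.castSucc)).subst (upSubst τ) =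
      (t.subst τ).relabel (Sum.map id Fin.castSucc) := by
    intro t
    rw [term_relabel_eq_subst, term_relabel_eq_subst, term_subst_subst, term_subst_subst]
    congr 1
    funext a
    rcases a with a | i <;> simp [upSubst, term_relabel_eq_subst]
  funext a
  rcases a with a | i
  · exact key _
  · refine Fin.lastCases ?_ (fun i => ?_) i
    · simp [upSubst]
    · simp only [upSubst, Sum.elim_inr, Fin.lastCases_castSucc]
      exact key _

theorem upSubst_var {n : ℕ} :
    upSubst (Term.var : α ⊕ Fin n → L.Term (α ⊕ Fin n)) = Term.var := by
  funext a
  rcases a with a | i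
  · rfl
  · refine Fin.lastCases ?_ (fun i => ?_) i <;> simp [upSubst]

theorem bsubst_bsubst {n m k : ℕ} (φ : L.BoundedFormula α n) (σ : α ⊕ Fin n → L.Term (β ⊕ Fin m))
    (τ : β ⊕ Fin m → L.Term (γ ⊕ Fin k)) :
    bsubst (bsubst φ σ) τ = bsubst φ fun a => (σ a).subst τ := by
  induction φ generalizing m k with
  | falsum => rfl
  | equal => simp [bsubst, term_subst_subst]
  | rel => simp [bsubst, term_subst_subst]
  | imp _ _ h₁ h₂ => simp [bsubst, h₁, h₂]
  | all _ h => simp [bsubst, h, upSubst_subst]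

theorem bsubst_var {n : ℕ} (φ : L.BoundedFormula α n) : bsubst φ Term.var = φ := by
  induction φ with
  | falsum => rfl
  | equal => simp [bsubst, term_subst_var]
  | rel => simp [bsubst, term_subst_var]
  | imp _ _ h₁ h₂ => simp [bsubst, h₁, h₂]
  | all _ h => simp [bsubst, h, upSubst_var]

theorem realize_bsubst {M : Type} [L.Structure M] {n m : ℕ} (φ : L.BoundedFormula α n)
    (σ : α ⊕ Fin n → L.Term (β ⊕ Fin m)) (v : β → M) (xs : Fin m → M) :
    (bsubst φ σ).Realize v xs ↔
      φ.Realize (fun a => (σ (.inl a)).realize (Sum.elim v xs))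
        (fun i => (σ (.inr i)).realize (Sum.elim v xs)) := by
  have hs : ∀ {n m : ℕ} (t : L.Term (α ⊕ Fin n)) (σ : α ⊕ Fin n → L.Term (β ⊕ Fin m))
      (xs : Fin m → M), (t.subst σ).realize (Sum.elim v xs) =
      t.realize (Sum.elim (fun a => (σ (.inl a)).realize (Sum.elim v xs))
        (fun i => (σ (.inr i)).realize (Sum.elim v xs))) := by
    intro n m t σ xs
    rw [Term.realize_subst]
    congr 1
    funext a
    rcases a with a | i <;> rfl
  induction φ generalizing m with
  | falsum => rfl
  | equal => simp [bsubst, BoundedFormula.Realize, hs]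
  | rel => simp [bsubst, BoundedFormula.Realize, hs]
  | imp _ _ h₁ h₂ => simp [bsubst, h₁, h₂]
  | all φ h =>
    simp only [bsubst, BoundedFormula.realize_all, h]
    refine forall_congr' fun x => ?_
    have e : ∀ t : L.Term (β ⊕ Fin m), (t.relabel (Sum.map id Fin.castSucc)).realize
        (Sum.elim v (Fin.snoc xs x : Fin (m + 1) → M)) = t.realize (Sum.elim v xs) := by
      intro t
      rw [Term.realize_relabel]
      congr 1
      funext a
      rcases a with a | i <;> simp
    have e₁ : (fun a => (upSubst σ (.inl a)).realize (Sum.elim v (Fin.snoc xs x : Fin (m + 1) → M)))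
        = fun a => (σ (.inl a)).realize (Sum.elim v xs) := by
      funext a
      exact e _
    have e₂ : (fun i => (upSubst σ (.inr i)).realize (Sum.elim v (Fin.snoc xs x : Fin (m + 1) → M)))
        = Fin.snoc (fun i => (σ (.inr i)).realize (Sum.elim v xs)) x := by
      funext i
      refine Fin.lastCases ?_ (fun i => ?_) i
      · simp [upSubst]
      · simp [upSubst, e]
    rw [e₁, e₂]

/-- With `subst_eq_bsubst` and `toFormula_eq_bsubst` this reduces all operations on formulas in the
deduction rules to one kind of substitution. Identities between them then follow from the
composition law `bsubst_bsubst` by comparing values at variables. -/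
theorem relabel_eq_bsubst {n k : ℕ} (φ : L.BoundedFormula α k) (g : α → β ⊕ Fin n) :
    φ.relabel g = bsubst φ fun a => Term.var (BoundedFormula.relabelAux g k a) := by
  induction φ with
  | falsum => rfl
  | equal => simp [BoundedFormula.relabel, BoundedFormula.mapTermRel, bsubst, term_relabel_eq_subst]
  | rel => simp [BoundedFormula.relabel, BoundedFormula.mapTermRel, bsubst, term_relabel_eq_subst]
  | imp _ _ h₁ h₂ => simp [bsubst, h₁, h₂]
  | @all k φ h =>
    rw [BoundedFormula.relabel_all, h, bsubst]
    congr 2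
    funext a
    rcases a with a | i
    · simp only [BoundedFormula.relabelAux, upSubst, Function.comp, Sum.map_inl, Sum.elim_inl]
      rcases g a with b | j
      · simp
      · simp
        rfl
    · refine Fin.lastCases ?_ (fun i => ?_) i
      · simp [BoundedFormula.relabelAux, upSubst]
      · simp [BoundedFormula.relabelAux, upSubst]

theorem subst_eq_bsubst {n : ℕ} (φ : L.BoundedFormula α n) (f : α → L.Term β) :
    φ.subst f = bsubst φ (Sum.elim (fun a => (f a).relabel Sum.inl) fun i => Term.var (.inr i)) := by
  rw [BoundedFormula.subst]
  induction φ with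
  | falsum => rfl
  | equal => rfl
  | rel => rfl
  | imp _ _ h₁ h₂ => simp [bsubst, h₁, h₂, BoundedFormula.mapTermRel]
  | all φ h =>
    simp only [bsubst, h, BoundedFormula.mapTermRel, id]
    congr 2
    funext a
    rcases a with a | i
    · simp [upSubst]
      rfl
    · refine Fin.lastCases ?_ (fun i => ?_) i <;> simp [upSubst]

theorem toFormula_eq_bsubst {n : ℕ} (φ : L.BoundedFormula α n) :
    φ.toFormula = bsubst φ fun a => Term.var (.inl a) := by
  induction φ with
  | falsum => rfl
  | equal => simp [bsubst, Term.equal, Term.bdEqual, term_relabel_eq_subst]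
  | rel => simp [bsubst, Relations.formula, Relations.boundedFormula, term_relabel_eq_subst]
  | imp _ _ h₁ h₂ => simp [bsubst, h₁, h₂]
  | @all n φ h =>
    rw [BoundedFormula.toFormula, h, relabel_eq_bsubst, bsubst_bsubst, bsubst]
    congr 2
    funext a
    rcases a with a | i
    · simp [upSubst, BoundedFormula.relabelAux]
    · refine Fin.lastCases ?_ (fun i => ?_) i
      · have : finSumFinEquiv.symm (Fin.last n) = (Sum.inr 0 : Fin n ⊕ Fin 1) := by
          rw [Equiv.symm_apply_eq]; rfl
        simp [upSubst, BoundedFormula.relabelAux, this]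
        rfl
      · have : finSumFinEquiv.symm i.castSucc = (Sum.inl i : Fin n ⊕ Fin 1) := by
          rw [Equiv.symm_apply_eq]; rfl
        simp [upSubst, BoundedFormula.relabelAux, this]

theorem inst_eq_bsubst (φ : L.BoundedFormula ℕ 1) (t : L.Term ℕ) :
    inst φ t = bsubst φ (Sum.elim (fun a => Term.var (.inl a)) fun _ => t.relabel Sum.inl) := by
  rw [inst, toFormula_eq_bsubst, subst_eq_bsubst, bsubst_bsubst]
  congr 1
  funext a
  rcases a with a | i <;> simp

theorem biUnion_univ_eq_empty {n : ℕ} (f : Fin n → Finset ℕ) :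
    Finset.univ.biUnion f = ∅ ↔ ∀ i, f i = ∅ := by
  simp only [Finset.eq_empty_iff_forall_notMem, Finset.mem_biUnion, Finset.mem_univ, true_and,
    not_exists]
  exact forall_comm

/-- A substitution without free variables in its values yields a formula without free variables. -/
theorem freeVarFinset_bsubst {n m : ℕ} (φ : L.BoundedFormula α n)
    (σ : α ⊕ Fin n → L.Term (ℕ ⊕ Fin m)) (h : ∀ a, (σ a).varFinsetLeft = ∅) :
    (bsubst φ σ).freeVarFinset = ∅ := by
  have hs : ∀ {n m : ℕ} (t : L.Term (α ⊕ Fin n)) (σ : α ⊕ Fin n → L.Term (ℕ ⊕ Fin m)),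
      (∀ a, (σ a).varFinsetLeft = ∅) → (t.subst σ).varFinsetLeft = ∅ := by
    intro n m t σ h
    induction t with
    | var a => exact h a
    | func f ts ih => exact (biUnion_univ_eq_empty _).2 ih
  induction φ generalizing m with
  | falsum => rfl
  | equal => simp [bsubst, hs _ σ h]
  | rel => exact (biUnion_univ_eq_empty _).2 fun i => hs _ σ h
  | imp _ _ h₁ h₂ => simp [bsubst, h₁ σ h, h₂ σ h]
  | all φ ih =>
    refine ih _ fun a => ?_
    have e : ∀ t : L.Term (ℕ ⊕ Fin m), t.varFinsetLeft = ∅ →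
        (t.relabel (Sum.map id (Fin.castSucc : Fin m → Fin (m + 1)))).varFinsetLeft = ∅ := by
      intro t ht
      induction t with
      | var a =>
        rcases a with a | i
        · simp at ht
        · rfl
      | func f ts ih =>
        exact (biUnion_univ_eq_empty _).2 fun i => ih i ((biUnion_univ_eq_empty _).1 ht i)
    rcases a with a | i
    · exact e _ (h _)
    · refine Fin.lastCases ?_ (fun i => ?_) i
      · simp [upSubst]
      · simpa [upSubst] using e _ (h (.inr i))

end Substitution

/-! ## The completeness theorem -/

section Completeness

variable {L : FirstOrder.Language.{0, 0}} {Γ Δ : Set (L.Formula ℕ)} {φ ψ : L.Formula ℕ}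

/-- Finiteness of derivations is what makes the union of a chain of consistent sets consistent, both
in the Henkin construction and for Zorn's lemma. -/
theorem Derives.exists_finite (h : Derives Γ φ) : ∃ Δ ⊆ Γ, Δ.Finite ∧ Derives Δ φ := by
  induction h with
  | @assumption Γ φ h => exact ⟨{φ}, by simpa using h, Set.finite_singleton _, .assumption rfl⟩
  | weakening hs _ ih =>
    obtain ⟨Δ, h, hf, hd⟩ := ih
    exact ⟨Δ, h.trans hs, hf, hd⟩
  | @impIntro Γ φ ψ _ ih =>
    obtain ⟨Δ, h, hf, hd⟩ := ih
    refine ⟨Δ \ {φ}, by simpa [Set.sdiff_subset_iff] using h, hf.sdiff, .impIntro (.weakening ?_ hd)⟩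
    simp
  | impElim _ _ ih₁ ih₂ =>
    obtain ⟨Δ₁, h₁, hf₁, hd₁⟩ := ih₁
    obtain ⟨Δ₂, h₂, hf₂, hd₂⟩ := ih₂
    exact ⟨Δ₁ ∪ Δ₂, Set.union_subset h₁ h₂, hf₁.union hf₂,
      .impElim (.weakening Set.subset_union_left hd₁) (.weakening Set.subset_union_right hd₂)⟩
  | @byContradiction Γ φ _ ih =>
    obtain ⟨Δ, h, hf, hd⟩ := ih
    refine ⟨Δ \ {φ.not}, by simpa [Set.sdiff_subset_iff] using h, hf.sdiff,
      .byContradiction (.weakening ?_ hd)⟩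
    simp
  | allIntro x hx hφ _ ih =>
    obtain ⟨Δ, h, hf, hd⟩ := ih
    exact ⟨Δ, h, hf, .allIntro x (fun ψ hψ => hx ψ (h hψ)) hφ hd⟩
  | allElim t _ ih =>
    obtain ⟨Δ, h, hf, hd⟩ := ih
    exact ⟨Δ, h, hf, .allElim t hd⟩
  | eqRefl t => exact ⟨∅, Set.empty_subset _, Set.finite_empty, .eqRefl t⟩
  | eqSubst φ _ _ ih₁ ih₂ =>
    obtain ⟨Δ₁, h₁, hf₁, hd₁⟩ := ih₁
    obtain ⟨Δ₂, h₂, hf₂, hd₂⟩ := ih₂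
    exact ⟨Δ₁ ∪ Δ₂, Set.union_subset h₁ h₂, hf₁.union hf₂,
      .eqSubst φ (.weakening Set.subset_union_left hd₁) (.weakening Set.subset_union_right hd₂)⟩

def Consistent (Γ : Set (L.Formula ℕ)) : Prop := ¬ Derives Γ ⊥

theorem Derives.exfalso (h : Derives Γ ⊥) : Derives Γ φ :=
  .byContradiction (.weakening (Set.subset_insert _ _) h)

theorem consistent_sUnion {c : Set (Set (L.Formula ℕ))} (hc : IsChain (· ⊆ ·) c)
    (hne : c.Nonempty) (h : ∀ Γ ∈ c, Consistent Γ) : Consistent (⋃₀ c) := by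
  intro hd
  obtain ⟨Δ, hs, hf, hd⟩ := hd.exists_finite
  obtain ⟨Γ, hΓ, hsub⟩ := hc.directedOn.exists_mem_subset_of_finite_of_subset_sUnion hne hf hs
  exact h Γ hΓ (.weakening hsub hd)

/-- All but finitely many variables do not occur freely in `Γ`. -/
def BoundedVars (Γ : Set (L.Formula ℕ)) : Prop :=
  ∃ N, ∀ ψ ∈ Γ, ∀ x ∈ ψ.freeVarFinset, x < N

/-- If the witness axiom for a fresh variable were refutable, `Γ` would derive both the instance at
this variable and the negation of the universal formula. Generalization over the fresh variable
contradicts this. Free variables serve as Henkin constants, so the language need not be extended. -/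
theorem exists_witness (hc : Consistent Γ) (hb : BoundedVars Γ) (φ : L.BoundedFormula ℕ 1) :
    ∃ x : ℕ, Consistent (insert ((inst φ (Term.var x)).imp φ.all) Γ) := by
  obtain ⟨N, hN⟩ := hb
  obtain ⟨x, hx⟩ := (Finset.range N ∪ φ.freeVarFinset).exists_notMem
  simp only [Finset.mem_union, Finset.mem_range, not_or, not_lt] at hx
  refine ⟨x, fun hd => hc ?_⟩
  have h₁ : Derives Γ (((inst φ (Term.var x)).imp φ.all).imp ⊥) := .impIntro hd
  have h₂ : Derives Γ (inst φ (Term.var x)) := by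
    refine .byContradiction (.impElim (.weakening (Set.subset_insert _ _) h₁) (.impIntro ?_))
    exact Derives.exfalso (.impElim (φ := inst φ (Term.var x))
      (.assumption (Set.mem_insert_of_mem _ (Set.mem_insert _ _)))
      (.assumption (Set.mem_insert _ _)))
  have h₃ : Derives Γ φ.all :=
    .allIntro x (fun ψ hψ hx' => absurd (hN ψ hψ x hx') (not_lt.2 hx.1)) hx.2 h₂
  exact .impElim h₁ (.impIntro (.weakening (Set.subset_insert _ _) h₃))

theorem BoundedVars.insert (hb : BoundedVars Γ) (φ : L.Formula ℕ) :
    BoundedVars (insert φ Γ) := by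
  obtain ⟨N, hN⟩ := hb
  refine ⟨max N (φ.freeVarFinset.sup id + 1), ?_⟩
  rintro ψ (rfl | hψ) x hx
  · exact lt_max_of_lt_right (Nat.lt_succ_of_le (Finset.le_sup (f := id) hx))
  · exact lt_max_of_lt_left (hN ψ hψ x hx)

/-- `Γ` contains witnesses for the failure of universal formulas. -/
def IsHenkin (Γ : Set (L.Formula ℕ)) : Prop :=
  ∀ φ : L.BoundedFormula ℕ 1, ∃ x : ℕ, (inst φ (Term.var x)).imp φ.all ∈ Γ

/-- The formulas are enumerated and one witness axiom is added per stage. Each stage keeps the free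
variables bounded, so a fresh variable is always left for the next one. -/
theorem exists_henkin [Countable (L.BoundedFormula ℕ 1)] (hc : Consistent Γ)
    (hb : BoundedVars Γ) : ∃ Δ, Γ ⊆ Δ ∧ Consistent Δ ∧ IsHenkin Δ := by
  have : Nonempty (L.BoundedFormula ℕ 1) := ⟨.falsum⟩
  obtain ⟨e, he⟩ := exists_surjective_nat (L.BoundedFormula ℕ 1)
  choose w hw using fun (Γ : {Γ : Set (L.Formula ℕ) // Consistent Γ ∧ BoundedVars Γ}) =>
    exists_witness Γ.2.1 Γ.2.2
  let S : ℕ → {Γ : Set (L.Formula ℕ) // Consistent Γ ∧ BoundedVars Γ} := fun n =>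
    Nat.rec ⟨Γ, hc, hb⟩ (fun n Γ => ⟨_, hw Γ (e n), Γ.2.2.insert _⟩) n
  have hmono : Monotone fun n => (S n).1 := monotone_nat_of_le_succ fun n => Set.subset_insert _ _
  refine ⟨⋃₀ Set.range fun n => (S n).1, ?_, ?_, ?_⟩
  · exact Set.subset_sUnion_of_mem ⟨0, rfl⟩
  · refine consistent_sUnion hmono.isChain_range ⟨_, 0, rfl⟩ ?_
    rintro _ ⟨n, rfl⟩
    exact (S n).2.1
  · intro φ
    obtain ⟨n, rfl⟩ := he φ
    exact ⟨w (S n) (e n), Set.mem_sUnion.2 ⟨_, ⟨n + 1, rfl⟩, Set.mem_insert _ _⟩⟩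

/-- Maximal consistent sets with witnesses. -/
structure IsComplete (Γ : Set (L.Formula ℕ)) : Prop where
  consistent : Consistent Γ
  henkin : IsHenkin Γ
  mem_of_consistent : ∀ φ, Consistent (insert φ Γ) → φ ∈ Γ

/-- The witness axioms come before maximization: they survive in every larger set, whereas a maximal
set has no fresh variables left. -/
theorem exists_complete [Countable (L.BoundedFormula ℕ 1)] (hc : Consistent Γ)
    (hb : BoundedVars Γ) : ∃ Δ, Γ ⊆ Δ ∧ IsComplete Δ := by
  obtain ⟨Γ', hΓ', hc', hh⟩ := exists_henkin hc hb
  obtain ⟨Δ, hΔ, hmax⟩ := zorn_subset_nonempty {Δ : Set (L.Formula ℕ) | Consistent Δ}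
    (fun c hc hchain hne => ⟨⋃₀ c, consistent_sUnion hchain hne hc,
      fun s hs => Set.subset_sUnion_of_mem hs⟩) Γ' hc'
  refine ⟨Δ, hΓ'.trans hΔ, hmax.prop, fun φ => (hh φ).imp fun x hx => hΔ hx, fun φ hφ => ?_⟩
  exact hmax.le_of_ge (y := insert φ Δ) hφ (Set.subset_insert _ _) (Set.mem_insert _ _)

namespace IsComplete

theorem mem_iff (hΓ : IsComplete Γ) : φ ∈ Γ ↔ Derives Γ φ := by
  refine ⟨.assumption, fun h => hΓ.mem_of_consistent _ fun h' => hΓ.consistent ?_⟩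
  exact .impElim (.impIntro h') h

theorem bot_notMem (hΓ : IsComplete Γ) : (⊥ : L.Formula ℕ) ∉ Γ := fun h => hΓ.consistent (.assumption h)

theorem imp_mem (hΓ : IsComplete Γ) : φ.imp ψ ∈ Γ ↔ (φ ∈ Γ → ψ ∈ Γ) := by
  constructor
  · intro h h'
    exact hΓ.mem_iff.2 (.impElim (.assumption h) (.assumption h'))
  · intro h
    by_cases hφ : φ ∈ Γ
    · exact hΓ.mem_iff.2 (.impIntro (.weakening (Set.subset_insert _ _) (.assumption (h hφ))))
    · have : ¬ Consistent (insert φ Γ) := fun h' => hφ (hΓ.mem_of_consistent _ h')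
      exact hΓ.mem_iff.2 (.impIntro (Derives.exfalso (not_not.1 this)))

theorem all_mem (hΓ : IsComplete Γ) (φ : L.BoundedFormula ℕ 1) : φ.all ∈ Γ ↔ ∀ t, inst φ t ∈ Γ := by
  constructor
  · exact fun h t => hΓ.mem_iff.2 (.allElim t (.assumption h))
  · intro h
    obtain ⟨x, hx⟩ := hΓ.henkin φ
    exact hΓ.imp_mem.1 hx (h _)

theorem eq_refl (hΓ : IsComplete Γ) (t : L.Term ℕ) : t.equal t ∈ Γ := hΓ.mem_iff.2 (.eqRefl t)

/-- Substitution of equals for a single variable. -/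
theorem eq_subst (hΓ : IsComplete Γ) (φ : L.BoundedFormula ℕ 1) {s t : L.Term ℕ} (h : s.equal t ∈ Γ)
    (h' : inst φ s ∈ Γ) : inst φ t ∈ Γ :=
  hΓ.mem_iff.2 (.eqSubst φ (.assumption h) (.assumption h'))

/-- Simultaneous substitution of equals. -/
theorem eq_subst_fin (hΓ : IsComplete Γ) {n : ℕ} (φ : L.Formula (ℕ ⊕ Fin n)) {s t : Fin n → L.Term ℕ}
    (h : ∀ i, (s i).equal (t i) ∈ Γ) (h' : φ.subst (Sum.elim Term.var s) ∈ Γ) :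
    φ.subst (Sum.elim Term.var t) ∈ Γ := by
  classical
  -- The deduction rule replaces a single term, so the `s i` are exchanged for the `t i` one index
  -- at a time; `u` is the set of indices already treated.
  suffices H : ∀ u : Finset (Fin n), φ.subst (Sum.elim Term.var (u.piecewise t s)) ∈ Γ by
    simpa using H Finset.univ
  intro u
  induction u using Finset.induction_on with
  | empty => simpa using h'
  | @insert i u hi ih =>
    rw [Finset.piecewise_insert]
    -- In `ψ` only the place `i` is open; all other places carry their current terms.
    let ψ : L.BoundedFormula ℕ 1 := bsubst φ (Sum.elim (Sum.elim (fun a => Term.var (.inl a))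
      (Function.update (fun j => (u.piecewise t s j).relabel Sum.inl) i (Term.var (.inr 0))))
      Fin.elim0)
    have key : ∀ r, inst ψ r =
        φ.subst (Sum.elim Term.var (Function.update (u.piecewise t s) i r)) := by
      intro r
      rw [inst_eq_bsubst, bsubst_bsubst, subst_eq_bsubst]
      congr 1
      funext a
      rcases a with (a | j) | j
      · rfl
      · by_cases hj : j = i
        · subst hj
          simp only [Sum.elim_inl, Sum.elim_inr, Function.update_self, Term.subst]
        · simp only [Sum.elim_inl, Sum.elim_inr, Function.update_of_ne hj, term_relabel_eq_subst,
            term_subst_subst, Term.subst]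
      · exact j.elim0
    rw [← key]
    refine hΓ.eq_subst ψ (h i) ?_
    rw [key]
    have : u.piecewise t s i = s i := by simp [hi]
    rw [← this, Function.update_eq_self]
    exact ih

theorem subst_equal {α β : Type} (s t : L.Term α) (σ : α → L.Term β) :
    BoundedFormula.subst (s.equal t) σ = (s.subst σ).equal (t.subst σ) := by
  rw [subst_eq_bsubst]
  simp only [Term.equal, Term.bdEqual, bsubst, term_relabel_eq_subst, term_subst_subst]
  rfl

/-- Replace `s` by `t` on the left of `s = s`. -/
theorem eq_symm (hΓ : IsComplete Γ) {s t : L.Term ℕ} (h : s.equal t ∈ Γ) : t.equal s ∈ Γ := by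
  have := hΓ.eq_subst_fin (n := 1) ((Term.var (.inr 0)).equal (s.relabel Sum.inl))
    (s := fun _ => s) (t := fun _ => t) (fun _ => h)
  simp only [subst_equal, term_relabel_eq_subst, term_subst_subst, Term.subst, Sum.elim_inr,
    Sum.elim_inl, term_subst_var] at this
  exact this (hΓ.eq_refl s)

theorem eq_trans (hΓ : IsComplete Γ) {s t u : L.Term ℕ} (h : s.equal t ∈ Γ) (h' : t.equal u ∈ Γ) :
    s.equal u ∈ Γ := by
  have := hΓ.eq_subst_fin (n := 1) ((s.relabel Sum.inl).equal (Term.var (.inr 0)))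
    (s := fun _ => t) (t := fun _ => u) (fun _ => h')
  simp only [subst_equal, term_relabel_eq_subst, term_subst_subst, Term.subst, Sum.elim_inr,
    Sum.elim_inl, term_subst_var] at this
  exact this h

theorem func_congr (hΓ : IsComplete Γ) {n : ℕ} (f : L.Functions n) {s t : Fin n → L.Term ℕ}
    (h : ∀ i, (s i).equal (t i) ∈ Γ) : (Term.func f s).equal (Term.func f t) ∈ Γ := by
  have := hΓ.eq_subst_fin (((Term.func f s).relabel Sum.inl).equal
    (Term.func f fun i => Term.var (.inr i))) h
  simp only [subst_equal, term_relabel_eq_subst, term_subst_subst, Term.subst, Sum.elim_inr,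
    Sum.elim_inl, term_subst_var] at this
  exact this (hΓ.eq_refl _)

theorem rel_congr (hΓ : IsComplete Γ) {n : ℕ} (R : L.Relations n) {s t : Fin n → L.Term ℕ}
    (h : ∀ i, (s i).equal (t i) ∈ Γ) (h' : R.formula s ∈ Γ) : R.formula t ∈ Γ := by
  have := hΓ.eq_subst_fin (R.formula fun i => Term.var (.inr i)) h
  simp only [subst_eq_bsubst, Relations.formula, Relations.boundedFormula, bsubst,
    Term.relabel, Term.subst, Sum.elim_inl, Sum.elim_inr] at this
  exact this h'

/-- Provable equality of terms. -/
@[reducible] def setoid (hΓ : IsComplete Γ) : Setoid (L.Term ℕ) where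
  r s t := s.equal t ∈ Γ
  iseqv := ⟨hΓ.eq_refl, hΓ.eq_symm, hΓ.eq_trans⟩

/-- The term model before division by provable equality; the congruence lemmas make its operations
and relations descend to the quotient. -/
instance prestructure (hΓ : IsComplete Γ) : L.Prestructure hΓ.setoid where
  toStructure :=
    { funMap := fun f ts => Term.func f ts
      RelMap := fun R ts => R.formula ts ∈ Γ }
  fun_equiv := fun _ _ h => hΓ.func_congr _ h
  rel_equiv := fun _ _ h => propext
    ⟨hΓ.rel_congr _ h, hΓ.rel_congr _ fun i => hΓ.eq_symm (h i)⟩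

theorem realize_term (hΓ : IsComplete Γ) {n : ℕ} (t : L.Term (ℕ ⊕ Fin n))
    (ts : Fin n → L.Term ℕ) :
      t.realize (M := Quotient hΓ.setoid)
      (Sum.elim (fun a => Quotient.mk _ (Term.var a)) fun i => Quotient.mk _ (ts i)) =
      Quotient.mk _ (t.subst (Sum.elim Term.var ts)) := by
  have e : (Sum.elim (fun a => Quotient.mk hΓ.setoid (Term.var a)) fun i => Quotient.mk _ (ts i)) =
      fun a => Quotient.mk hΓ.setoid (Sum.elim Term.var ts a) := by
    funext a
    rcases a with a | i <;> rfl
  rw [e, Term.realize_quotient_mk']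
  congr 1
  induction t with
  | var a => rfl
  | func f ts ih =>
    simp only [Term.realize, Term.subst]
    rw [funext ih]
    rfl

/-- The truth lemma: membership in `Γ` is truth in the term model. Under quantifiers the bound
variables are evaluated at classes of terms, which corresponds to substituting these terms in the
formula. -/
theorem realize_iff (hΓ : IsComplete Γ) {n : ℕ} (φ : L.BoundedFormula ℕ n)
    (ts : Fin n → L.Term ℕ) :
      φ.Realize (M := Quotient hΓ.setoid) (fun a => Quotient.mk _ (Term.var a))
      (fun i => Quotient.mk _ (ts i)) ↔
      bsubst (m := 0) φ (Sum.elim (fun a => Term.var (.inl a)) fun i => (ts i).relabel Sum.inl)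
        ∈ Γ := by
  have hσ : ∀ {n : ℕ} (t : L.Term (ℕ ⊕ Fin n)) (ts : Fin n → L.Term ℕ),
      t.subst (Sum.elim (fun a => Term.var (.inl a)) fun i => (ts i).relabel Sum.inl) =
      (t.subst (Sum.elim Term.var ts)).relabel (Sum.inl : ℕ → ℕ ⊕ Fin 0) := by
    intro n t ts
    rw [term_relabel_eq_subst, term_subst_subst]
    congr 1
    funext a
    rcases a with a | i
    · rfl
    · simp [term_relabel_eq_subst]
  induction φ with
  | falsum => exact ⟨False.elim, hΓ.bot_notMem⟩
  | equal s t =>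
    simp only [BoundedFormula.Realize, bsubst]
    rw [realize_term hΓ s ts, realize_term hΓ t ts, Quotient.eq, hσ, hσ]
    rfl
  | rel R us =>
    simp only [BoundedFormula.Realize, bsubst, hσ, realize_term hΓ _ ts]
    exact relMap_quotient_mk' hΓ.setoid R _
  | imp φ ψ h₁ h₂ =>
    exact BoundedFormula.realize_imp.trans ((imp_congr (h₁ ts) (h₂ ts)).trans hΓ.imp_mem.symm)
  | @all n φ h =>
    rw [BoundedFormula.realize_all, bsubst, hΓ.all_mem]
    have key : ∀ t, inst (bsubst φ (upSubst (m := 0)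
        (Sum.elim (fun a => Term.var (.inl a)) fun i => (ts i).relabel Sum.inl))) t =
        bsubst (m := 0) φ (Sum.elim (fun a => Term.var (.inl a))
          fun i => ((Fin.snoc ts t : Fin (n + 1) → L.Term ℕ) i).relabel Sum.inl) := by
      intro t
      rw [inst_eq_bsubst, bsubst_bsubst]
      congr 1
      funext a
      rcases a with a | i
      · rfl
      · refine Fin.lastCases ?_ (fun i => ?_) i
        · simp [upSubst]
        · simp [upSubst, term_relabel_eq_subst, term_subst_subst]
    have e : ∀ t, (Fin.snoc (fun i => Quotient.mk hΓ.setoid (ts i)) (Quotient.mk _ t) :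
        Fin (n + 1) → Quotient hΓ.setoid) =
        fun i => Quotient.mk _ ((Fin.snoc ts t : Fin (n + 1) → L.Term ℕ) i) := by
      intro t
      funext i
      refine Fin.lastCases ?_ (fun i => ?_) i <;> simp
    constructor
    · intro H t
      rw [key]
      refine (h (Fin.snoc ts t)).1 ?_
      rw [← e]
      exact H _
    · intro H a
      -- Every element of the model is the class of a term, so the quantifier over the model amounts
      -- to a quantifier over the instances of the formula.
      induction a using Quotient.ind with
      | _ t =>
        rw [e]
        refine (h (Fin.snoc ts t)).2 ?_
        rw [← key]
        exact H t

theorem realize_sentence_iff (hΓ : IsComplete Γ) (σ : L.Sentence) :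
      (Quotient hΓ.setoid) ⊨ σ ↔ Formula.relabel (Empty.elim : Empty → ℕ) σ ∈ Γ := by
  have h := hΓ.realize_iff (Formula.relabel (Empty.elim : Empty → ℕ) σ) Fin.elim0
  have e : (Sum.elim (fun a => Term.var (.inl a)) fun i => (Fin.elim0 i : L.Term ℕ).relabel Sum.inl :
      ℕ ⊕ Fin 0 → L.Term (ℕ ⊕ Fin 0)) = Term.var := by
    funext a
    rcases a with a | i
    · rfl
    · exact i.elim0
  rw [e, bsubst_var] at h
  rw [← h, Sentence.Realize,
    Subsingleton.elim (fun i => Quotient.mk hΓ.setoid (Fin.elim0 i)) (default : Fin 0 → _)]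
  have h' := Formula.realize_relabel (φ := σ) (g := (Empty.elim : Empty → ℕ))
    (v := fun a => Quotient.mk hΓ.setoid (Term.var a))
  convert h'.symm
  unfold Formula.Realize
  congr! 1

end IsComplete

theorem freeVarFinset_relabel_empty (σ : L.Sentence) :
    (Formula.relabel (Empty.elim : Empty → ℕ) σ).freeVarFinset = ∅ := by
  rw [Formula.relabel, relabel_eq_bsubst]
  refine freeVarFinset_bsubst σ _ ?_
  rintro (a | i)
  · exact a.elim
  · exact i.elim0

/-- Gödel's completeness theorem. -/
theorem provable_of_models [Countable (L.BoundedFormula ℕ 1)] {T : L.Theory} {σ : L.Sentence}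
    (h : ∀ (M : Type) [L.Structure M] [Nonempty M], M ⊨ T → M ⊨ σ) : Provable T σ := by
  by_contra hσ
  set ρ : L.Sentence → L.Formula ℕ := fun τ => Formula.relabel (Empty.elim : Empty → ℕ) τ with hρ
  have hc : Consistent (insert (ρ σ).not (ρ '' T)) := fun hd => hσ (.byContradiction hd)
  have hb : BoundedVars (ρ '' T) := by
    refine ⟨0, ?_⟩
    rintro _ ⟨τ, -, rfl⟩ x hx
    rw [hρ, freeVarFinset_relabel_empty] at hx
    simp at hx
  obtain ⟨Δ, hΔ, hcomp⟩ := exists_complete hc (hb.insert _)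
  have : Nonempty (Quotient hcomp.setoid) := ⟨Quotient.mk _ (Term.var 0)⟩
  have hT : (Quotient hcomp.setoid) ⊨ T := by
    refine (Theory.model_iff _).2 fun τ hτ => ?_
    rw [hcomp.realize_sentence_iff]
    exact hΔ (Set.mem_insert_of_mem _ ⟨τ, hτ, rfl⟩)
  have h₁ := (hcomp.realize_sentence_iff σ).1 (h _ hT)
  have h₂ : (ρ σ).not ∈ Δ := hΔ (Set.mem_insert _ _)
  exact hcomp.bot_notMem (hcomp.imp_mem.1 h₂ h₁)

end Completeness

/-- The Henkin construction enumerates these formulas. -/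
instance : Countable (arith.BoundedFormula ℕ 1) := by
  have h₁ : Countable (Σ l, arith.Functions l) := by
    have : Function.Injective (fun f : (Σ l, ArithFunc l) => (match f with
      | ⟨_, .zero⟩ => 0 | ⟨_, .succ⟩ => 1 | ⟨_, .add⟩ => 2 | ⟨_, .mul⟩ => 3 : ℕ)) := by
      rintro ⟨_, _ | _ | _ | _⟩ ⟨_, _ | _ | _ | _⟩ h <;> simp_all
    exact this.countable
  have h₂ : Countable (Σ l, arith.Relations l) := by
    have : Function.Injective (fun f : (Σ l, ArithRel l) => (0 : ℕ)) := by
      rintro ⟨_, _ | _⟩ ⟨_, _ | _⟩ h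
      rfl
    exact this.countable
  have h₃ : Countable arith.Symbols := inferInstanceAs (Countable (_ ⊕ _))
  have h₄ : Function.Injective
      (fun φ => ⟨1, φ⟩ : arith.BoundedFormula ℕ 1 → Σ n, arith.BoundedFormula ℕ n) := by
    intro φ ψ h
    simpa using h
  exact h₄.countable

/-! ## Realization of the connectives -/

section Realize

variable {L : FirstOrder.Language.{0, 0}} {M : Type} [L.Structure M] {α : Type}

theorem realize_allF {m : ℕ} (φ : L.Formula (α ⊕ Fin m)) (v : α → M) :
    (allF φ).Realize v ↔ ∀ xs : Fin m → M, φ.Realize (Sum.elim v xs) := by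
  rw [allF, BoundedFormula.realize_alls]
  refine forall_congr' fun xs => ?_
  rw [BoundedFormula.realize_relabel, Formula.Realize]
  have e₁ : Sum.elim v (xs ∘ Fin.castAdd 0) ∘ (id : α ⊕ Fin m → α ⊕ Fin m) = Sum.elim v xs := rfl
  rw [e₁]
  congr! 1

theorem realize_exF {m : ℕ} (φ : L.Formula (α ⊕ Fin m)) (v : α → M) :
    (exF φ).Realize v ↔ ∃ xs : Fin m → M, φ.Realize (Sum.elim v xs) := by
  rw [exF, BoundedFormula.realize_exs]
  refine exists_congr fun xs => ?_
  rw [BoundedFormula.realize_relabel, Formula.Realize]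
  have e₁ : Sum.elim v (xs ∘ Fin.castAdd 0) ∘ (id : α ⊕ Fin m → α ⊕ Fin m) = Sum.elim v xs := rfl
  rw [e₁]
  congr! 1

theorem realize_univClosure {k : ℕ} (φ : L.Formula (Fin k)) :
    M ⊨ univClosure φ ↔ ∀ xs : Fin k → M, φ.Realize xs := by
  rw [univClosure, Sentence.Realize, realize_allF]
  refine forall_congr' fun xs => ?_
  rw [Formula.realize_relabel]
  rfl

theorem realize_conj {m : ℕ} (φ : Fin m → L.Formula α) (v : α → M) :
    (conj φ).Realize v ↔ ∀ i, (φ i).Realize v := by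
  rw [conj, Formula.Realize, BoundedFormula.realize_foldr_inf]
  simp only [List.mem_ofFn]
  exact Set.forall_mem_range

@[simp]
theorem realize_lift {m : ℕ} (t : L.Term α) (v : α → M) (xs : Fin m → M) :
    (lift t : L.Term (α ⊕ Fin m)).realize (Sum.elim v xs) = t.realize v := by
  simp [lift]

@[simp]
theorem realize_bv {m : ℕ} (i : Fin m) (v : α → M) (xs : Fin m → M) :
    (bv i : L.Term (α ⊕ Fin m)).realize (Sum.elim v xs) = xs i := rfl

theorem realize_formula_subst {β : Type} (φ : L.Formula α) (f : α → L.Term β) (v : β → M) :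
    Formula.Realize (BoundedFormula.subst φ f) v ↔ φ.Realize fun a => (f a).realize v :=
  BoundedFormula.realize_subst

end Realize

/-! ## Sets defined by bounded formulas -/

/-- The formula `θ` with renamed free variables. -/
def rename {α β : Type} {n : ℕ} (g : α → β ⊕ Fin n) (θ : arith.Formula α) :
    arith.BoundedFormula β n :=
  bsubst θ (Sum.elim (fun a => Term.var (g a)) Fin.elim0)

theorem term_relabel_castSucc_subst {L : FirstOrder.Language.{0, 0}} {β γ : Type} {m k : ℕ}
    (τ : β ⊕ Fin m → L.Term (γ ⊕ Fin k)) (t : L.Term (β ⊕ Fin m)) :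
    (t.relabel (Sum.map id Fin.castSucc)).subst (upSubst τ) =
      (t.subst τ).relabel (Sum.map id Fin.castSucc) := by
  rw [term_relabel_eq_subst, term_relabel_eq_subst, term_subst_subst, term_subst_subst]
  congr 1
  funext a
  rcases a with a | i <;> simp [upSubst, term_relabel_eq_subst]

theorem bsubst_ltB {α β : Type} {n m : ℕ} (s t : arith.Term (α ⊕ Fin n))
    (σ : α ⊕ Fin n → arith.Term (β ⊕ Fin m)) :
    bsubst (ltB s t) σ = ltB (s.subst σ) (t.subst σ) := by
  simp only [ltB, Relations.boundedFormula₂, Relations.boundedFormula, bsubst]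
  congr 1
  funext i
  fin_cases i <;> rfl

theorem IsDelta0.bsubst {α β : Type} {n m : ℕ} {φ : arith.BoundedFormula α n} (h : IsDelta0 φ)
    (σ : α ⊕ Fin n → arith.Term (β ⊕ Fin m)) : IsDelta0 (bsubst φ σ) := by
  induction h generalizing m with
  | falsum => exact .falsum
  | equal => exact .equal _ _
  | rel => exact .rel _ _
  | imp _ _ h₁ h₂ => exact .imp (h₁ σ) (h₂ σ)
  | ball t _ ih =>
    simp only [StepDown.bsubst, bsubst_ltB, term_relabel_castSucc_subst]
    have : (Term.var (Sum.inr (Fin.last _))).subst (upSubst σ) = Term.var (Sum.inr (Fin.last _)) := by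
      simp [upSubst]
    rw [this]
    exact .ball _ (ih _)
  | @bex n t φ _ ih =>
    have : (Term.var (Sum.inr (Fin.last n))).subst (upSubst σ) = Term.var (Sum.inr (Fin.last _)) := by
      simp [upSubst]
    have e : StepDown.bsubst (ltB (Term.var (Sum.inr (Fin.last n)))
        (t.relabel (Sum.map id Fin.castSucc)) ⊓ φ).ex σ =
        (ltB (Term.var (Sum.inr (Fin.last m))) ((t.subst σ).relabel (Sum.map id Fin.castSucc)) ⊓
          StepDown.bsubst φ (upSubst σ)).ex := by
      rw [← term_relabel_castSucc_subst, ← this, ← bsubst_ltB]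
      rfl
    rw [e]
    exact .bex _ (ih _)

theorem IsDelta0.rename {α β : Type} {n : ℕ} {θ : arith.Formula α} (h : IsDelta0 θ)
    (g : α → β ⊕ Fin n) : IsDelta0 (rename g θ) := h.bsubst _

section Arith

variable {M : Type} [arith.Structure M]

theorem realize_rename {α β : Type} {n : ℕ} (g : α → β ⊕ Fin n) (θ : arith.Formula α) (v : β → M)
    (xs : Fin n → M) : (rename g θ).Realize v xs ↔ θ.Realize (Sum.elim v xs ∘ g) := by
  rw [rename, realize_bsubst, Formula.Realize]
  congr! 1

instance : Zero M := ⟨Structure.funMap (L := arith) ArithFunc.zero ![]⟩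
instance : Add M := ⟨fun x y => Structure.funMap (L := arith) ArithFunc.add ![x, y]⟩
instance : Mul M := ⟨fun x y => Structure.funMap (L := arith) ArithFunc.mul ![x, y]⟩
instance : LT M := ⟨fun x y => Structure.RelMap (L := arith) ArithRel.lt ![x, y]⟩
/-- The successor in a structure for arithmetic. -/
def sc (x : M) : M := Structure.funMap (L := arith) ArithFunc.succ ![x]

section

variable {α : Type} (v : α → M) (s t : arith.Term α)

@[simp] theorem realize_zeroT : (zeroT : arith.Term α).realize v = 0 := by
  simp only [zeroT, Constants.term, Term.realize]
  change _ = Structure.funMap (L := arith) ArithFunc.zero ![]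
  congr 1
  exact Subsingleton.elim _ _

@[simp] theorem realize_succT_sc : (succT t).realize v = sc (t.realize v) :=
  Term.realize_functions_apply₁

@[simp] theorem realize_addT : (addT s t).realize v = s.realize v + t.realize v :=
  Term.realize_functions_apply₂

@[simp] theorem realize_mulT : (mulT s t).realize v = s.realize v * t.realize v :=
  Term.realize_functions_apply₂

theorem realize_ltF : (ltF s t).Realize v ↔ s.realize v < t.realize v :=
  Formula.realize_rel₂

theorem realize_ltB {n : ℕ} (s t : arith.Term (α ⊕ Fin n)) (xs : Fin n → M) :
    (ltB s t).Realize v xs ↔ s.realize (Sum.elim v xs) < t.realize (Sum.elim v xs) :=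
  BoundedFormula.realize_rel₂

end

/-- Functions given by terms with parameters. -/
def Poly {α : Type} (f : (α → M) → M) : Prop :=
  ∃ (β : Type) (_ : Finite β) (p : β → M) (t : arith.Term (α ⊕ β)),
    ∀ v, f v = t.realize (Sum.elim v p)

/-- Sets defined by bounded formulas with parameters. -/
def Delta {α : Type} (S : (α → M) → Prop) : Prop :=
  ∃ (β : Type) (_ : Finite β) (p : β → M) (θ : arith.Formula (α ⊕ β)), IsDelta0 θ ∧
    ∀ v, S v ↔ θ.Realize (Sum.elim v p)

/-- The assignment `v`, extended by the value `y` for one more variable. -/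
def ocons {α : Type} (y : M) (v : α → M) : Option α → M := fun o => o.elim y v

variable {α α' : Type}

theorem Poly.var (a : α) : Poly fun v : α → M => v a :=
  ⟨Empty, inferInstance, Empty.elim, Term.var (.inl a), fun _ => rfl⟩

theorem Poly.const (c : M) : Poly fun _ : α → M => c :=
  ⟨Unit, inferInstance, fun _ => c, Term.var (.inr ()), fun _ => rfl⟩

theorem Poly.sc {f : (α → M) → M} (hf : Poly f) : Poly fun v => sc (f v) := by
  obtain ⟨β, hβ, p, t, h⟩ := hf
  exact ⟨β, hβ, p, succT t, fun v => by simp [h]⟩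

theorem poly₂ {f g : (α → M) → M} (hf : Poly f) (hg : Poly g) :
    ∃ (β : Type) (_ : Finite β) (p : β → M) (s t : arith.Term (α ⊕ β)),
      (∀ v, f v = s.realize (Sum.elim v p)) ∧ ∀ v, g v = t.realize (Sum.elim v p) := by
  obtain ⟨β, hβ, p, s, hs⟩ := hf
  obtain ⟨γ, hγ, q, t, ht⟩ := hg
  refine ⟨β ⊕ γ, inferInstance, Sum.elim p q, s.relabel (Sum.map id Sum.inl),
    t.relabel (Sum.map id Sum.inr), fun v => ?_, fun v => ?_⟩
  · rw [hs, Term.realize_relabel]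
    congr 1
    funext a
    rcases a with a | b <;> rfl
  · rw [ht, Term.realize_relabel]
    congr 1
    funext a
    rcases a with a | b <;> rfl

theorem Poly.add {f g : (α → M) → M} (hf : Poly f) (hg : Poly g) : Poly fun v => f v + g v := by
  obtain ⟨β, hβ, p, s, t, hs, ht⟩ := poly₂ hf hg
  exact ⟨β, hβ, p, addT s t, fun v => by simp [hs, ht]⟩

theorem Poly.mul {f g : (α → M) → M} (hf : Poly f) (hg : Poly g) : Poly fun v => f v * g v := by
  obtain ⟨β, hβ, p, s, t, hs, ht⟩ := poly₂ hf hg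
  exact ⟨β, hβ, p, mulT s t, fun v => by simp [hs, ht]⟩

theorem Delta.congr {S T : (α → M) → Prop} (hS : Delta S) (h : ∀ v, T v ↔ S v) : Delta T := by
  obtain ⟨β, hβ, p, θ, hθ, e⟩ := hS
  exact ⟨β, hβ, p, θ, hθ, fun v => (h v).trans (e v)⟩

theorem Delta.eq {f g : (α → M) → M} (hf : Poly f) (hg : Poly g) : Delta fun v => f v = g v := by
  obtain ⟨β, hβ, p, s, t, hs, ht⟩ := poly₂ hf hg
  exact ⟨β, hβ, p, s.equal t, .equal _ _, fun v => by
    beta_reduce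
    rw [Formula.realize_equal, hs, ht]⟩

theorem Delta.lt {f g : (α → M) → M} (hf : Poly f) (hg : Poly g) : Delta fun v => f v < g v := by
  obtain ⟨β, hβ, p, s, t, hs, ht⟩ := poly₂ hf hg
  exact ⟨β, hβ, p, ltF s t, .rel _ _, fun v => by
    beta_reduce
    rw [realize_ltF, hs, ht]⟩

theorem Delta.false : Delta fun _ : α → M => False :=
  ⟨Empty, inferInstance, Empty.elim, .falsum, .falsum, fun _ => Iff.rfl⟩

theorem Delta.imp {S T : (α → M) → Prop} (hS : Delta S) (hT : Delta T) :
    Delta fun v => S v → T v := by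
  obtain ⟨β, hβ, p, θ, hθ, e⟩ := hS
  obtain ⟨γ, hγ, q, ψ, hψ, e'⟩ := hT
  refine ⟨β ⊕ γ, inferInstance, Sum.elim p q, .imp (rename (Sum.inl ∘ Sum.map id Sum.inl) θ)
    (rename (Sum.inl ∘ Sum.map id Sum.inr) ψ), .imp (hθ.rename _) (hψ.rename _), fun v => ?_⟩
  beta_reduce
  rw [Formula.Realize, BoundedFormula.realize_imp, realize_rename, realize_rename, e, e']
  have e₁ : Sum.elim (Sum.elim v (Sum.elim p q)) (default : Fin 0 → M) ∘
      (Sum.inl ∘ Sum.map id Sum.inl) = Sum.elim v p := by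
    funext a
    rcases a with a | b <;> rfl
  have e₂ : Sum.elim (Sum.elim v (Sum.elim p q)) (default : Fin 0 → M) ∘
      (Sum.inl ∘ Sum.map id Sum.inr) = Sum.elim v q := by
    funext a
    rcases a with a | b <;> rfl
  rw [e₁, e₂]

theorem Delta.not {S : (α → M) → Prop} (hS : Delta S) : Delta fun v => ¬ S v :=
  hS.imp .false

theorem Delta.and {S T : (α → M) → Prop} (hS : Delta S) (hT : Delta T) :
    Delta fun v => S v ∧ T v :=
  (hS.imp hT.not).not.congr fun v => by tauto

theorem Delta.or {S T : (α → M) → Prop} (hS : Delta S) (hT : Delta T) :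
    Delta fun v => S v ∨ T v :=
  (hS.not.imp hT).congr fun v => by tauto

theorem Delta.reindex {S : (α → M) → Prop} (hS : Delta S) (g : α → α') :
    Delta fun w : α' → M => S fun a => w (g a) := by
  obtain ⟨β, hβ, p, θ, hθ, e⟩ := hS
  refine ⟨β, hβ, p, rename (Sum.inl ∘ Sum.map g id) θ, hθ.rename _, fun v => ?_⟩
  beta_reduce
  rw [Formula.Realize, realize_rename, e]
  have e₁ : Sum.elim (Sum.elim v p) (default : Fin 0 → M) ∘ (Sum.inl ∘ Sum.map g id) =
      Sum.elim (fun a => v (g a)) p := by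
    funext a
    rcases a with a | b <;> rfl
  rw [e₁]

/-- Variables are turned into parameters. Parameter sets are kept finite because an induction axiom
has only finitely many parameters. -/
theorem Delta.fix {S : (α ⊕ α' → M) → Prop} [Finite α'] (hS : Delta S) (c : α' → M) :
    Delta fun v : α → M => S (Sum.elim v c) := by
  obtain ⟨β, hβ, p, θ, hθ, e⟩ := hS
  refine ⟨α' ⊕ β, inferInstance, Sum.elim c p, rename (Sum.inl ∘ Equiv.sumAssoc _ _ _) θ,
    hθ.rename _, fun v => ?_⟩
  beta_reduce
  rw [Formula.Realize, realize_rename, e]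
  have e₁ : Sum.elim (Sum.elim v (Sum.elim c p)) (default : Fin 0 → M) ∘
      (Sum.inl ∘ Equiv.sumAssoc _ _ _) = Sum.elim (Sum.elim v c) p := by
    funext a
    rcases a with (a | a) | b <;> rfl
  rw [e₁]

theorem Delta.ball {f : (α → M) → M} (hf : Poly f) {S : (Option α → M) → Prop} (hS : Delta S) :
    Delta fun v => ∀ y, y < f v → S (ocons y v) := by
  obtain ⟨β, hβ, p, t, ht⟩ := hf
  obtain ⟨γ, hγ, q, θ, hθ, e⟩ := hS
  let t' : arith.Term ((α ⊕ (β ⊕ γ)) ⊕ Fin 0) := t.relabel (Sum.inl ∘ Sum.map id Sum.inl)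
  let g : Option α ⊕ γ → (α ⊕ (β ⊕ γ)) ⊕ Fin 1 :=
    Sum.elim (fun o => o.elim (.inr 0) fun a => .inl (.inl a)) fun c => .inl (.inr (.inr c))
  refine ⟨β ⊕ γ, inferInstance, Sum.elim p q, _, .ball t' (hθ.rename g), fun v => ?_⟩
  rw [Formula.Realize, BoundedFormula.realize_all]
  refine forall_congr' fun y => ?_
  rw [BoundedFormula.realize_imp, realize_ltB, realize_rename, e, ht]
  have e₁ : Sum.elim (Sum.elim v (Sum.elim p q)) (Fin.snoc default y : Fin 1 → M) ∘ g =
      Sum.elim (ocons y v) q := by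
    funext a
    rcases a with (_ | a) | b <;> rfl
  have e₂ : (t'.relabel (Sum.map id Fin.castSucc)).realize
      (Sum.elim (Sum.elim v (Sum.elim p q)) (Fin.snoc default y : Fin 1 → M)) =
      t.realize (Sum.elim v p) := by
    simp only [t', Term.relabel_relabel, Term.realize_relabel]
    congr 1
    funext a
    rcases a with a | b <;> rfl
  rw [e₁, e₂]
  rfl

theorem Delta.bex {f : (α → M) → M} (hf : Poly f) {S : (Option α → M) → Prop} (hS : Delta S) :
    Delta fun v => ∃ y, y < f v ∧ S (ocons y v) :=
  (Delta.ball hf hS.not).not.congr fun v => by push Not; rfl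

/-! ## `Σ₁`-sets -/

/-- Sets defined by `Σ₁`-formulas with parameters. -/
class Sig (S : (α → M) → Prop) : Prop where
  out : ∃ D : (Option α → M) → Prop, Delta D ∧ ∀ v, S v ↔ ∃ y, D (ocons y v)

theorem Sig.congr {S T : (α → M) → Prop} (hS : Sig S) (h : ∀ v, T v ↔ S v) : Sig T := by
  obtain ⟨D, hD, e⟩ := hS
  exact ⟨D, hD, fun v => (h v).trans (e v)⟩

theorem Delta.sig {S : (α → M) → Prop} (hS : Delta S) : Sig S :=
  ⟨_, hS.reindex some, fun _ => ⟨fun h => ⟨0, h⟩, fun ⟨_, h⟩ => h⟩⟩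

theorem Sig.reindex {S : (α → M) → Prop} (hS : Sig S) (g : α → α') :
    Sig fun w : α' → M => S fun a => w (g a) := by
  obtain ⟨D, hD, e⟩ := hS
  refine ⟨_, hD.reindex (Option.map g), fun v => (e _).trans (exists_congr fun y => ?_)⟩
  have : (ocons y fun a => v (g a)) = fun a => ocons y v (Option.map g a) := by
    funext a
    cases a <;> rfl
  rw [this]

variable [hM : M ⊨ ISigma1]

/-- This is where the induction axioms enter: a semantic `Σ₁`-set is translated back into a formula
with numbered parameters, and its axiom is read off in `M`. -/
theorem sigma_induction_sc {P : M → Prop} (hP : Sig fun v : Unit → M => P (v ())) (h₀ : P 0)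
    (hs : ∀ x, P x → P (sc x)) (x : M) : P x := by
  obtain ⟨D, ⟨β, hβ, p, θ, hθ, e'⟩, e⟩ := hP
  obtain ⟨k, ⟨i⟩⟩ := Finite.exists_equiv_fin β
  -- The witness `none` becomes the quantified variable, the argument becomes the induction variable
  -- `Sum.inr 0`, and the parameters are numbered by `i`.
  let g : Option Unit ⊕ β → (Fin k ⊕ Fin 1) ⊕ Fin 1 :=
    Sum.elim (fun o => o.elim (.inr 0) fun _ => .inl (.inr 0)) fun b => .inl (.inl (i b))
  let φ : arith.Formula (Fin k ⊕ Fin 1) := (rename g θ).ex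
  have hφ : ∀ x : M, P x ↔ φ.Realize (Sum.elim (p ∘ i.symm) fun _ => x) := by
    intro x
    rw [Formula.Realize, BoundedFormula.realize_ex]
    refine (e fun _ => x).trans (exists_congr fun y => ?_)
    rw [realize_rename, e']
    have : Sum.elim (ocons y fun _ => x) p =
        Sum.elim (Sum.elim (p ∘ i.symm) fun _ => x) (Fin.snoc default y : Fin 1 → M) ∘ g := by
      funext a
      rcases a with (_ | a) | b
      · rfl
      · rfl
      · simp [g]
    rw [this]
  have H : M ⊨ inductionAxiom φ := hM.realize_of_mem _ (Or.inr ⟨k, φ, ⟨_, hθ.rename g, rfl⟩, rfl⟩)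
  rw [inductionAxiom, realize_univClosure] at H
  have H := H (p ∘ i.symm)
  rw [Formula.realize_imp, Formula.realize_imp, realize_formula_subst, realize_allF,
    realize_allF] at H
  have c : ∀ xs : Fin 1 → M, xs = fun _ => xs 0 := fun xs => by
    funext j
    rw [Subsingleton.elim j 0]
  have H := H ?_ ?_ (fun _ => x)
  · exact (hφ x).2 H
  · convert (hφ 0).1 h₀ using 1
    funext a
    rcases a with a | a <;> simp
  · intro xs
    rw [Formula.realize_imp, realize_formula_subst, c xs, ← hφ]
    intro hx
    convert (hφ _).1 (hs _ hx) using 1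
    funext a
    rcases a with a | a <;> simp

end Arith

/-! ## Models of `IΣ₁` are ordered semirings -/

section Semiring

variable {M : Type} [arith.Structure M] [hM : M ⊨ ISigma1]

theorem realize_axiom {k : ℕ} (φ : arith.Formula (Fin k)) (h : univClosure φ ∈ elementaryAxioms)
    (xs : Fin k → M) : φ.Realize xs :=
  (realize_univClosure φ).1 (hM.realize_of_mem _ (Or.inl h)) xs

theorem sc_ne_zero (a : M) : sc a ≠ 0 := by
  have := realize_axiom (M := M) _ (.inl rfl) ![a]
  simpa [x, Formula.realize_equal] using this

theorem add_zero' (a : M) : a + 0 = a := by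
  have := realize_axiom (M := M) _ (.inr (.inr (.inl rfl))) ![a]
  simpa [x, Formula.realize_equal] using this

theorem add_sc (a b : M) : a + sc b = sc (a + b) := by
  have := realize_axiom (M := M) _ (.inr (.inr (.inr (.inl rfl)))) ![a, b]
  simpa [x, Formula.realize_equal] using this

theorem mul_zero' (a : M) : a * 0 = 0 := by
  have := realize_axiom (M := M) _ (.inr (.inr (.inr (.inr (.inl rfl))))) ![a]
  simpa [x, Formula.realize_equal] using this

theorem mul_sc (a b : M) : a * sc b = a * b + a := by
  have := realize_axiom (M := M) _ (.inr (.inr (.inr (.inr (.inr (.inl rfl)))))) ![a, b]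
  simpa [x, Formula.realize_equal] using this

theorem not_lt_zero_sc (a : M) : ¬ a < 0 := by
  have := realize_axiom (M := M) _ (.inr (.inr (.inr (.inr (.inr (.inr (.inl rfl))))))) ![a]
  simpa [x, realize_ltF] using this

theorem lt_sc_cases {a b : M} (h : a < sc b) : a < b ∨ a = b := by
  have := realize_axiom (M := M) _
    (.inr (.inr (.inr (.inr (.inr (.inr (.inr (.inl rfl)))))))) ![a, b]
  simp only [x, Formula.realize_imp, Formula.realize_sup, Formula.realize_equal, realize_ltF,
    realize_succT_sc] at this
  exact this h

theorem zero_lt_sc (a : M) : 0 < sc a := by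
  have := realize_axiom (M := M) _
    (.inr (.inr (.inr (.inr (.inr (.inr (.inr (.inr (.inl rfl))))))))) ![a]
  simpa [x, realize_ltF] using this

theorem sc_lt_sc {a b : M} (h : a < b) : sc a < sc b := by
  have := realize_axiom (M := M) _
    (.inr (.inr (.inr (.inr (.inr (.inr (.inr (.inr (.inr (.inl rfl)))))))))) ![a, b]
  simp only [x, Formula.realize_imp, realize_ltF, realize_succT_sc] at this
  exact this h

theorem lt_of_sc_lt {a b : M} (h : sc a < b) : a < b := by
  have := realize_axiom (M := M) _
    (.inr (.inr (.inr (.inr (.inr (.inr (.inr (.inr (.inr (.inr (.inl rfl))))))))))) ![a, b]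
  simp only [x, Formula.realize_imp, realize_ltF, realize_succT_sc] at this
  exact this h

theorem lt_sc (a : M) : a < sc a := by
  have := realize_axiom (M := M) _
    (.inr (.inr (.inr (.inr (.inr (.inr (.inr (.inr (.inr (.inr (.inr rfl))))))))))) ![a]
  simpa [x, realize_ltF] using this

theorem lt_sc_of_lt {a b : M} (h : a < b) : a < sc b := lt_of_sc_lt (sc_lt_sc h)

/-- Induction for equations between terms. -/
theorem eq_induction {f g : M → M} (hf : Poly fun v : Unit → M => f (v ()))
    (hg : Poly fun v : Unit → M => g (v ())) (h₀ : f 0 = g 0)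
    (hs : ∀ a, f a = g a → f (sc a) = g (sc a)) (a : M) : f a = g a :=
  sigma_induction_sc (P := fun a => f a = g a) (Delta.eq hf hg).sig h₀ hs a

theorem zero_add' (a : M) : 0 + a = a :=
  eq_induction (f := fun a : M => 0 + a) (g := fun a => a) (.add (.const _) (.var _)) (.var _)
    (add_zero' _) (fun a h => by rw [add_sc, h]) a

theorem sc_add (a b : M) : sc a + b = sc (a + b) :=
  eq_induction (f := fun b => sc a + b) (g := fun b => sc (a + b)) (.add (.const _) (.var _))
    (.sc (.add (.const _) (.var _))) (by simp only [add_zero'])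
    (fun b h => by rw [add_sc, h, add_sc]) b

theorem add_comm' (a b : M) : a + b = b + a :=
  eq_induction (f := fun b => a + b) (g := fun b => b + a) (.add (.const _) (.var _))
    (.add (.var _) (.const _)) (by simp only [add_zero', zero_add'])
    (fun b h => by rw [add_sc, h, sc_add]) b

theorem add_assoc' (a b c : M) : a + b + c = a + (b + c) :=
  eq_induction (f := fun c => a + b + c) (g := fun c => a + (b + c)) (.add (.const _) (.var _))
    (.add (.const _) (.add (.const _) (.var _))) (by simp only [add_zero'])
    (fun b h => by simp only [add_sc, h]) c

theorem zero_mul' (a : M) : 0 * a = 0 :=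
  eq_induction (f := fun a : M => 0 * a) (g := fun _ => (0 : M)) (.mul (.const _) (.var _)) (.const _)
    (mul_zero' _) (fun a h => by rw [mul_sc, h, add_zero']) a

theorem sc_mul (a b : M) : sc a * b = a * b + b :=
  eq_induction (f := fun b => sc a * b) (g := fun b => a * b + b) (.mul (.const _) (.var _))
    (.add (.mul (.const _) (.var _)) (.var _)) (by simp only [mul_zero', add_zero'])
    (fun b h => by
      rw [mul_sc, h, mul_sc, add_sc, add_sc, add_assoc', add_assoc', add_comm' b a]) b

theorem mul_comm' (a b : M) : a * b = b * a :=
  eq_induction (f := fun b => a * b) (g := fun b => b * a) (.mul (.const _) (.var _))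
    (.mul (.var _) (.const _)) (by simp only [mul_zero', zero_mul'])
    (fun b h => by rw [mul_sc, h, sc_mul]) b

theorem mul_add' (a b c : M) : a * (b + c) = a * b + a * c :=
  eq_induction (f := fun c => a * (b + c)) (g := fun c => a * b + a * c)
    (.mul (.const _) (.add (.const _) (.var _))) (.add (.const _) (.mul (.const _) (.var _)))
    (by simp only [add_zero', mul_zero'])
    (fun c h => by rw [add_sc, mul_sc, mul_sc, h, add_assoc']) c

theorem mul_assoc' (a b c : M) : a * b * c = a * (b * c) :=
  eq_induction (f := fun c => a * b * c) (g := fun c => a * (b * c))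
    (.mul (.const _) (.var _)) (.mul (.const _) (.mul (.const _) (.var _)))
    (by simp only [mul_zero'])
    (fun c h => by rw [mul_sc, mul_sc, h, mul_add']) c

instance : One M := ⟨sc 0⟩

theorem sc_eq (a : M) : sc a = a + 1 := by
  change _ = a + sc 0
  rw [add_sc, add_zero']

theorem mul_one' (a : M) : a * 1 = a := by
  change a * sc 0 = a
  rw [mul_sc, mul_zero', zero_add']

instance : CommSemiring M where
  add_assoc := add_assoc'
  zero_add := zero_add'
  add_zero := add_zero'
  add_comm := add_comm'
  left_distrib := mul_add'
  right_distrib a b c := by rw [mul_comm', mul_add', mul_comm' c a, mul_comm' c b]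
  zero_mul := zero_mul'
  mul_zero := mul_zero'
  mul_assoc := mul_assoc'
  one_mul a := by rw [mul_comm', mul_one']
  mul_one := mul_one'
  mul_comm := mul_comm'
  nsmul := nsmulRec

/-! ### The order of a model and its compatibility with the semiring operations. -/

theorem lt_irrefl' (a : M) : ¬ a < a :=
  sigma_induction_sc (P := fun a : M => ¬ a < a) (Delta.lt (.var _) (.var _)).not.sig
    (not_lt_zero_sc _) (fun a ih h => (lt_sc_cases h).elim (fun h => ih (lt_of_sc_lt h))
      fun h => ih (by have := lt_sc a; rwa [h] at this)) a

theorem lt_add_sc (a b : M) : a < a + sc b := by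
  refine sigma_induction_sc (P := fun b : M => a < a + sc b)
    (Delta.lt (.const _) (.add (.const _) (.sc (.var _)))).sig ?_ (fun b ih => ?_) b
  · rw [add_sc, add_zero']
    exact lt_sc a
  · rw [add_sc]
    exact lt_sc_of_lt ih

/-- This replaces subtraction: through `lt_iff_exists`, inequalities become equations that `ring`
can treat. -/
theorem exists_of_lt {a b : M} : a < b → ∃ c, a + sc c = b := by
  refine sigma_induction_sc (P := fun b : M => a < b → ∃ c, a + sc c = b) ?_
    (fun h => absurd h (not_lt_zero_sc _)) (fun b ih h => ?_) b
  -- The existential quantifier is moved in front of the implication. This is classically equivalent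
  -- and exhibits the `Σ₁`-form.
  · refine Sig.congr (S := fun v : Unit → M => ∃ c, a < v () → a + sc c = v ()) ⟨_,
      (Delta.lt (.const _) (.var (some ()))).imp
        (.eq (.add (.const a) (.sc (.var none))) (.var (some ()))), fun v => Iff.rfl⟩ fun v => ?_
    by_cases h : a < v ()
    · simp [h]
    · simp [h]
  · rcases lt_sc_cases h with h | rfl
    · obtain ⟨c, rfl⟩ := ih h
      exact ⟨sc c, by simp only [add_sc]⟩
    · exact ⟨0, by rw [add_sc, add_zero']⟩

theorem lt_iff_exists {a b : M} : a < b ↔ ∃ c, a + c + 1 = b := by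
  constructor
  · intro h
    obtain ⟨c, rfl⟩ := exists_of_lt h
    exact ⟨c, by rw [sc_eq, add_assoc]⟩
  · rintro ⟨c, rfl⟩
    rw [add_assoc, ← sc_eq]
    exact lt_add_sc a c

theorem lt_trichotomy' (a b : M) : a < b ∨ a = b ∨ b < a := by
  refine sigma_induction_sc (P := fun b : M => a < b ∨ a = b ∨ b < a)
    ((Delta.lt (.const _) (.var _)).or ((Delta.eq (.const _) (.var _)).or
      (.lt (.var _) (.const _)))).sig ?_ (fun b ih => ?_) b
  · have : a = 0 ∨ 0 < a := by
      refine sigma_induction_sc (P := fun a : M => a = 0 ∨ 0 < a)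
        ((Delta.eq (.var _) (.const _)).or (.lt (.const _) (.var _))).sig (.inl rfl)
        (fun a _ => .inr (zero_lt_sc a)) a
    exact .inr this
  · rcases ih with h | rfl | h
    · exact .inl (lt_sc_of_lt h)
    · exact .inl (lt_sc a)
    · right
      obtain ⟨c, rfl⟩ := lt_iff_exists.1 h
      have : c = 0 ∨ 0 < c := by
        refine sigma_induction_sc (P := fun a : M => a = 0 ∨ 0 < a)
          ((Delta.eq (.var _) (.const _)).or (.lt (.const _) (.var _))).sig (.inl rfl)
          (fun a _ => .inr (zero_lt_sc a)) c
      rcases this with rfl | hc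
      · left
        rw [add_zero, sc_eq]
      · right
        obtain ⟨d, rfl⟩ := lt_iff_exists.1 hc
        exact lt_iff_exists.2 ⟨d, by rw [sc_eq]; ring⟩

theorem lt_trans' {a b c : M} (h : a < b) (h' : b < c) : a < c := by
  obtain ⟨d, rfl⟩ := lt_iff_exists.1 h
  obtain ⟨e, rfl⟩ := lt_iff_exists.1 h'
  exact lt_iff_exists.2 ⟨d + e + 1, by ring⟩

noncomputable instance : LinearOrder M where
  le a b := a < b ∨ a = b
  le_refl a := .inr rfl
  le_trans a b c := by
    rintro (h | rfl) (h' | rfl)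
    · exact .inl (lt_trans' h h')
    · exact .inl h
    · exact .inl h'
    · exact .inr rfl
  lt_iff_le_not_ge a b := by
    constructor
    · intro h
      refine ⟨.inl h, ?_⟩
      rintro (h' | rfl)
      · exact lt_irrefl' _ (lt_trans' h h')
      · exact lt_irrefl' _ h
    · rintro ⟨h | rfl, h'⟩
      · exact h
      · exact absurd (.inr rfl) h'
  le_antisymm a b := by
    rintro (h | rfl) (h' | h')
    · exact absurd (lt_trans' h h') (lt_irrefl' _)
    · exact h'.symm
    · rfl
    · rfl
  le_total a b := by
    rcases lt_trichotomy' a b with h | h | h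
    · exact .inl (.inl h)
    · exact .inl (.inr h)
    · exact .inr (.inl h)
  toDecidableLE := Classical.decRel _

theorem le_iff_exists {a b : M} : a ≤ b ↔ ∃ c, b = a + c := by
  constructor
  · rintro (h | rfl)
    · obtain ⟨c, rfl⟩ := lt_iff_exists.1 h
      exact ⟨c + 1, add_assoc _ _ _⟩
    · exact ⟨0, (add_zero a).symm⟩
  · rintro ⟨c, rfl⟩
    rcases lt_trichotomy' 0 c with h | rfl | h
    · obtain ⟨d, rfl⟩ := lt_iff_exists.1 h
      exact .inl (lt_iff_exists.2 ⟨d, by ring⟩)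
    · exact .inr (add_zero a).symm
    · exact absurd h (not_lt_zero_sc c)

theorem add_lt_add_left' {a b : M} (h : a < b) (c : M) : c + a < c + b := by
  obtain ⟨d, rfl⟩ := lt_iff_exists.1 h
  exact lt_iff_exists.2 ⟨d, by ring⟩

theorem mul_lt_mul_left' {a b c : M} (hc : 0 < c) (h : a < b) : c * a < c * b := by
  obtain ⟨d, rfl⟩ := lt_iff_exists.1 h
  obtain ⟨e, rfl⟩ := lt_iff_exists.1 hc
  exact lt_iff_exists.2 ⟨e * d + d + e, by ring⟩

instance : CanonicallyOrderedAdd M where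
  exists_add_of_le h := le_iff_exists.1 h
  le_add_self _ b := le_iff_exists.2 ⟨b, add_comm _ _⟩
  le_self_add _ b := le_iff_exists.2 ⟨b, rfl⟩

instance : IsStrictOrderedRing M where
  add_le_add_left _ _ h _ := by
    obtain ⟨d, rfl⟩ := le_iff_exists.1 h
    exact le_iff_exists.2 ⟨d, by ring⟩
  le_of_add_le_add_left a b c h := by
    by_contra h'
    exact absurd (add_lt_add_left' (not_le.1 h') a) (not_lt.2 h)
  zero_le_one := le_iff_exists.2 ⟨1, (zero_add 1).symm⟩
  exists_pair_ne := ⟨0, 1, fun h => sc_ne_zero (0 : M) h.symm⟩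
  mul_lt_mul_of_pos_left _ ha _ _ h := mul_lt_mul_left' ha h
  mul_lt_mul_of_pos_right a ha b c h := by
    rw [mul_comm b, mul_comm c]
    exact mul_lt_mul_left' ha h

@[simp] theorem realize_succT {α : Type} (v : α → M) (t : arith.Term α) :
    (succT t).realize v = t.realize v + 1 := by
  rw [realize_succT_sc, sc_eq]

theorem lt_add_one_iff' {a b : M} : a < b + 1 ↔ a ≤ b := by
  rw [← sc_eq]
  exact ⟨lt_sc_cases, fun h => h.elim lt_sc_of_lt fun h => h ▸ lt_sc a⟩

theorem realize_leF {α : Type} (v : α → M) (s t : arith.Term α) :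
    (leF s t).Realize v ↔ s.realize v ≤ t.realize v := by
  rw [leF, realize_ltF, realize_succT, lt_add_one_iff']

end Semiring

/-! ## Closure properties of `Σ₁`-sets and induction -/

section SigmaOne

variable {M : Type} [arith.Structure M] {α β : Type}

/-- Sets with `Σ₁`-complement. -/
class Pi (S : (α → M) → Prop) : Prop where
  out : Sig fun v => ¬ S v

/-- Functions with a `Σ₁`-graph. -/
class SigF (f : (α → M) → M) : Prop where
  out : Sig fun w : Option α → M => w none = f fun a => w (some a)

theorem SigF.graph (f : (α → M) → M) [SigF f] (c : β) (g : α → β) :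
    Sig fun w : β → M => w c = f fun a => w (g a) :=
  SigF.out (f := f).reindex fun o => o.elim c g

variable [hM : M ⊨ ISigma1]

theorem lt_max_add_one (a b : M) : a < max a b + 1 ∧ b < max a b + 1 :=
  ⟨lt_add_one_iff'.2 (le_max_left _ _), lt_add_one_iff'.2 (le_max_right _ _)⟩

/-- Two existential quantifiers are merged into one without pairing: a common strict bound `u` is
quantified and both witnesses are sought below `u`. -/
theorem Delta.sig_ex₂ {D : (Option (Option α) → M) → Prop} (hD : Delta D) :
    Sig fun v => ∃ x y, D (ocons y (ocons x v)) := by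
  let g : Option (Option α) → Option (Option (Option α)) :=
    fun o => o.elim none fun o => o.elim (some none) fun a => some (some (some a))
  have hg : ∀ (x y u : M) (v : α → M), (fun o => ocons y (ocons x (ocons u v)) (g o)) =
      ocons y (ocons x v) := by
    intro x y u v
    funext o
    rcases o with _ | _ | a <;> rfl
  refine ⟨_, Delta.bex (.var none) (Delta.bex (.var (some none)) (hD.reindex g)), fun v => ?_⟩
  constructor
  · rintro ⟨x, y, h⟩
    refine ⟨max x y + 1, x, (lt_max_add_one _ _).1, y, (lt_max_add_one _ _).2, ?_⟩
    rw [hg]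
    exact h
  · rintro ⟨u, x, -, y, -, h⟩
    rw [hg] at h
    exact ⟨x, y, h⟩

instance Sig.ex {P : M → (α → M) → Prop}
    [hP : Sig fun w : Option α → M => P (w none) fun a => w (some a)] :
    Sig fun v => ∃ x, P x v := by
  obtain ⟨D, hD, e⟩ := hP
  exact hD.sig_ex₂.congr fun v => exists_congr fun x => e (ocons x v)

instance Sig.and {S T : (α → M) → Prop} [hS : Sig S] [hT : Sig T] :
    Sig fun v => S v ∧ T v := by
  obtain ⟨D, hD, e⟩ := hS
  obtain ⟨E, hE, e'⟩ := hT
  refine ((hD.reindex (Option.map some : Option α → Option (Option α))).and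
    (hE.reindex (fun o => o.elim (some none) fun a => some (some a)))).sig_ex₂.congr fun v => ?_
  have e₁ : ∀ x y, (fun a => ocons y (ocons x v) (Option.map some a)) = ocons y v := by
    intro x y
    funext o
    cases o <;> rfl
  have e₂ : ∀ x y, (fun o => ocons y (ocons x v)
      (Option.elim o (some none) fun a => some (some a))) = ocons x v := by
    intro x y
    funext o
    cases o <;> rfl
  simp only [e₁, e₂, e, e']
  constructor
  · rintro ⟨⟨x, hx⟩, y, hy⟩
    exact ⟨y, x, hx, hy⟩
  · rintro ⟨y, x, hx, hy⟩
    exact ⟨⟨x, hx⟩, y, hy⟩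

instance Sig.or {S T : (α → M) → Prop} [hS : Sig S] [hT : Sig T] :
    Sig fun v => S v ∨ T v := by
  obtain ⟨D, hD, e⟩ := hS
  obtain ⟨E, hE, e'⟩ := hT
  exact ⟨_, hD.or hE, fun v => by simp only [e, e', exists_or]⟩

instance (priority := low) Sig.constProp (p : Prop) : Sig fun _ : α → M => p := by
  by_cases h : p
  · exact Delta.sig (Delta.false.not.congr fun _ => by simp [h])
  · exact Delta.sig (Delta.false.congr fun _ => by simp [h])

instance Sig.not {S : (α → M) → Prop} [hS : Pi S] : Sig fun v => ¬ S v := hS.out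

instance Sig.imp {S T : (α → M) → Prop} [hS : Pi S] [hT : Sig T] : Sig fun v => S v → T v :=
  (Sig.or (S := fun v => ¬ S v) (T := T)).congr fun _ => by tauto

instance Pi.imp {S T : (α → M) → Prop} [hS : Sig S] [hT : Pi T] : Pi fun v => S v → T v :=
  ⟨(Sig.and (S := S) (T := fun v => ¬ T v)).congr fun _ => by tauto⟩

instance Pi.or {S T : (α → M) → Prop} [hS : Pi S] [hT : Pi T] : Pi fun v => S v ∨ T v :=
  ⟨(Sig.and (S := fun v => ¬ S v) (T := fun v => ¬ T v)).congr fun _ => by tauto⟩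

instance Pi.all {P : M → (α → M) → Prop}
    [hP : Pi fun w : Option α → M => P (w none) fun a => w (some a)] :
    Pi fun v => ∀ x, P x v := by
  have := hP.out
  exact ⟨(Sig.ex (P := fun x v => ¬ P x v)).congr fun v => by push Not; rfl⟩

instance (priority := low) Pi.constProp (p : Prop) : Pi fun _ : α → M => p := ⟨inferInstance⟩

/-- Substitution of a function with `Σ₁`-graph. -/
theorem Sig.subst₁ {f : (α → M) → M} [hf : SigF f] (R : M → (α → M) → Prop)
    [hR : Sig fun w : Option α → M => R (w none) fun a => w (some a)] : Sig fun v => R (f v) v := by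
  have := hf.out
  exact (Sig.ex (P := fun x v => x = f v ∧ R x v)).congr fun v => by simp

instance Sig.eq {f g : (α → M) → M} [SigF f] [hg : SigF g] : Sig fun v => f v = g v := by
  have := hg.out
  exact Sig.subst₁ (f := f) fun x v => x = g v

theorem Sig.rel₂ {f g : (α → M) → M} [SigF f] [SigF g] (R : M → M → Prop)
    (hR : Delta fun w : Option (Option α) → M => R (w (some none)) (w none)) :
    Sig fun v => R (f v) (g v) := by
  have h₁ := hR.sig
  have h₂ : SigF (fun w : Option α → M => g fun a => w (some a)) := by
    refine ⟨SigF.graph g none fun a => some (some a)⟩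
  have h₃ : Sig fun w : Option α → M => R (w none) (g fun a => w (some a)) :=
    Sig.subst₁ (f := fun w : Option α → M => g fun a => w (some a))
      fun y (w : Option α → M) => R (w none) y
  exact Sig.subst₁ (f := f) fun x v => R x (g v)

instance Sig.lt {f g : (α → M) → M} [SigF f] [SigF g] : Sig fun v => f v < g v :=
  Sig.rel₂ _ (.lt (.var _) (.var _))

instance Sig.le {f g : (α → M) → M} [SigF f] [SigF g] : Sig fun v => f v ≤ g v :=
  Sig.rel₂ _ (((Delta.lt (.var _) (.var _)).or (Delta.eq (.var _) (.var _))).congr fun _ =>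
    le_iff_lt_or_eq)

instance Pi.eq {f g : (α → M) → M} [SigF f] [SigF g] : Pi fun v => f v = g v :=
  ⟨Sig.rel₂ (fun x y => ¬ x = y) (Delta.eq (.var _) (.var _)).not⟩

instance Pi.lt {f g : (α → M) → M} [SigF f] [SigF g] : Pi fun v => f v < g v :=
  ⟨(Sig.le (f := g) (g := f)).congr fun _ => not_lt⟩

instance Pi.le {f g : (α → M) → M} [SigF f] [SigF g] : Pi fun v => f v ≤ g v :=
  ⟨(Sig.lt (f := g) (g := f)).congr fun _ => not_le⟩

instance SigF.var (a : α) : SigF fun v : α → M => v a :=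
  ⟨(Delta.eq (.var none) (.var (some a))).sig⟩

instance (priority := low) SigF.const (c : M) : SigF fun _ : α → M => c :=
  ⟨(Delta.eq (.var none) (.const c)).sig⟩

instance SigF.weaken {f : (α → M) → M} [SigF f] :
    SigF fun w : Option α → M => f fun a => w (some a) :=
  ⟨SigF.graph f none fun a => some (some a)⟩

theorem SigF.comp₂ {f g : (α → M) → M} [SigF f] [SigF g] (F : M → M → M)
    (hF : Poly fun w : Option (Option (Option α)) → M => F (w (some none)) (w none)) :
    SigF fun v => F (f v) (g v) :=
  ⟨(Sig.ex (α := Option α) (P := fun x w => x = f (fun a => w (some a)) ∧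
      w none = F x (g fun a => w (some a)))
    (hP := Sig.and (S := fun w => w none = f fun a => w (some (some a)))
      (T := fun w : Option (Option α) → M => w (some none) = F (w none) (g fun a => w (some (some a))))
      (hS := SigF.graph f none fun a => some (some a))
      (hT := Sig.subst₁ (f := fun w : Option (Option α) → M => g fun a => w (some (some a)))
        (hf := SigF.weaken (f := fun w : Option α → M => g fun a => w (some a)))
        (fun y w => w (some none) = F (w none) y)
        (hR := (Delta.eq (.var (some (some none))) hF).sig)))).congr fun v => by simp⟩

instance SigF.add {f g : (α → M) → M} [SigF f] [SigF g] : SigF fun v => f v + g v :=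
  SigF.comp₂ _ (.add (.var _) (.var _))

instance SigF.mul {f g : (α → M) → M} [SigF f] [SigF g] : SigF fun v => f v * g v :=
  SigF.comp₂ _ (.mul (.var _) (.var _))

/-- `Σ₁`-induction. -/
theorem sig_induction {P : M → Prop} [hP : Sig fun v : Unit → M => P (v ())] (h₀ : P 0)
    (hs : ∀ x, P x → P (x + 1)) (x : M) : P x :=
  sigma_induction_sc hP h₀ (fun x h => sc_eq x ▸ hs x h) x

/-- `Σ₁`-collection for sets given by bounded formulas. -/
theorem collection [Finite α] {D : (Option (Option α) → M) → Prop} (hD : Delta D) (v : α → M) (b : M)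
    (h : ∀ y, y < b → ∃ z, D (ocons z (ocons y v))) :
    ∃ u, ∀ y, y < b → ∃ z, z < u ∧ D (ocons z (ocons y v)) := by
  let g : Option (Option α) → Option (Option (Option Unit)) ⊕ α :=
    fun o => o.elim (.inl none) fun o => o.elim (.inl (some none)) fun a => .inr a
  have hg : ∀ w : Option (Option (Option Unit)) → M, (fun o => Sum.elim w v (g o)) =
      ocons (w none) (ocons (w (some none)) v) := by
    intro w
    funext o
    rcases o with _ | _ | a <;> rfl
  have hS := (hD.reindex g).fix v
  simp only [hg] at hS
  -- The disjunct `b < t` makes the inductive claim trivial beyond `b`, where witnesses are not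
  -- assumed.
  have hP : Sig fun t : Unit → M => ∃ u, b < t () ∨ ∀ y, y < t () → ∃ z, z < u ∧
      D (ocons z (ocons y v)) := by
    refine ⟨_, (Delta.lt (.const b) (.var (some ()))).or
      (Delta.ball (.var (some ())) (Delta.bex (.var (some none)) hS)), fun t => Iff.rfl⟩
  have H := sig_induction (P := fun t => ∃ u, b < t ∨ ∀ y, y < t → ∃ z, z < u ∧
      D (ocons z (ocons y v))) ?_ ?_ b
  · simpa using H
  · exact ⟨0, .inr fun y hy => absurd hy not_lt_zero⟩
  · rintro t ⟨u, hu⟩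
    rcases lt_or_ge b (t + 1) with ht | ht
    · exact ⟨0, .inl ht⟩
    · have htb : t < b := lt_of_lt_of_le (lt_add_one t) ht
      obtain ⟨z, hz⟩ := h t htb
      refine ⟨max u (z + 1), .inr fun y hy => ?_⟩
      rcases (lt_add_one_iff'.1 hy).lt_or_eq with hy | rfl
      · obtain ⟨z', hz', hd⟩ := (hu.resolve_left htb.not_gt) y hy
        exact ⟨z', lt_max_of_lt_left hz', hd⟩
      · exact ⟨z, lt_max_of_lt_right (lt_add_one z), hz⟩

/-- Collection supplies a common bound for the witnesses, so the existential quantifier can be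
pulled in front of the bounded one. -/
theorem Sig.ball_poly [Finite α] {f : (α → M) → M} (hf : Poly fun w : Option α → M => f fun a => w (some a))
    {P : M → (α → M) → Prop} [hP : Sig fun w : Option α → M => P (w none) fun a => w (some a)] :
    Sig fun v => ∀ y, y < f v → P y v := by
  obtain ⟨D, hD, e⟩ := hP
  let g : Option (Option α) → Option (Option (Option α)) :=
    fun o => o.elim none fun o => o.elim (some none) fun a => some (some (some a))
  have hg : ∀ (x y u : M) (v : α → M), (fun o => ocons y (ocons x (ocons u v)) (g o)) =
      ocons y (ocons x v) := by
    intro x y u v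
    funext o
    rcases o with _ | _ | a <;> rfl
  refine ⟨_, Delta.ball hf (Delta.bex (.var (some none)) (hD.reindex g)), fun v => ?_⟩
  have e : ∀ y, P y v ↔ ∃ z, D (ocons z (ocons y v)) := fun y => e (ocons y v)
  simp only [e, hg]
  constructor
  · intro h
    exact collection hD v _ h
  · rintro ⟨u, hu⟩ y hy
    obtain ⟨z, -, hz⟩ := hu y hy
    exact ⟨z, hz⟩

instance Sig.ball [Finite α] {f : (α → M) → M} [SigF f]
    {P : M → (α → M) → Prop} [hP : Sig fun w : Option α → M => P (w none) fun a => w (some a)] :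
    Sig fun v => ∀ y, y < f v → P y v := by
  have h₂ : Sig fun w : Option (Option α) → M => P (w none) fun a => w (some (some a)) :=
    hP.reindex fun o => o.elim none fun a => some (some a)
  have h₁ : Sig fun w : Option α → M => ∀ y, y < w none → P y fun a => w (some a) :=
    Sig.ball_poly (f := fun w : Option α → M => w none) (.var _)
      (P := fun y w => P y fun a => w (some a))
  exact Sig.subst₁ (f := f) fun x v => ∀ y, y < x → P y v

instance Sig.ball_le [Finite α] {f : (α → M) → M} [SigF f]
    {P : M → (α → M) → Prop} [hP : Sig fun w : Option α → M => P (w none) fun a => w (some a)] :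
    Sig fun v => ∀ y, y ≤ f v → P y v := by
  have h : SigF fun v => f v + 1 := inferInstance
  exact (Sig.ball (hM := hM) (f := fun v => f v + 1) (P := P)).congr fun v => by
    simp only [lt_add_one_iff']

/-- Strong `Σ₁`-induction. -/
theorem sig_strong_induction {P : M → Prop} [hP : Sig fun v : Unit → M => P (v ())]
    (h : ∀ x, (∀ y, y < x → P y) → P x) (x : M) : P x := by
  have : Sig fun w : Option Unit → M => P (w none) := hP.reindex fun _ => none
  have H := sig_induction (P := fun x => ∀ y, y < x → P y) (fun y hy => absurd hy not_lt_zero)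
    (fun x hx y hy => h y fun z hz => hx z (lt_of_lt_of_le hz (lt_add_one_iff'.1 hy))) (x + 1)
  exact H x (lt_add_one x)

/-- Strong induction for sets with `Σ₁`-complement. -/
theorem pi_strong_induction {P : M → Prop} [hP : Pi fun v : Unit → M => P (v ())]
    (h : ∀ x, (∀ y, y < x → P y) → P x) (x : M) : P x := by
  by_contra hx
  have hP' : Sig fun w : Option Unit → M => ¬ P (w none) := hP.out.reindex fun _ => none
  -- Infinite descent: each counterexample has a smaller one, so after `t` rounds there is one at
  -- distance at least `t` below `x`. For `t = x + 1` this is impossible.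
  have H := sig_induction (P := fun t => ∃ y, ¬ P y ∧ y + t ≤ x) ⟨x, hx, by simp⟩ ?_ (x + 1)
  · obtain ⟨y, -, hy⟩ := H
    exact absurd (lt_of_lt_of_le (lt_of_lt_of_le (lt_add_one x) le_add_self) hy) (lt_irrefl _)
  · rintro t ⟨y, hy, hyt⟩
    obtain ⟨z, hz, hz'⟩ : ∃ z, z < y ∧ ¬ P z := by
      by_contra! h'
      exact hy (h y h')
    refine ⟨z, hz', le_trans ?_ hyt⟩
    obtain ⟨d, rfl⟩ := lt_iff_exists.1 hz
    exact le_iff_exists.2 ⟨d, by ring⟩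

/-- Simultaneous substitution of functions with `Σ₁`-graphs. -/
theorem Sig.subst {m : ℕ} {S : (Fin m → M) → Prop} (hS : Sig S) (g : Fin m → (α → M) → M)
    [hg : ∀ j, SigF (g j)] : Sig fun v => S fun j => g j v := by
  have key : ∀ (m : ℕ) (g : Fin m → (α → M) → M) (_ : ∀ j, SigF (g j))
      (S : (Fin m → M) → (α → M) → Prop)
      (_ : Sig fun w : Fin m ⊕ α → M => S (fun j => w (.inl j)) fun a => w (.inr a)),
      Sig fun v => S (fun j => g j v) v := by
    intro m
    induction m with
    | zero =>
      intro g _ S hS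
      refine (hS.reindex (Sum.elim Fin.elim0 id)).congr fun v => ?_
      rw [Subsingleton.elim (fun j => g j v) fun j => v (Sum.elim Fin.elim0 id (Sum.inl j))]
      rfl
    | succ m ih =>
      intro g hg S hS
      have h₁ : Sig fun w : Option (Fin m ⊕ α) → M => w none = g 0 fun a => w (some (.inr a)) :=
        SigF.graph (g 0) none fun a => some (Sum.inr a)
      have h₂ : Sig fun w : Option (Fin m ⊕ α) → M =>
          S (Fin.cons (w none) fun j => w (some (.inl j))) fun a => w (some (.inr a)) := by
        refine (hS.reindex (Sum.elim (Fin.cases none fun j => some (.inl j))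
          fun a => some (.inr a))).congr fun w => ?_
        have : (fun j => w (Sum.elim (Fin.cases none fun j => some (.inl j))
            (fun a => some (.inr a)) (Sum.inl j))) =
            (Fin.cons (w none) fun j => w (some (.inl j)) : Fin (m + 1) → M) := by
          funext j
          refine Fin.cases rfl (fun j => rfl) j
        rw [this]
        rfl
      refine (ih (fun j => g j.succ) (fun j => hg _)
        (fun xs v => ∃ y, y = g 0 v ∧ S (Fin.cons y xs) v) ?_).congr fun v => ?_
      · exact Sig.ex (P := fun y (w : Fin m ⊕ α → M) => y = g 0 (fun a => w (.inr a)) ∧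
          S (Fin.cons y fun j => w (.inl j)) fun a => w (.inr a))
      · rw [exists_eq_left]
        have : (Fin.cons (g 0 v) fun j => g j.succ v : Fin (m + 1) → M) = fun j => g j v := by
          funext j
          refine Fin.cases rfl (fun j => rfl) j
        rw [this]
  exact key m g hg (fun xs _ => S xs) (hS.reindex Sum.inl)

/-- Composition of functions with `Σ₁`-graphs. -/
theorem SigF.comp {m : ℕ} (F : (Fin m → M) → M) [hF : SigF F] (g : Fin m → (α → M) → M)
    [hg : ∀ j, SigF (g j)] : SigF fun v => F fun j => g j v := by
  constructor
  refine (Sig.subst (m := m + 1) (S := fun w => w 0 = F fun j => w j.succ)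
    (SigF.graph F 0 Fin.succ) (Fin.cases (fun w : Option α → M => w none)
      fun j w => g j fun a => w (some a)) (hg := ?_)).congr fun v => Iff.rfl
  exact fun j => Fin.cases (SigF.var _) (fun j => SigF.weaken) j

instance SigF.ite {f g a b : (α → M) → M} [SigF f] [SigF g] [ha : SigF a] [hb : SigF b] :
    SigF fun v => if f v ≤ g v then a v else b v := by
  constructor
  have := ha.out
  have := hb.out
  have h : Sig fun w : Option α → M =>
      ((f fun a => w (some a)) ≤ (g fun a => w (some a)) ∧ w none = a fun a => w (some a)) ∨
      ((g fun a => w (some a)) < (f fun a => w (some a)) ∧ w none = b fun a => w (some a)) :=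
    inferInstance
  refine h.congr fun w => ?_
  split_ifs with h
  · simp [h, not_lt.2 h]
  · simp [h, not_le.1 h]

end SigmaOne

/-! ## Coding of sequences and pairs -/

section Coding

variable {M : Type} [arith.Structure M] [hM : M ⊨ ISigma1] {α : Type}

/-- The entry with index `i` of the sequence coded by `(c, d)` is `y`. -/
def Entry (c d i y : M) : Prop := y < (i + 1) * d + 1 ∧ ∃ q, c = q * ((i + 1) * d + 1) + y

instance Sig.entry {c d i y : (α → M) → M} [SigF c] [SigF d] [SigF i] [SigF y] :
    Sig fun v => Entry (c v) (d v) (i v) (y v) :=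
  inferInstanceAs (Sig fun v => y v < (i v + 1) * d v + 1 ∧
    ∃ q, c v = q * ((i v + 1) * d v + 1) + y v)

theorem realize_entryF (v : α → M) (c d i y : arith.Term α) :
    (entryF c d i y).Realize v ↔
      Entry (c.realize v) (d.realize v) (i.realize v) (y.realize v) := by
  rw [entryF, Formula.realize_inf, realize_ltF, realize_exF, Entry]
  simp only [realize_succT, realize_mulT, Formula.realize_equal, realize_lift, realize_addT,
    realize_bv]
  refine and_congr_right fun _ => ⟨fun ⟨q, h⟩ => ⟨q 0, h⟩, fun ⟨q, h⟩ => ⟨fun _ => q, h⟩⟩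

theorem rem_unique {m q q' y y' : M} (hy : y < m) (hy' : y' < m)
    (h : q * m + y = q' * m + y') : y = y' := by
  have key : ∀ {q q' y y' : M}, y < m → q < q' → q * m + y ≠ q' * m + y' := by
    intro q q' y y' hy hq
    obtain ⟨e, rfl⟩ := lt_iff_exists.1 hq
    refine ne_of_lt ?_
    calc q * m + y < q * m + m := by gcongr
      _ ≤ q * m + m + (e * m + y') := le_self_add
      _ = (q + e + 1) * m + y' := by ring
  rcases lt_trichotomy q q' with hq | rfl | hq
  · exact absurd h (key hy hq)
  · exact add_left_cancel h
  · exact absurd h.symm (key hy' hq)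

theorem Entry.unique {c d i y y' : M} (h : Entry c d i y) (h' : Entry c d i y') : y = y' := by
  obtain ⟨hy, q, rfl⟩ := h
  obtain ⟨hy', q', h⟩ := h'
  exact rem_unique hy hy' h

/-- Two different moduli of Gödel's `β`-function are coprime. -/
theorem moduli_coprime {k l d e : M} (hd : 0 < d) (he : (l + 1) * e = d) :
    ∃ u v, u * ((k + 1) * d + 1) = 1 + v * ((k + l + 1 + 1) * d + 1) := by
  have hpos : 0 < (1 + (k + l + 1 + 1) * e * (k + 1)) * ((k + l + 1 + 1) * d) := by positivity
  obtain ⟨r, hr⟩ := lt_iff_exists.1 hpos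
  rw [zero_add] at hr
  -- Write `J = k + l + 2`. Modulo `J · d + 1`, both `J² · e` times the first modulus and `J · d`
  -- are `-1`, so `J² · e · (J · d)` is an inverse of the first modulus. The number `r`, one less
  -- than a product, avoids subtraction.
  refine ⟨(k + l + 1 + 1) * (k + l + 1 + 1) * e * ((k + l + 1 + 1) * d), r, ?_⟩
  have hX : (k + l + 1 + 1) * (k + l + 1 + 1) * e * ((k + 1) * d + 1) + 1 =
      (1 + (k + l + 1 + 1) * e * (k + 1)) * ((k + l + 1 + 1) * d + 1) := by
    rw [← he]
    ring
  have h₁ : (k + l + 1 + 1) * (k + l + 1 + 1) * e * ((k + 1) * d + 1) =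
      (1 + (k + l + 1 + 1) * e * (k + 1)) + r := by
    refine add_right_cancel (b := 1) (hX.trans ?_)
    rw [mul_add, ← hr]
    ring
  calc _ = ((k + l + 1 + 1) * (k + l + 1 + 1) * e * ((k + 1) * d + 1)) * ((k + l + 1 + 1) * d) := by
        ring
    _ = (1 + (k + l + 1 + 1) * e * (k + 1)) * ((k + l + 1 + 1) * d) + r * ((k + l + 1 + 1) * d) := by
        rw [h₁]; ring
    _ = _ := by rw [← hr]; ring

/-- `Σ₁`-collection. -/
theorem sig_collection {R : M → M → Prop}
    [hR : Sig fun v : Option Unit → M => R (v (some ())) (v none)] {b : M}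
    (h : ∀ j, j < b → ∃ y, R j y) : ∃ u, ∀ j, j < b → ∃ y, y < u ∧ R j y := by
  have hR' : Sig fun w : Option (Option (Option Unit)) → M => R (w (some none)) (w none) :=
    hR.reindex fun o => o.elim none fun _ => some none
  obtain ⟨u, hu⟩ := sig_induction
    (P := fun t => ∃ u, ∀ j, j < t → b ≤ j ∨ ∃ y, y < u ∧ R j y)
    ⟨0, fun y hy => absurd hy not_lt_zero⟩ (by
      rintro t ⟨u, hu⟩
      rcases le_or_gt b t with ht | ht
      · refine ⟨u, fun j hj => ?_⟩
        rcases (lt_add_one_iff'.1 hj).lt_or_eq with hj | rfl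
        · exact hu j hj
        · exact .inl ht
      · obtain ⟨z, hz⟩ := h t ht
        refine ⟨max u (z + 1), fun y hy => ?_⟩
        rcases (lt_add_one_iff'.1 hy).lt_or_eq with hy | rfl
        · exact (hu y hy).imp_right fun ⟨z', hz', hd⟩ => ⟨z', lt_max_of_lt_left hz', hd⟩
        · exact .inr ⟨z, lt_max_of_lt_right (lt_add_one z), hz⟩) b
  exact ⟨u, fun j hj => (hu j hj).resolve_left hj.not_ge⟩

/-- The inductive step multiplies by `b + 1`, as for a factorial. -/
theorem exists_common_multiple (b : M) : ∃ d : M, 0 < d ∧ ∀ l, l < b → ∃ e, (l + 1) * e = d := by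
  refine sig_induction (P := fun b => ∃ d : M, 0 < d ∧ ∀ l, l < b → ∃ e, (l + 1) * e = d)
    ⟨1, zero_lt_one, fun y hy => absurd hy not_lt_zero⟩ ?_ b
  rintro b ⟨d, hd, h⟩
  refine ⟨d * (b + 1), by positivity, fun l hl => ?_⟩
  rcases (lt_add_one_iff'.1 hl).lt_or_eq with hl | rfl
  · obtain ⟨e, rfl⟩ := h l hl
    exact ⟨e * (b + 1), by ring⟩
  · exact ⟨d, by ring⟩

/-- Since `u` inverts `P` modulo `m`, one solves for `t = u · (y - c)`. As there are no negative
numbers, `-c` is represented by `(m - 1) · c`, with `r = m - 1`. -/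
theorem crt_step {c P u v m y : M} (h : u * P = 1 + v * m) (hm : 0 < m) :
    ∃ t q, c + P * t = q * m + y := by
  obtain ⟨r, hr⟩ := lt_iff_exists.1 hm
  rw [zero_add] at hr
  refine ⟨u * (y + r * c), c + v * (y + r * c), ?_⟩
  calc c + P * (u * (y + r * c)) = c + (u * P) * (y + r * c) := by ring
    _ = c * (r + 1) + y + v * m * (y + r * c) := by rw [h]; ring
    _ = _ := by rw [hr]; ring

/-- Every sequence with a `Σ₁`-definition has a code. -/
theorem exists_code {R : M → M → Prop}
    [hR : Sig fun v : Option Unit → M => R (v (some ())) (v none)] {i : M}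
    (h : ∀ j, j ≤ i → ∃ y, R j y) : ∃ c d, ∀ j, j ≤ i → ∃ y, R j y ∧ Entry c d j y := by
  obtain ⟨u, hu⟩ := sig_collection (R := R) (b := i + 1) fun j hj => h j (lt_add_one_iff'.1 hj)
  obtain ⟨d₀, hd₀, hdiv₀⟩ := exists_common_multiple (i + 1)
  -- Divisibility of `d` by all `l + 1` makes the moduli pairwise coprime. The extra factor `u + 1`
  -- makes them larger than the values to be coded, which must be remainders.
  obtain ⟨d, hd, hud, hdiv⟩ : ∃ d : M, 0 < d ∧ u ≤ d ∧ ∀ l, l < i + 1 → ∃ e, (l + 1) * e = d := by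
    refine ⟨d₀ * (u + 1), by positivity, ?_, fun l hl => ?_⟩
    · calc u ≤ 1 * (u + 1) := by rw [one_mul]; exact le_self_add
        _ ≤ d₀ * (u + 1) := by
          gcongr
          have := lt_iff_exists.1 hd₀
          obtain ⟨r, rfl⟩ := this
          rw [zero_add]
          exact le_add_self
    · obtain ⟨e, rfl⟩ := hdiv₀ l hl
      exact ⟨e * (u + 1), by ring⟩
  have hcop : ∀ k j, k < j → j ≤ i →
      ∃ u v, u * ((k + 1) * d + 1) = 1 + v * ((j + 1) * d + 1) := by
    intro k j hk hj
    obtain ⟨l, rfl⟩ := lt_iff_exists.1 hk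
    have hl : l < i + 1 := by
      refine lt_of_le_of_lt (le_trans ?_ hj) (lt_add_one i)
      exact le_iff_exists.2 ⟨k + 1, by ring⟩
    obtain ⟨e, he⟩ := hdiv l hl
    exact moduli_coprime hd he
  have hR' : Sig fun w : Option (Option (Option (Option Unit))) → M => R (w (some none)) (w none) :=
    hR.reindex fun o => o.elim none fun _ => some none
  -- Chinese remaindering one index at a time: `c` has the right remainders below `k`, and `P` is a
  -- common multiple of the moduli used so far that is invertible modulo those still to come. Adding
  -- multiples of `P` to `c` preserves the old remainders.
  have H := sig_induction (P := fun k => ∃ c P,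
      (∀ j, j < k → j ≤ i → (∃ q, P = q * ((j + 1) * d + 1)) ∧ ∃ y, R j y ∧ Entry c d j y) ∧
      ∀ j, j ≤ i → k ≤ j → ∃ u v, u * P = 1 + v * ((j + 1) * d + 1)) ?_ ?_ (i + 1)
  · obtain ⟨c, P, hc, -⟩ := H
    exact ⟨c, d, fun j hj => (hc j (lt_add_one_iff'.2 hj) hj).2⟩
  · exact ⟨0, 1, fun j hj => absurd hj not_lt_zero, fun j _ _ => ⟨1, 0, by ring⟩⟩
  · rintro k ⟨c, P, hc, hP⟩
    rcases le_or_gt k i with hk | hk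
    · obtain ⟨y, hy, hRy⟩ := hu k (lt_add_one_iff'.2 hk)
      obtain ⟨w, v, hwv⟩ := hP k hk le_rfl
      obtain ⟨t, q, htq⟩ := crt_step (c := c) (y := y) hwv (by positivity)
      refine ⟨c + P * t, P * ((k + 1) * d + 1), fun j hj hji => ?_, fun j hji hkj => ?_⟩
      · rcases (lt_add_one_iff'.1 hj).lt_or_eq with hj | rfl
        · obtain ⟨⟨p, hp⟩, z, hz, hz', q', hq'⟩ := hc j hj hji
          refine ⟨⟨p * ((k + 1) * d + 1), by rw [hp]; ring⟩, z, hz, hz', q' + p * t, ?_⟩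
          rw [hq', hp]
          ring
        · refine ⟨⟨P, rfl⟩, y, hRy, ?_, q, htq⟩
          calc y < u := hy
            _ ≤ d := hud
            _ ≤ d + (j * d + 1) := le_self_add
            _ = (j + 1) * d + 1 := by ring
      · obtain ⟨u₁, v₁, h₁⟩ := hP j hji (le_trans le_self_add hkj)
        obtain ⟨u₂, v₂, h₂⟩ := hcop k j (lt_of_lt_of_le (lt_add_one k) hkj) hji
        refine ⟨u₁ * u₂, v₁ + v₂ + v₁ * v₂ * ((j + 1) * d + 1), ?_⟩
        calc u₁ * u₂ * (P * ((k + 1) * d + 1)) = (u₁ * P) * (u₂ * ((k + 1) * d + 1)) := by ring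
          _ = _ := by rw [h₁, h₂]; ring
    · refine ⟨c, P, fun j hj hji => hc j (lt_of_le_of_lt hji hk) hji, fun j hji hkj => ?_⟩
      exact absurd (lt_of_lt_of_le hk (le_trans le_self_add hkj)) (not_lt.2 hji)

/-! ### Pairing, projections and predecessor. -/

/-- The pairing function. -/
noncomputable def mpair (a b : M) : M := if b ≤ a then a * a + a + b else b * b + a

instance SigF.mpair {f g : (α → M) → M} [SigF f] [SigF g] : SigF fun v => mpair (f v) (g v) :=
  inferInstanceAs (SigF fun v => if g v ≤ f v then f v * f v + f v + g v else g v * g v + f v)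

theorem realize_pairF (v : α → M) (a b p : arith.Term α) :
    (pairF a b p).Realize v ↔ p.realize v = mpair (a.realize v) (b.realize v) := by
  rw [pairF, Formula.realize_sup, Formula.realize_inf, Formula.realize_inf, realize_ltF,
    realize_leF, mpair]
  simp only [Formula.realize_equal, realize_addT, realize_mulT]
  split_ifs with h
  · simp [h, not_lt.2 h]
  · simp [h, not_le.1 h]

/-- The code of a pair lies between consecutive squares determined by the maximum. Hence a smaller
maximum gives a smaller code, from which injectivity and monotonicity follow. -/
theorem mpair_bounds (a b : M) :
    max a b * max a b ≤ mpair a b ∧ mpair a b < (max a b + 1) * (max a b + 1) := by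
  rw [mpair]
  split_ifs with h
  · rw [max_eq_left h]
    refine ⟨le_iff_exists.2 ⟨a + b, by ring⟩, ?_⟩
    obtain ⟨d, rfl⟩ := le_iff_exists.1 h
    exact lt_iff_exists.2 ⟨d, by ring⟩
  · have h := not_le.1 h
    rw [max_eq_right h.le]
    refine ⟨le_self_add, ?_⟩
    obtain ⟨d, rfl⟩ := lt_iff_exists.1 h
    exact lt_iff_exists.2 ⟨a + d + 1 + d + 1, by ring⟩

theorem mpair_inj {a b a' b' : M} (h : mpair a b = mpair a' b') : a = a' ∧ b = b' := by
  have key : ∀ {a b a' b' : M}, max a b < max a' b' → mpair a b < mpair a' b' := by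
    intro a b a' b' h
    refine lt_of_lt_of_le (mpair_bounds a b).2 (le_trans ?_ (mpair_bounds a' b').1)
    obtain ⟨d, hd⟩ := lt_iff_exists.1 h
    rw [← hd]
    exact le_iff_exists.2 ⟨d * (max a b + d + 1 + (max a b + 1)), by ring⟩
  have hm : max a b = max a' b' := by
    rcases lt_trichotomy (max a b) (max a' b') with h' | h' | h'
    · exact absurd h (key h').ne
    · exact h'
    · exact absurd h (key h').ne'
  rw [mpair, mpair] at h
  split_ifs at h with h₁ h₂ h₂
  · rw [max_eq_left h₁, max_eq_left h₂] at hm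
    subst hm
    exact ⟨rfl, add_left_cancel h⟩
  · rw [max_eq_left h₁, max_eq_right (not_le.1 h₂).le] at hm
    subst hm
    rw [add_assoc] at h
    have := add_left_cancel h
    exact absurd (this ▸ le_self_add : a ≤ a') (not_le.2 (not_le.1 h₂))
  · rw [max_eq_right (not_le.1 h₁).le, max_eq_left h₂] at hm
    subst hm
    rw [add_assoc] at h
    have := add_left_cancel h
    exact absurd (this ▸ le_self_add : b ≤ a) h₁
  · rw [max_eq_right (not_le.1 h₁).le, max_eq_right (not_le.1 h₂).le] at hm
    subst hm
    exact ⟨add_left_cancel h, rfl⟩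

/-- Induction along the enumeration of pairs. With maximum `m` it passes through `(0, m), …, (m - 1,
m)`, then through `(m, 0), …, (m, m)`, and goes on to `(0, m + 1)`; the four cases give the
successor of a pair. -/
theorem mpair_surj (p : M) : ∃ a b, p = mpair a b := by
  refine sig_induction (P := fun p : M => ∃ a b, p = mpair a b) ⟨0, 0, by simp [mpair]⟩ ?_ p
  rintro _ ⟨a, b, rfl⟩
  by_cases h : b ≤ a
  · rcases h.lt_or_eq with h' | rfl
    · refine ⟨a, b + 1, ?_⟩
      have : b + 1 ≤ a := by
        obtain ⟨d, rfl⟩ := lt_iff_exists.1 h'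
        exact le_iff_exists.2 ⟨d, by ring⟩
      rw [mpair, mpair, if_pos h, if_pos this, add_assoc _ b 1]
    · refine ⟨0, b + 1, ?_⟩
      rw [mpair, mpair, if_pos h, if_neg (not_le.2 (by positivity))]
      ring
  · have h' := not_le.1 h
    obtain ⟨d, hd⟩ := lt_iff_exists.1 h'
    rcases eq_or_ne d 0 with rfl | hd'
    · refine ⟨b, 0, ?_⟩
      rw [mpair, mpair, if_neg h, if_pos zero_le, ← hd]
      ring
    · refine ⟨a + 1, b, ?_⟩
      have : ¬ b ≤ a + 1 := by
        obtain ⟨e, rfl⟩ := lt_iff_exists.1 (pos_iff_ne_zero.2 hd')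
        refine not_le.2 (lt_iff_exists.2 ⟨e, ?_⟩)
        rw [← hd]
        ring
      rw [mpair, mpair, if_neg h, if_neg this, add_assoc]

noncomputable def mfst (p : M) : M := (mpair_surj p).choose
noncomputable def msnd (p : M) : M := (mpair_surj p).choose_spec.choose

theorem mpair_mfst_msnd (p : M) : mpair (mfst p) (msnd p) = p :=
  (mpair_surj p).choose_spec.choose_spec.symm

@[simp] theorem mfst_mpair (a b : M) : mfst (mpair a b) = a :=
  (mpair_inj (mpair_mfst_msnd (mpair a b))).1

@[simp] theorem msnd_mpair (a b : M) : msnd (mpair a b) = b :=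
  (mpair_inj (mpair_mfst_msnd (mpair a b))).2

theorem mfst_eq_iff {p a : M} : a = mfst p ↔ ∃ b, p = mpair a b := by
  constructor
  · rintro rfl
    exact ⟨_, (mpair_mfst_msnd p).symm⟩
  · rintro ⟨b, rfl⟩
    simp

theorem msnd_eq_iff {p b : M} : b = msnd p ↔ ∃ a, p = mpair a b := by
  constructor
  · rintro rfl
    exact ⟨_, (mpair_mfst_msnd p).symm⟩
  · rintro ⟨b, rfl⟩
    simp

instance SigF.mfst {f : (α → M) → M} [hf : SigF f] : SigF fun v => mfst (f v) :=
  ⟨(Sig.subst₁ (f := fun w : Option α → M => f fun a => w (some a))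
    (fun p w => ∃ b, p = StepDown.mpair (w none) b)).congr fun _ => mfst_eq_iff⟩

instance SigF.msnd {f : (α → M) → M} [hf : SigF f] : SigF fun v => msnd (f v) :=
  ⟨(Sig.subst₁ (f := fun w : Option α → M => f fun a => w (some a))
    (fun p w => ∃ b, p = StepDown.mpair b (w none))).congr fun _ => msnd_eq_iff⟩

theorem le_mul_self' (a : M) : a ≤ a * a := by
  rcases eq_or_ne a 0 with rfl | h
  · simp
  · obtain ⟨e, rfl⟩ := lt_iff_exists.1 (pos_iff_ne_zero.2 h)
    exact le_iff_exists.2 ⟨(e + 1) * e, by ring⟩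

theorem left_le_mpair (a b : M) : a ≤ mpair a b :=
  (le_trans (le_max_left a b) (le_mul_self' _)).trans (mpair_bounds a b).1

theorem right_le_mpair (a b : M) : b ≤ mpair a b :=
  (le_trans (le_max_right a b) (le_mul_self' _)).trans (mpair_bounds a b).1

/-- This makes the recursion for comparing notations well-founded: passing to components in both
entries lowers the code of the pair. -/
theorem mpair_lt_mpair {a b a' b' : M} (h : a < a') (h' : b < b') : mpair a b < mpair a' b' := by
  have hm : max a b < max a' b' := max_lt_max h h'
  refine lt_of_lt_of_le (mpair_bounds a b).2 (le_trans ?_ (mpair_bounds a' b').1)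
  obtain ⟨d, hd⟩ := lt_iff_exists.1 hm
  rw [← hd]
  exact le_iff_exists.2 ⟨d * (max a b + d + 1 + (max a b + 1)), by ring⟩

/-- The predecessor. -/
noncomputable def mpred (a : M) : M := by
  classical exact if h : ∃ b, a = b + 1 then h.choose else 0

@[simp] theorem mpred_add_one (a : M) : mpred (a + 1) = a := by
  have h : ∃ b, a + 1 = b + 1 := ⟨a, rfl⟩
  rw [mpred, dif_pos h]
  exact (add_right_cancel h.choose_spec).symm

@[simp] theorem mpred_zero : mpred (0 : M) = 0 := by
  rw [mpred, dif_neg]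
  rintro ⟨b, hb⟩
  have : (0 : M) < b + 1 := by positivity
  exact this.ne hb

theorem zero_or_succ (a : M) : a = 0 ∨ ∃ b, a = b + 1 := by
  rcases eq_or_ne a 0 with h | h
  · exact .inl h
  · obtain ⟨e, he⟩ := lt_iff_exists.1 (pos_iff_ne_zero.2 h)
    exact .inr ⟨e, by rw [← he, zero_add]⟩

theorem mpred_eq_iff {a b : M} : b = mpred a ↔ (a = 0 ∧ b = 0) ∨ a = b + 1 := by
  rcases zero_or_succ a with rfl | ⟨c, rfl⟩
  · have : (0 : M) ≠ b + 1 := (by positivity : (0 : M) < b + 1).ne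
    simp [this]
  · have : c + 1 ≠ 0 := (by positivity : (0 : M) < c + 1).ne'
    simp only [mpred_add_one, this, false_and, false_or]
    exact ⟨fun h => by rw [h], fun h => (add_right_cancel h).symm⟩

instance SigF.mpred {f : (α → M) → M} [hf : SigF f] : SigF fun v => mpred (f v) :=
  ⟨(Sig.subst₁ (f := fun w : Option α → M => f fun a => w (some a))
    (fun p w => (p = 0 ∧ w none = 0) ∨ p = w none + 1)).congr fun _ => mpred_eq_iff⟩

end Coding

/-! ## Evaluation of programs in models of `IΣ₁` -/

section CourseRec

variable {M : Type} [arith.Structure M] [hM : M ⊨ ISigma1] {α : Type}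

/-- In the sequence coded by `(c, d)`, the value used at index `j` for the index `a` is `u`. -/
def Prev (c d j a u : M) : Prop := (a < j ∧ Entry c d a u) ∨ (j ≤ a ∧ u = 0)

instance Sig.prev {c d j a u : (α → M) → M} [SigF c] [SigF d] [SigF j] [SigF a] [SigF u] :
    Sig fun v => Prev (c v) (d v) (j v) (a v) (u v) :=
  inferInstanceAs (Sig fun v => (a v < j v ∧ Entry (c v) (d v) (a v) (u v)) ∨
    (j v ≤ a v ∧ u v = 0))

theorem realize_prevF (v : α → M) (c d j a u : arith.Term α) :
    (prevF c d j a u).Realize v ↔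
      Prev (c.realize v) (d.realize v) (j.realize v) (a.realize v) (u.realize v) := by
  rw [prevF, Formula.realize_sup, Formula.realize_inf, Formula.realize_inf, realize_ltF,
    realize_leF, realize_entryF, Formula.realize_equal, realize_zeroT, Prev]

variable (h₁ h₂ : M → M) (g : M → M → M → M)

/-- The sequence coded by `(c, d)` satisfies the recursive clause at the indices below `n`. -/
def Good (c d n : M) : Prop :=
  ∀ j, j < n → ∃ u w, Prev c d j (h₁ j) u ∧ Prev c d j (h₂ j) w ∧ Entry c d j (g j u w)

/-- The relation defined by the formula for course-of-values recursion. -/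
def CourseRel (i y : M) : Prop := ∃ c d, Entry c d i y ∧ Good h₁ h₂ g c d (i + 1)

/-- Course-of-values recursion. -/
noncomputable def courseFun (i : M) : M := Classical.epsilon fun y => CourseRel h₁ h₂ g i y

variable {h₁ h₂ g}

theorem Good.mono {c d n m : M} (h : Good h₁ h₂ g c d n) (hm : m ≤ n) : Good h₁ h₂ g c d m :=
  fun j hj => h j (lt_of_lt_of_le hj hm)

/-- The recursive clause determines each entry from earlier ones, so two codes agree by strong
induction on the index. This induction is `Σ₁` even if `h₁`, `h₂` and `g` have no definition, as
only entries are compared. -/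
theorem Good.unique {c d c' d' n : M} (h : Good h₁ h₂ g c d n) (h' : Good h₁ h₂ g c' d' n)
    (j : M) : j < n → ∃ y, Entry c d j y ∧ Entry c' d' j y := by
  refine sig_strong_induction (P := fun j => j < n → ∃ y, Entry c d j y ∧ Entry c' d' j y) ?_ j
  intro j ih hj
  obtain ⟨u, w, hu, hw, hz⟩ := h j hj
  obtain ⟨u', w', hu', hw', hz'⟩ := h' j hj
  have key : ∀ a u u', Prev c d j a u → Prev c' d' j a u' → u = u' := by
    rintro a u u' (⟨ha, hu⟩ | ⟨ha, rfl⟩) (⟨ha', hu'⟩ | ⟨ha', rfl⟩)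
    · obtain ⟨y, hy, hy'⟩ := ih a ha (ha.trans hj)
      rw [hu.unique hy, hu'.unique hy']
    · exact absurd ha (not_lt.2 ha')
    · exact absurd ha' (not_lt.2 ha)
    · rfl
  obtain rfl := key _ _ _ hu hu'
  obtain rfl := key _ _ _ hw hw'
  exact ⟨_, hz, hz'⟩

theorem CourseRel.unique {i y y' : M} (h : CourseRel h₁ h₂ g i y) (h' : CourseRel h₁ h₂ g i y') :
    y = y' := by
  obtain ⟨c, d, hy, hg⟩ := h
  obtain ⟨c', d', hy', hg'⟩ := h'
  obtain ⟨z, hz, hz'⟩ := hg.unique hg' i (lt_add_one i)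
  rw [hy.unique hz, hy'.unique hz']

/-- Unary functions whose composites with functions with `Σ₁`-graphs have `Σ₁`-graphs. -/
class SigFun₁ (h : M → M) : Prop where
  app : ∀ (β : Type) (f : (β → M) → M) [SigF f], SigF fun v => h (f v)

/-- Ternary functions whose composites with functions with `Σ₁`-graphs have `Σ₁`-graphs. -/
class SigFun₃ (g : M → M → M → M) : Prop where
  app : ∀ (β : Type) (a b c : (β → M) → M) [SigF a] [SigF b] [SigF c],
    SigF fun v => g (a v) (b v) (c v)

variable [i₁ : SigFun₁ h₁] [i₂ : SigFun₁ h₂] [i₃ : SigFun₃ g]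

include i₁ i₂ i₃ in
theorem exists_good (n : M) : ∃ c d, Good h₁ h₂ g c d n := by
  have := i₁.app
  have := i₂.app
  have := i₃.app
  refine sig_induction (P := fun n => ∃ c d, ∀ j, j < n → ∃ u w, Prev c d j (h₁ j) u ∧
    Prev c d j (h₂ j) w ∧ Entry c d j (g j u w)) ⟨0, 0, fun j hj => absurd hj not_lt_zero⟩ ?_ n
  rintro n ⟨c, d, h⟩
  have hprev : ∀ a, ∃ u, Prev c d n a u := by
    intro a
    rcases lt_or_ge a n with ha | ha
    · obtain ⟨u, w, -, -, h⟩ := h a ha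
      exact ⟨_, .inl ⟨ha, h⟩⟩
    · exact ⟨0, .inr ⟨ha, rfl⟩⟩
  obtain ⟨u, hu⟩ := hprev (h₁ n)
  obtain ⟨w, hw⟩ := hprev (h₂ n)
  -- A β-code cannot be extended in place. The old entries together with the new value at `n` form a
  -- sequence with a `Σ₁`-definition, which receives a new code.
  obtain ⟨c', d', h'⟩ := exists_code (R := fun j y => (j < n ∧ Entry c d j y) ∨
      (j = n ∧ y = g n u w)) (i := n) (fun j hj => by
    rcases hj.lt_or_eq with hj | rfl
    · obtain ⟨u, w, -, -, h⟩ := h j hj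
      exact ⟨_, .inl ⟨hj, h⟩⟩
    · exact ⟨_, .inr ⟨rfl, rfl⟩⟩)
  have htr : ∀ j y, j < n → Entry c d j y → Entry c' d' j y := by
    intro j y hj hy
    obtain ⟨z, hz | hz, hz'⟩ := h' j hj.le
    · rwa [hy.unique hz.2]
    · exact absurd hz.1 hj.ne
  have hprev' : ∀ j a u, j ≤ n → Prev c d j a u → Prev c' d' j a u := by
    rintro j a u hj (⟨ha, hu⟩ | hu)
    · exact .inl ⟨ha, htr _ _ (lt_of_lt_of_le ha hj) hu⟩
    · exact .inr hu
  refine ⟨c', d', fun j hj => ?_⟩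
  rcases (lt_add_one_iff'.1 hj).lt_or_eq with hj | rfl
  · obtain ⟨u, w, hu, hw, h⟩ := h j hj
    exact ⟨u, w, hprev' _ _ _ hj.le hu, hprev' _ _ _ hj.le hw, htr _ _ hj h⟩
  · obtain ⟨z, hz | ⟨-, rfl⟩, hz'⟩ := h' j le_rfl
    · exact absurd hz.1 (lt_irrefl _)
    · exact ⟨u, w, hprev' _ _ _ le_rfl hu, hprev' _ _ _ le_rfl hw, hz'⟩

include i₁ i₂ i₃ in
theorem courseRel_iff {i y : M} : CourseRel h₁ h₂ g i y ↔ y = courseFun h₁ h₂ g i := by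
  obtain ⟨c, d, h⟩ := exists_good (h₁ := h₁) (h₂ := h₂) (g := g) (i + 1)
  obtain ⟨u, w, -, -, hz⟩ := h i (lt_add_one i)
  have hex : ∃ y, CourseRel h₁ h₂ g i y := ⟨_, c, d, hz, h⟩
  have hs : CourseRel h₁ h₂ g i (courseFun h₁ h₂ g i) := Classical.epsilon_spec hex
  constructor
  · exact fun h => h.unique hs
  · rintro rfl
    exact hs

include i₁ i₂ i₃ in
theorem courseFun_eq (i : M) : courseFun h₁ h₂ g i =
    g i (if i ≤ h₁ i then 0 else courseFun h₁ h₂ g (h₁ i))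
      (if i ≤ h₂ i then 0 else courseFun h₁ h₂ g (h₂ i)) := by
  obtain ⟨c, d, h⟩ := exists_good (h₁ := h₁) (h₂ := h₂) (g := g) (i + 1)
  obtain ⟨u, w, hu, hw, hz⟩ := h i (lt_add_one i)
  have key : ∀ a u, Prev c d i a u → u = if i ≤ a then 0 else courseFun h₁ h₂ g a := by
    rintro a u (⟨ha, hu⟩ | ⟨ha, rfl⟩)
    · rw [if_neg (not_le.2 ha), ← courseRel_iff]
      exact ⟨c, d, hu, h.mono (by gcongr)⟩
    · rw [if_pos ha]
  rw [← key _ _ hu, ← key _ _ hw]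
  exact (courseRel_iff.1 ⟨c, d, hz, h⟩).symm

end CourseRec

/-! ### Values of programs and the meaning of their graph formulas. -/

section Eval

variable {M : Type} [arith.Structure M] [hM : M ⊨ ISigma1] {α : Type}

/-- The value of a program in a model of `IΣ₁`. -/
noncomputable def ev : {k : ℕ} → Prog k → (Fin k → M) → M
  | _, .var i, v => v i
  | _, .zero, _ => 0
  | _, .succ a, v => ev a v + 1
  | _, .pred a, v => mpred (ev a v)
  | _, .pair a b, v => mpair (ev a v) (ev b v)
  | _, .fst a, v => mfst (ev a v)
  | _, .snd a, v => msnd (ev a v)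
  | _, .ifLe a b c d, v => if ev a v ≤ ev b v then ev c v else ev d v
  | _, .comp f g, v => ev f fun j => ev (g j) v
  | _, .courseRec h₁ h₂ g, v =>
      courseFun (fun j => ev h₁ fun _ => j) (fun j => ev h₂ fun _ => j)
        (fun j a b => ev g (Matrix.vecCons j (Matrix.vecCons a (Matrix.vecCons b
          fun i => v i.succ)))) (v 0)

/-- Tuples of functions with `Σ₁`-graphs. -/
class SigV {m : ℕ} (a : (α → M) → Fin m → M) : Prop where
  out : ∀ j, SigF fun v => a v j

instance (priority := low) SigV.mk' {m : ℕ} {a : Fin m → (α → M) → M} [h : ∀ j, SigF fun v => a j v] :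
    SigV fun v j => a j v := ⟨h⟩

instance SigV.vecCons {m : ℕ} {x : (α → M) → M} {t : (α → M) → Fin m → M} [hx : SigF x]
    [ht : SigV t] : SigV fun v => Matrix.vecCons (x v) (t v) :=
  ⟨Fin.cases hx fun j => ht.out j⟩

instance SigV.vecEmpty : SigV fun _ : α → M => (![] : Fin 0 → M) := ⟨fun j => j.elim0⟩

theorem SigF.compV {m : ℕ} {F : (Fin m → M) → M} (hF : SigF F) (a : (α → M) → Fin m → M)
    [ha : SigV a] : SigF fun v => F (a v) := by
  have := ha.out
  exact SigF.comp F fun j v => a v j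

/-- Induction on the program. For a recursion, `courseRel_iff` replaces the function, which is
chosen by `Classical.epsilon`, by the existence of a code; the bounded quantifier over indices is
absorbed by collection. -/
instance SigF.ev {k : ℕ} (f : Prog k) : SigF (ev f : (Fin k → M) → M) := by
  induction f with
  | var i => exact SigF.var i
  | zero => exact SigF.const 0
  | succ a ha => exact inferInstanceAs (SigF fun v => StepDown.ev a v + 1)
  | pred a ha => exact inferInstanceAs (SigF fun v => StepDown.mpred (StepDown.ev a v))
  | pair a b ha hb =>
    exact inferInstanceAs (SigF fun v => StepDown.mpair (StepDown.ev a v) (StepDown.ev b v))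
  | fst a ha => exact inferInstanceAs (SigF fun v => StepDown.mfst (StepDown.ev a v))
  | snd a ha => exact inferInstanceAs (SigF fun v => StepDown.msnd (StepDown.ev a v))
  | ifLe a b c d ha hb hc hd =>
    exact inferInstanceAs (SigF fun v => if StepDown.ev a v ≤ StepDown.ev b v then
      StepDown.ev c v else StepDown.ev d v)
  | comp f g hf hg => exact SigF.comp (StepDown.ev f) fun j v => StepDown.ev (g j) v
  | @courseRec k h₁ h₂ g ih₁ ih₂ ih₃ =>
    have i₁ : SigFun₁ fun j : M => StepDown.ev h₁ fun _ => j :=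
      ⟨fun β f _ => ih₁.compV fun v _ => f v⟩
    have i₂ : SigFun₁ fun j : M => StepDown.ev h₂ fun _ => j :=
      ⟨fun β f _ => ih₂.compV fun v _ => f v⟩
    have := i₁.app
    have := i₂.app
    have i₃ : ∀ (β : Type) (a : (β → M) → Fin (k + 3) → M) [SigV a],
        SigF fun v => StepDown.ev g (a v) :=
      fun β a _ => ih₃.compV a
    have hS : Sig fun w : Option (Fin (k + 1)) → M => ∃ c d, Entry c d (w (some 0)) (w none) ∧
        ∀ j, j < w (some 0) + 1 → ∃ u z, Prev c d j (StepDown.ev h₁ fun _ => j) u ∧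
          Prev c d j (StepDown.ev h₂ fun _ => j) z ∧
          Entry c d j (StepDown.ev g (Matrix.vecCons j (Matrix.vecCons u (Matrix.vecCons z
            fun i => w (some i.succ))))) := inferInstance
    constructor
    refine hS.congr fun w => ?_
    have i₃' : SigFun₃ fun j a b : M => StepDown.ev g (Matrix.vecCons j (Matrix.vecCons a
        (Matrix.vecCons b fun i => w (some i.succ)))) := ⟨fun β a b c _ _ _ => inferInstance⟩
    exact (courseRel_iff (h₁ := fun j => StepDown.ev h₁ fun _ => j)
      (h₂ := fun j => StepDown.ev h₂ fun _ => j)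
      (g := fun j a b => StepDown.ev g (Matrix.vecCons j (Matrix.vecCons a (Matrix.vecCons b
          fun i => w (some i.succ)))))).symm

instance SigF.ev_app {m : ℕ} {f : Prog m} {a : (α → M) → Fin m → M} [SigV a] :
    SigF fun v => StepDown.ev f (a v) :=
  (SigF.ev f).compV a

instance SigFun₁.ev (h : Prog 1) : SigFun₁ fun j : M => StepDown.ev h fun _ => j :=
  ⟨fun _ _ _ => inferInstance⟩

instance SigFun₃.ev {k : ℕ} (g : Prog (k + 3)) (t : Fin k → M) :
    SigFun₃ fun j a b => StepDown.ev g (Matrix.vecCons j (Matrix.vecCons a (Matrix.vecCons b t))) :=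
  ⟨fun _ _ _ _ _ _ _ => inferInstance⟩

theorem ev_courseRec {k : ℕ} (h₁ h₂ : Prog 1) (g : Prog (k + 3)) (v : Fin (k + 1) → M) :
    ev (.courseRec h₁ h₂ g) v = ev g (Matrix.vecCons (v 0)
      (Matrix.vecCons (if v 0 ≤ ev h₁ ![v 0] then 0 else
        ev (.courseRec h₁ h₂ g) (Matrix.vecCons (ev h₁ ![v 0]) fun i => v i.succ))
      (Matrix.vecCons (if v 0 ≤ ev h₂ ![v 0] then 0 else
        ev (.courseRec h₁ h₂ g) (Matrix.vecCons (ev h₂ ![v 0]) fun i => v i.succ))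
      fun i => v i.succ))) := by
  have e : ∀ j : M, ![j] = fun _ : Fin 1 => j := fun j => by
    funext i
    rw [Subsingleton.elim i 0]
    rfl
  have := courseFun_eq (h₁ := fun j : M => ev h₁ fun _ => j)
      (h₂ := fun j : M => ev h₂ fun _ => j) (g := fun j a b : M => ev g (Matrix.vecCons j (Matrix.vecCons a (Matrix.vecCons b
          fun i => v i.succ)))) (v 0)
  simp only [e]
  exact this

/-- The formula for the graph of a program defines the graph of its evaluation. -/
theorem realize_graph {k : ℕ} (f : Prog k) (v : Fin k → arith.Term α) (y : arith.Term α)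
    (w : α → M) :
    (f.graph v y).Realize w ↔ y.realize w = ev f fun i => (v i).realize w := by
  induction f generalizing α with
  | var i =>
    rw [Prog.graph, Formula.realize_equal, ev, eq_comm]
  | zero => rw [Prog.graph, Formula.realize_equal, realize_zeroT, ev]
  | succ a ha =>
    simp only [Prog.graph, realize_exF, Formula.realize_inf, Formula.realize_equal, realize_succT,
      ha, realize_lift, realize_bv, ev]
    exact ⟨fun ⟨xs, h, h'⟩ => by rw [h', h], fun h => ⟨fun _ => ev a fun i => (v i).realize w, rfl, h⟩⟩
  | pred a ha =>
    simp only [Prog.graph, realize_exF, Formula.realize_inf, Formula.realize_sup,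
      Formula.realize_equal, realize_succT, realize_zeroT, ha, realize_lift, realize_bv, ev,
      mpred_eq_iff]
    exact ⟨fun ⟨xs, h, h'⟩ => h ▸ h', fun h => ⟨fun _ => ev a fun i => (v i).realize w, rfl, h⟩⟩
  | pair a b ha hb =>
    simp only [Prog.graph, realize_exF, Formula.realize_inf, realize_pairF, ha, hb, realize_lift,
      realize_bv, ev]
    exact ⟨fun ⟨xs, h, h', h''⟩ => by rw [h'', h, h'], fun h =>
      ⟨![ev a fun i => (v i).realize w, ev b fun i => (v i).realize w], rfl, rfl, h⟩⟩
  | fst a ha =>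
    simp only [Prog.graph, realize_exF, Formula.realize_inf, realize_pairF, ha, realize_lift,
      realize_bv, ev, mfst_eq_iff]
    exact ⟨fun ⟨xs, h, h'⟩ => ⟨xs 1, h ▸ h'⟩, fun ⟨b, h⟩ =>
      ⟨![ev a fun i => (v i).realize w, b], rfl, h⟩⟩
  | snd a ha =>
    simp only [Prog.graph, realize_exF, Formula.realize_inf, realize_pairF, ha, realize_lift,
      realize_bv, ev, msnd_eq_iff]
    exact ⟨fun ⟨xs, h, h'⟩ => ⟨xs 1, h ▸ h'⟩, fun ⟨b, h⟩ =>
      ⟨![ev a fun i => (v i).realize w, b], rfl, h⟩⟩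
  | ifLe a b c d ha hb hc hd =>
    simp only [Prog.graph, realize_exF, Formula.realize_inf, Formula.realize_sup, realize_leF,
      realize_ltF, ha, hb, hc, hd, realize_lift, realize_bv, ev]
    constructor
    · rintro ⟨xs, h, h', ⟨h₁, h₂⟩ | ⟨h₁, h₂⟩⟩
      · rw [h, h'] at h₁
        rw [if_pos h₁, h₂]
      · rw [h, h'] at h₁
        rw [if_neg (not_le.2 h₁), h₂]
    · intro h
      refine ⟨![ev a fun i => (v i).realize w, ev b fun i => (v i).realize w], rfl, rfl, ?_⟩
      split_ifs at h with h'
      · exact .inl ⟨h', h⟩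
      · exact .inr ⟨not_le.1 h', h⟩
  | comp f g hf hg =>
    simp only [Prog.graph, realize_exF, Formula.realize_inf, realize_conj, hf, hg, realize_lift,
      realize_bv, ev]
    exact ⟨fun ⟨xs, h, h'⟩ => by rw [h', funext h], fun h => ⟨_, fun _ => rfl, h⟩⟩
  | @courseRec k h₁ h₂ g ih₁ ih₂ ih₃ =>
    rw [ev, ← courseRel_iff]
    simp only [Prog.graph, realize_exF, realize_allF, Formula.realize_inf, Formula.realize_imp,
      realize_conj, realize_leF, realize_entryF, realize_lift, realize_bv, CourseRel, Good]
    have e₁ : ∀ (β : Type) (a b c : arith.Term β) (t : Fin k → arith.Term β) (w : β → M),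
        (fun i => Term.realize w (Matrix.vecCons a (Matrix.vecCons b (Matrix.vecCons c t)) i)) =
        Matrix.vecCons (a.realize w) (Matrix.vecCons (b.realize w) (Matrix.vecCons (c.realize w)
          fun i => (t i).realize w)) := by
      intro β a b c t w
      funext i
      refine Fin.cases rfl (fun i => Fin.cases rfl (fun i => Fin.cases rfl (fun i => rfl) i) i) i
    simp only [Fin.forall_fin_succ, Matrix.cons_val_zero, Matrix.cons_val_succ, ih₁, ih₂, ih₃,
      realize_prevF, realize_entryF, realize_lift, realize_bv, e₁, lt_add_one_iff',
      IsEmpty.forall_iff, and_true]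
    constructor
    · rintro ⟨xs, h, h'⟩
      refine ⟨xs 0, xs 1, h, fun j hj => ?_⟩
      obtain ⟨zs, hz₀, hz₁, hz₂, hz₃, hz₄, hz₅⟩ := h' (fun _ => j) hj
      refine ⟨zs 2, zs 3, hz₀ ▸ hz₂, hz₁ ▸ hz₃, hz₄ ▸ hz₅⟩
    · rintro ⟨c, d, h, h'⟩
      refine ⟨![c, d], h, fun js hj => ?_⟩
      obtain ⟨u, z, hu, hz, he⟩ := h' (js 0) hj
      exact ⟨![_, _, u, z, _], rfl, rfl, hu, hz, rfl, he⟩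

end Eval

/-! ## Ordinal notations in models of `IΣ₁` -/

section Notations

variable {M : Type} [arith.Structure M] [hM : M ⊨ ISigma1] {α : Type}

/-- The code of `ω ^ a + b`. -/
noncomputable def nd (a b : M) : M := mpair a b + 1

theorem left_lt_nd (a b : M) : a < nd a b := lt_add_one_iff'.2 (left_le_mpair a b)

theorem right_lt_nd (a b : M) : b < nd a b := lt_add_one_iff'.2 (right_le_mpair a b)

theorem nd_ne_zero (a b : M) : nd a b ≠ 0 := (lt_of_le_of_lt zero_le (left_lt_nd a b)).ne'

theorem zero_or_nd (x : M) : x = 0 ∨ ∃ a b, x = nd a b := by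
  rcases zero_or_succ x with h | ⟨y, rfl⟩
  · exact .inl h
  · exact .inr ⟨mfst y, msnd y, by rw [nd, mpair_mfst_msnd]⟩

@[simp] theorem mfst_mpred_nd (a b : M) : mfst (mpred (nd a b)) = a := by
  rw [nd, mpred_add_one, mfst_mpair]

@[simp] theorem msnd_mpred_nd (a b : M) : msnd (mpred (nd a b)) = b := by
  rw [nd, mpred_add_one, msnd_mpair]

instance SigF.nd {f g : (α → M) → M} [SigF f] [SigF g] : SigF fun v => nd (f v) (g v) :=
  inferInstanceAs (SigF fun v => StepDown.mpair (f v) (g v) + 1)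

section

variable {k m : ℕ} (v : Fin k → M)

theorem ev_vecCons (p : Prog k) (q : Fin m → Prog k) :
    (fun j => ev (Matrix.vecCons p q j) v) = Matrix.vecCons (ev p v) fun j => ev (q j) v := by
  funext j
  exact Fin.cases rfl (fun _ => rfl) j

theorem ev_vecEmpty : (fun j => ev ((![] : Fin 0 → Prog k) j) v) = ![] := by
  funext j
  exact j.elim0

theorem ev_ifZero (a c d : Prog k) :
    ev (.ifZero a c d) v = if ev a v = 0 then ev c v else ev d v := by
  simp [Prog.ifZero, ev]

theorem ev_ifEq (a b c d : Prog k) :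
    ev (.ifEq a b c d) v = if ev a v = ev b v then ev c v else ev d v := by
  simp only [Prog.ifEq, ev]
  split_ifs with h₁ h₂ h₃ h₃ h₃
  · rfl
  · exact absurd (le_antisymm h₁ h₂) h₃
  · exact absurd h₃.ge h₂
  · rfl
  · exact absurd h₃.le h₁
  · rfl

theorem ev_one : ev (.one : Prog k) v = 1 := by simp [Prog.one, ev]

theorem ev_two : ev (.two : Prog k) v = 2 := by
  simp only [Prog.two, ev, ev_one]
  norm_num

theorem ev_three : ev (.three : Prog k) v = 3 := by
  simp only [Prog.three, ev, ev_two]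
  norm_num

theorem ev_node (a b : Prog k) : ev (.node a b) v = nd (ev a v) (ev b v) := rfl

theorem ev_hd (a : Prog k) : ev (.hd a) v = mfst (mpred (ev a v)) := rfl

theorem ev_tl (a : Prog k) : ev (.tl a) v = msnd (mpred (ev a v)) := rfl

theorem ev_omegaPow (a : Prog k) : ev (.omegaPow a) v = nd (ev a v) 0 := rfl

theorem ev_ordOne : ev (.ordOne : Prog k) v = nd 0 0 := rfl

end

section

variable {k : ℕ} (g : Prog (k + 3)) (t : Fin k → M)

theorem ev_courseRec_zero (h₁ h₂ : Prog 1) : ev (.courseRec h₁ h₂ g) (Matrix.vecCons 0 t) =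
    ev g (Matrix.vecCons 0 (Matrix.vecCons 0 (Matrix.vecCons 0 t))) := by
  rw [ev_courseRec]
  simp

theorem ev_ordRec_nd (a b : M) : ev (.ordRec g) (Matrix.vecCons (nd a b) t) =
    ev g (Matrix.vecCons (nd a b) (Matrix.vecCons (ev (.ordRec g) (Matrix.vecCons a t))
      (Matrix.vecCons (ev (.ordRec g) (Matrix.vecCons b t)) t))) := by
  rw [Prog.ordRec, ev_courseRec]
  have e₁ : ev (.hd (.var 0)) ![nd a b] = a := mfst_mpred_nd a b
  have e₂ : ev (.tl (.var 0)) ![nd a b] = b := msnd_mpred_nd a b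
  simp only [Matrix.cons_val_zero, Matrix.cons_val_succ, e₁, e₂, not_le.2 (left_lt_nd a b),
    not_le.2 (right_lt_nd a b), if_false]

end

/-- Comparison of notations: `0` for `<`, `1` for `=` and `2` for `>`. -/
noncomputable def mcmp (a b : M) : M := ev Prog.cmpPair ![mpair a b]

noncomputable def mord (a : M) : M := ev Prog.isOrdF ![a]

noncomputable def mlast (a : M) : M := ev Prog.lastExpF ![a]

noncomputable def madd (a b : M) : M := ev Prog.addF ![a, b]

noncomputable def mmul (a n : M) : M := ev Prog.omegaPowMulF ![n, a]

noncomputable def mfund (a n : M) : M := ev Prog.fundF ![a, n]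

noncomputable def miter (x a n : M) : M := ev Prog.fundIter ![x, a, n]

section

variable {f g h : (α → M) → M} [SigF f] [SigF g] [SigF h]

instance SigF.mcmp : SigF fun v => mcmp (f v) (g v) :=
  inferInstanceAs (SigF fun v => StepDown.ev Prog.cmpPair ![StepDown.mpair (f v) (g v)])

instance SigF.mord : SigF fun v => mord (f v) :=
  inferInstanceAs (SigF fun v => StepDown.ev Prog.isOrdF ![f v])

instance SigF.mlast : SigF fun v => mlast (f v) :=
  inferInstanceAs (SigF fun v => StepDown.ev Prog.lastExpF ![f v])

instance SigF.madd : SigF fun v => madd (f v) (g v) :=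
  inferInstanceAs (SigF fun v => StepDown.ev Prog.addF ![f v, g v])

instance SigF.mmul : SigF fun v => mmul (f v) (g v) :=
  inferInstanceAs (SigF fun v => StepDown.ev Prog.omegaPowMulF ![g v, f v])

instance SigF.mfund : SigF fun v => mfund (f v) (g v) :=
  inferInstanceAs (SigF fun v => StepDown.ev Prog.fundF ![f v, g v])

instance SigF.miter : SigF fun v => miter (f v) (g v) (h v) :=
  inferInstanceAs (SigF fun v => StepDown.ev Prog.fundIter ![f v, g v, h v])

end

section

variable {k : ℕ} (v : Fin k → M) (a b c d : Prog k)

theorem ev_cmp : ev (.cmp a b) v = mcmp (ev a v) (ev b v) := by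
  simp only [Prog.cmp, ev, ev_vecCons, ev_vecEmpty, mcmp]

theorem ev_isOrd : ev (.isOrd a) v = mord (ev a v) := by
  simp only [Prog.isOrd, ev, ev_vecCons, ev_vecEmpty, mord]

theorem ev_lastExp : ev (.lastExp a) v = mlast (ev a v) := by
  simp only [Prog.lastExp, ev, ev_vecCons, ev_vecEmpty, mlast]

theorem ev_add : ev (.add a b) v = madd (ev a v) (ev b v) := by
  simp only [Prog.add, ev, ev_vecCons, ev_vecEmpty, madd]

theorem ev_omegaPowMul : ev (.omegaPowMul a b) v = mmul (ev a v) (ev b v) := by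
  simp only [Prog.omegaPowMul, ev, ev_vecCons, ev_vecEmpty, mmul]

theorem ev_fund : ev (.fund a b) v = mfund (ev a v) (ev b v) := by
  simp only [Prog.fund, ev, ev_vecCons, ev_vecEmpty, mfund]

theorem ev_ifOrdLt :
    ev (.ifOrdLt a b c d) v = if mcmp (ev a v) (ev b v) = 0 then ev c v else ev d v := by
  simp [Prog.ifOrdLt, ev, ev_cmp]

theorem ev_ifOrdLe :
    ev (.ifOrdLe a b c d) v = if mcmp (ev a v) (ev b v) ≤ 1 then ev c v else ev d v := by
  simp [Prog.ifOrdLe, ev, ev_cmp, ev_one]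

theorem ev_ifMesh : ev (.ifMesh a b c d) v =
    if ev a v = 0 ∨ mcmp (ev b v) (nd (madd (mlast (ev a v)) (nd 0 0)) 0) = 0 then ev c v
    else ev d v := by
  rw [Prog.ifMesh, ev_ifZero, ev_ifOrdLt, ev_omegaPow, ev_add, ev_lastExp, ev_ordOne, ite_or]

end

/-! ### Recursion equations for the operations on codes. -/

theorem mcmp_eq (x y : M) :
    mcmp x y = if x = 0 then if y = 0 then 1 else 0 else if y = 0 then 2 else
      if mcmp (mfst (mpred x)) (mfst (mpred y)) = 1 then mcmp (msnd (mpred x)) (msnd (mpred y))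
      else mcmp (mfst (mpred x)) (mfst (mpred y)) := by
  have e₁ : ev (.pair (.hd (.fst (.var 0))) (.hd (.snd (.var 0)))) ![mpair x y] =
      mpair (mfst (mpred x)) (mfst (mpred y)) := by simp [ev, ev_hd]
  have e₂ : ev (.pair (.tl (.fst (.var 0))) (.tl (.snd (.var 0)))) ![mpair x y] =
      mpair (msnd (mpred x)) (msnd (mpred y)) := by simp [ev, ev_tl]
  have e₃ : ∀ w : M, (Matrix.vecCons w fun i : Fin 0 => ![mpair x y] i.succ) = ![w] := by
    intro w
    funext j
    rw [Subsingleton.elim j 0]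
    rfl
  rw [mcmp, Prog.cmpPair, ev_courseRec, ← Prog.cmpPair]
  simp only [Matrix.cons_val_zero, e₁, e₂, e₃]
  simp only [ev_ifZero, ev_ifEq, ev_one, ev_two, ev, mfst_mpair, msnd_mpair, Matrix.cons_val]
  rcases zero_or_nd x with rfl | ⟨a, b, rfl⟩
  · simp
  rcases zero_or_nd y with rfl | ⟨c, d, rfl⟩
  · simp
  -- The component pairs have smaller codes, so the recursion uses its true values and not the
  -- default `0`. If an entry is `0`, the recursive values do not matter.
  have l₁ : ¬ mpair (nd a b) (nd c d) ≤ mpair a c :=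
    not_le.2 (mpair_lt_mpair (left_lt_nd a b) (left_lt_nd c d))
  have l₂ : ¬ mpair (nd a b) (nd c d) ≤ mpair b d :=
    not_le.2 (mpair_lt_mpair (right_lt_nd a b) (right_lt_nd c d))
  simp only [nd_ne_zero, mfst_mpred_nd, msnd_mpred_nd, l₁, l₂, if_false, mcmp]

theorem mcmp_zero_zero : mcmp (0 : M) 0 = 1 := by
  simp [mcmp_eq (0 : M)]

theorem mcmp_zero_nd (a b : M) : mcmp 0 (nd a b) = 0 := by
  simp [mcmp_eq 0 (nd a b), nd_ne_zero]

theorem mcmp_nd_zero (a b : M) : mcmp (nd a b) 0 = 2 := by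
  simp [mcmp_eq (nd a b) 0, nd_ne_zero]

theorem mcmp_nd_nd (a b c d : M) :
    mcmp (nd a b) (nd c d) = if mcmp a c = 1 then mcmp b d else mcmp a c := by
  simp [mcmp_eq (nd a b) (nd c d), nd_ne_zero]

theorem mord_nd (a b : M) : mord (nd a b) = if mord a = 1 ∧ mord b = 1 ∧
    (b = 0 ∨ mcmp (mfst (mpred b)) a ≤ 1) then 1 else 0 := by
  rw [mord, Prog.isOrdF, ev_ordRec_nd, ← Prog.isOrdF, ← mord, ← mord]
  simp only [ev_ifZero, ev_ifEq, ev_ifOrdLe, ev_one, ev_hd, ev_tl, ev, Matrix.cons_val,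
    nd_ne_zero, if_false, mfst_mpred_nd, msnd_mpred_nd, ite_and, ite_or]

theorem mlast_nd (a b : M) : mlast (nd a b) = if b = 0 then a else mlast b := by
  rw [mlast, Prog.lastExpF, ev_ordRec_nd, ← Prog.lastExpF]
  simp only [ev_ifZero, ev_hd, ev_tl, ev, Matrix.cons_val, mfst_mpred_nd, msnd_mpred_nd, mlast]

theorem madd_zero (c : M) : madd 0 c = c := by
  rw [madd, Prog.addF, Prog.ordRec, ev_courseRec_zero]
  simp [ev_ifZero, ev]

theorem madd_nd (a b c : M) : madd (nd a b) c = 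
    if madd b c = 0 ∨ mcmp (mfst (mpred (madd b c))) a ≤ 1 then nd a (madd b c) else madd b c := by
  rw [madd, Prog.addF, ev_ordRec_nd, ← Prog.addF, ← madd, ← madd]
  simp only [ev_ifZero, ev_ifOrdLe, ev_node, ev_hd, ev, Matrix.cons_val,
    nd_ne_zero, if_false, mfst_mpred_nd, ite_or]

theorem mmul_zero (d : M) : mmul d 0 = 0 := by
  rw [mmul, Prog.omegaPowMulF, ev_courseRec_zero]
  simp [ev_ifZero, ev]

theorem mmul_add_one (d k : M) : mmul d (k + 1) = nd d (mmul d k) := by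
  rw [mmul, Prog.omegaPowMulF, ev_courseRec, ← Prog.omegaPowMulF]
  have : ¬ k + 1 ≤ k := not_le.2 (lt_add_one k)
  have e : (fun _ : Fin 1 => d) = ![d] := by
    funext j
    rw [Subsingleton.elim j 0]
    rfl
  simp [ev_ifZero, ev_node, ev, this, mmul, e]

theorem mfund_zero (n : M) : mfund 0 n = 0 := by
  rw [mfund, Prog.fundF, Prog.ordRec, ev_courseRec_zero]
  simp [ev_ifZero, ev]

theorem mfund_nd (a b n : M) : mfund (nd a b) n =
    if b = 0 then if a = 0 then 0 else if mlast a = 0 then mmul (mfund a n) (n + 1)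
      else nd (mfund a n) 0
    else nd a (mfund b n) := by
  rw [mfund, Prog.fundF, ev_ordRec_nd, ← Prog.fundF, ← mfund, ← mfund]
  simp only [ev_ifZero, ev_node, ev_omegaPow, ev_omegaPowMul, ev_lastExp, ev_hd, ev_tl, ev,
    Matrix.cons_val, nd_ne_zero, if_false, mfst_mpred_nd, msnd_mpred_nd]

theorem miter_zero (a n : M) : miter 0 a n = a := by
  rw [miter, Prog.fundIter, ev_courseRec_zero]
  simp [ev_ifZero, ev]

theorem miter_add_one (x a n : M) : miter (x + 1) a n = mfund (miter x a n) n := by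
  rw [miter, Prog.fundIter, ev_courseRec, ← Prog.fundIter]
  have : ¬ x + 1 ≤ x := not_le.2 (lt_add_one x)
  simp [ev_ifZero, ev_fund, ev, this, miter]

end Notations

/-! ## Stepping down along fundamental sequences -/

section Descent

variable {M : Type} [arith.Structure M] [hM : M ⊨ ISigma1] {α : Type} {n : M}

/-- `b` is reached from `a` by iterating `{·}(n)`. -/
def Reaches (n a b : M) : Prop := ∃ y, miter y a n = b

instance Sig.reaches {f g h : (α → M) → M} [SigF f] [SigF g] [SigF h] :
    Sig fun v => Reaches (f v) (g v) (h v) :=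
  inferInstanceAs (Sig fun v => ∃ y, StepDown.miter y (g v) (f v) = h v)

theorem miter_add (n a x y : M) : miter (x + y) a n = miter y (miter x a n) n := by
  refine sig_induction (P := fun y => miter (x + y) a n = miter y (miter x a n) n) ?_ ?_ y
  · rw [add_zero, miter_zero]
  · intro y ih
    rw [← add_assoc, miter_add_one, miter_add_one, ih]

namespace Reaches

theorem refl (a : M) : Reaches n a a := ⟨0, miter_zero a n⟩

theorem trans {a b c : M} (h : Reaches n a b) (h' : Reaches n b c) : Reaches n a c := by
  obtain ⟨x, rfl⟩ := h
  obtain ⟨y, rfl⟩ := h'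
  exact ⟨x + y, miter_add n a x y⟩

theorem fund (a : M) : Reaches n a (mfund a n) :=
  ⟨0 + 1, by rw [miter_add_one, miter_zero]⟩

/-- A descent is transported through `F` step by step: the image of one step may be a whole descent.
The definability of `F` makes the induction on the number of steps `Σ₁`. -/
theorem map {F : M → M} [i : SigFun₁ F] (h : ∀ b, Reaches n (F b) (F (mfund b n))) {b c : M}
    (hbc : Reaches n b c) : Reaches n (F b) (F c) := by
  have := i.app
  obtain ⟨y, rfl⟩ := hbc
  refine sig_induction (P := fun y => Reaches n (F b) (F (miter y b n))) ?_ ?_ y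
  · rw [miter_zero]
    exact refl _
  · intro y ih
    rw [miter_add_one]
    exact ih.trans (h _)

instance (a : M) : SigFun₁ fun b => nd a b := ⟨fun _ _ _ => inferInstance⟩

instance : SigFun₁ fun a : M => nd a 0 := ⟨fun _ _ _ => inferInstance⟩

/-- Fundamental sequences act on the last summand, so `{·}(n)` works on `b` under the leading
summand as long as `b ≠ 0`. -/
theorem nd_right (a : M) {b c : M} (h : Reaches n b c) : Reaches n (nd a b) (nd a c) := by
  refine map (F := fun b => nd a b) (fun b => ?_) h
  rcases eq_or_ne b 0 with rfl | hb
  · rw [mfund_zero]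
    exact refl _
  · have := fund (n := n) (nd a b)
    rwa [mfund_nd, if_neg hb] at this

theorem nd_zero_zero : Reaches n (nd 0 0) 0 := by
  have := fund (n := n) (nd 0 0)
  rwa [mfund_nd, if_pos rfl, if_pos rfl] at this

/-- The summands disappear one after the other, the innermost (last) one first. -/
theorem mul_zero {d : M} (h : Reaches n (nd d 0) 0) (k : M) : Reaches n (mmul d k) 0 := by
  refine sig_induction (P := fun k => Reaches n (mmul d k) 0) ?_ ?_ k
  · rw [mmul_zero]
    exact refl _
  · intro k ih
    rw [mmul_add_one]
    exact (nd_right d ih).trans h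

/-- The second case arises for successor exponents: the `n + 1` copies are split into a leading one
and `n` others. -/
theorem nd_zero_cases {g : M} (hg : g ≠ 0) : Reaches n (nd g 0) (nd (mfund g n) 0) ∨
    Reaches n (nd g 0) (nd (mfund g n) (mmul (mfund g n) n)) := by
  have := fund (n := n) (nd g 0)
  rw [mfund_nd, if_pos rfl, if_neg hg] at this
  split_ifs at this
  · rw [mmul_add_one] at this
    exact .inr this
  · exact .inl this

theorem nd_zero_of_fund {g : M} (h : Reaches n (nd (mfund g n) 0) 0) : Reaches n (nd g 0) 0 := by
  rcases eq_or_ne g 0 with rfl | hg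
  · exact nd_zero_zero
  · rcases nd_zero_cases (n := n) hg with h' | h'
    · exact h'.trans h
    · exact h'.trans ((nd_right _ (mul_zero h n)).trans h)

theorem nd_zero {a : M} (h : Reaches n a 0) : Reaches n (nd a 0) 0 := by
  obtain ⟨x, hx⟩ := h
  -- Induction on the number `j` of steps remaining from the `i`-th iterate to `0`, hence backwards
  -- along the path. The bound `i ≤ x` keeps the quantifier over `i` bounded and the claim `Σ₁`.
  have H : ∀ i, i ≤ x → i + x = x → Reaches n (nd (miter i a n) 0) 0 := by
    refine sig_induction (P := fun j => ∀ i, i ≤ x → i + j = x →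
      Reaches n (nd (miter i a n) 0) 0) ?_ ?_ x
    · rintro i - rfl
      rw [add_zero] at hx
      rw [hx]
      exact nd_zero_zero
    · intro j ih i hi h
      apply nd_zero_of_fund
      rw [← miter_add_one]
      have h : i + 1 + j = x := by rw [← h]; ring
      exact ih _ (le_iff_exists.2 ⟨j, h.symm⟩) h
  simpa [miter_zero] using H 0 zero_le (zero_add x)

/-- Every number leads to `0`. -/
theorem zero (n a : M) : Reaches n a 0 := by
  refine sig_strong_induction (P := fun a => Reaches n a 0) ?_ a
  intro a ih
  rcases zero_or_nd a with rfl | ⟨a, b, rfl⟩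
  · exact refl 0
  -- The induction is on numbers, not on ordinals: exponent and remainder have smaller codes than `ω
  -- ^ a + b`. First `b` is removed, then `ω ^ a`.
  · exact (nd_right a (ih b (right_lt_nd a b))).trans (nd_zero (ih a (left_lt_nd a b)))

/-- A step in the exponent may produce `n` superfluous copies of the next power. They descend to `0`
under the leading copy by `Reaches.zero`. -/
theorem nd_left {a b : M} (h : Reaches n a b) : Reaches n (nd a 0) (nd b 0) := by
  refine map (F := fun a => nd a 0) (fun g => ?_) h
  rcases eq_or_ne g 0 with rfl | hg
  · rw [mfund_zero]
    exact refl _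
  · rcases nd_zero_cases (n := n) hg with h' | h'
    · exact h'
    · exact h'.trans (nd_right _ (zero _ _))

theorem mul_of_le (d : M) {k l : M} (h : k ≤ l) : Reaches n (mmul d l) (mmul d k) := by
  -- The last summand is removed, and this takes place below the leading ones; the case of a single
  -- summand is `Reaches.zero`.
  have step : ∀ k, Reaches n (mmul d (k + 1)) (mmul d k) := by
    intro k
    refine sig_induction (P := fun k => Reaches n (mmul d (k + 1)) (mmul d k)) ?_ ?_ k
    · rw [mmul_zero]
      exact zero _ _
    · intro k ih
      rw [mmul_add_one d (k + 1), mmul_add_one d k]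
      exact nd_right d (by rwa [mmul_add_one d k] at ih)
  obtain ⟨c, rfl⟩ := le_iff_exists.1 h
  refine sig_induction (P := fun c => Reaches n (mmul d (k + c)) (mmul d k)) ?_ ?_ c
  · rw [add_zero]
    exact refl _
  · intro c ih
    rw [← add_assoc]
    exact (step (k + c)).trans ih

end Reaches

/-- The predecessor of a successor ordinal does not depend on the argument of the fundamental
sequence. -/
theorem mfund_of_mlast_eq_zero (m n a : M) : mlast a = 0 → mfund a m = mfund a n := by
  refine sig_strong_induction (P := fun a => mlast a = 0 → mfund a m = mfund a n) ?_ a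
  intro a ih h
  rcases zero_or_nd a with rfl | ⟨a, b, rfl⟩
  · rw [mfund_zero, mfund_zero]
  · rw [mlast_nd] at h
    rw [mfund_nd, mfund_nd]
    split_ifs at h with hb
    · rw [if_pos hb, if_pos hb, if_pos h, if_pos h]
    · rw [if_neg hb, if_neg hb, ih b (right_lt_nd a b) h]

/-- Here steps with a smaller argument `m` are simulated by steps with argument `n`; this treats the
basic step-down arguments, whose numerals are only bounded by `n`. -/
theorem Reaches.fund_of_le {m : M} (h : m ≤ n) (a : M) : Reaches n a (mfund a m) := by
  refine sig_strong_induction (P := fun a => Reaches n a (mfund a m)) ?_ a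
  intro a ih
  rcases zero_or_nd a with rfl | ⟨a, b, rfl⟩
  · rw [mfund_zero]
    exact refl 0
  · rw [mfund_nd]
    split_ifs with hb ha hl
    · exact Reaches.zero _ _
    · subst hb
      -- The exponent is a successor: one step gives `n + 1` copies of the same power of which `m +
      -- 1` are wanted, and the surplus is removed.
      have := fund (n := n) (nd a 0)
      rw [mfund_nd, if_pos rfl, if_neg ha, if_pos hl, mfund_of_mlast_eq_zero n m a hl] at this
      exact this.trans (mul_of_le _ (by gcongr))
    · subst hb
      exact nd_left (ih a (left_lt_nd a 0))
    · exact nd_right a (ih b (right_lt_nd a b))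

/-! ### Comparison and meshing -/

theorem eq_zero_or_one {a : M} (h : a ≤ 1) : a = 0 ∨ a = 1 := by
  rcases h.lt_or_eq with h | h
  · rw [← zero_add (1 : M), lt_add_one_iff'] at h
    exact .inl (le_antisymm h zero_le)
  · exact .inr h

theorem mcmp_zero_le (a : M) : mcmp 0 a ≤ 1 := by
  rcases zero_or_nd a with rfl | ⟨a, b, rfl⟩
  · rw [mcmp_zero_zero]
  · rw [mcmp_zero_nd]
    exact zero_le

theorem mcmp_zero_ne_zero (a : M) : mcmp a 0 ≠ 0 := by
  rcases zero_or_nd a with rfl | ⟨a, b, rfl⟩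
  · rw [mcmp_zero_zero]
    exact one_ne_zero
  · rw [mcmp_nd_zero]
    exact two_ne_zero

theorem mcmp_nd_zero_not_le (a b : M) : ¬ mcmp (nd a b) 0 ≤ 1 := by
  rw [mcmp_nd_zero, not_le]
  exact one_lt_two

/-- Passing to a member of the fundamental sequence decreases a nonzero ordinal. The bound `e`
changes to its exponent or remainder in the inductive step, so it is quantified, and the induction
is for a `Π₁`-set. -/
theorem mcmp_mfund (n p : M) : ∀ e, p ≠ 0 → mcmp p e ≤ 1 → mcmp (mfund p n) e = 0 := by
  refine pi_strong_induction (P := fun p => ∀ e, p ≠ 0 → mcmp p e ≤ 1 → mcmp (mfund p n) e = 0)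
    ?_ p
  intro p ih e hp h
  rcases zero_or_nd p with rfl | ⟨a, b, rfl⟩
  · exact absurd rfl hp
  rcases zero_or_nd e with rfl | ⟨c, d, rfl⟩
  · exact absurd h (mcmp_nd_zero_not_le a b)
  rw [mcmp_nd_nd] at h
  have hac : mcmp a c ≤ 1 := by
    split_ifs at h with hac
    · exact hac.le
    · exact h
  have hlt : a ≠ 0 → ∀ q, mcmp (nd (mfund a n) q) (nd c d) = 0 := by
    intro ha q
    rw [mcmp_nd_nd, ih a (left_lt_nd a b) c ha hac, if_neg zero_ne_one]
  rw [mfund_nd]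
  split_ifs with hb ha hl
  · exact mcmp_zero_nd c d
  · rw [mmul_add_one]
    exact hlt ha _
  · exact hlt ha _
  · rw [mcmp_nd_nd]
    split_ifs at h ⊢ with hac'
    · exact ih b (right_lt_nd a b) d hb h
    · exact (eq_zero_or_one hac).resolve_right hac'

/-- A form of meshing: the leading exponent of `c` is at most the smallest exponent of `a`. -/
def Meshes (a c : M) : Prop := a = 0 ∨ c = 0 ∨ mcmp (mfst (mpred c)) (mlast a) ≤ 1

instance Sig.meshes {f g : (α → M) → M} [SigF f] [SigF g] : Sig fun v => Meshes (f v) (g v) :=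
  inferInstanceAs (Sig fun v => f v = 0 ∨ g v = 0 ∨
    StepDown.mcmp (StepDown.mfst (StepDown.mpred (g v))) (StepDown.mlast (f v)) ≤ 1)

instance Pi.meshes {f g : (α → M) → M} [SigF f] [SigF g] : Pi fun v => Meshes (f v) (g v) :=
  inferInstanceAs (Pi fun v => f v = 0 ∨ g v = 0 ∨
    StepDown.mcmp (StepDown.mfst (StepDown.mpred (g v))) (StepDown.mlast (f v)) ≤ 1)

/-- A step of `{·}(n)` either keeps the leading exponent, or lowers it by `mcmp_mfund`, or leads to
`0`. Meshing therefore persists along a descent. -/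
theorem Meshes.mfund {a c : M} (h : Meshes a c) (n : M) : Meshes a (mfund c n) := by
  rcases h with h | rfl | h
  · exact .inl h
  · exact .inr (.inl (mfund_zero n))
  rcases zero_or_nd c with rfl | ⟨p, q, rfl⟩
  · exact .inr (.inl (mfund_zero n))
  rw [mfst_mpred_nd] at h
  have hlt : p ≠ 0 → ∀ q, Meshes a (nd (StepDown.mfund p n) q) := by
    intro hp q
    refine .inr (.inr ?_)
    rw [mfst_mpred_nd, mcmp_mfund n p _ hp h]
    exact zero_le
  rw [mfund_nd]
  split_ifs with hq hp hl
  · exact .inr (.inl rfl)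
  · rw [mmul_add_one]
    exact hlt hp _
  · exact hlt hp _
  · refine .inr (.inr ?_)
    rwa [mfst_mpred_nd]

theorem Meshes.of_nd {a b c : M} (h : Meshes (nd a b) c) : Meshes b c := by
  rcases eq_or_ne b 0 with hb | hb
  · exact .inl hb
  · rcases h with h | h | h
    · exact absurd h (nd_ne_zero a b)
    · exact .inr (.inl h)
    · rw [mlast_nd, if_neg hb] at h
      exact .inr (.inr h)

theorem mord_nd_iff {a b : M} : mord (nd a b) = 1 ↔
    mord a = 1 ∧ mord b = 1 ∧ (b = 0 ∨ mcmp (mfst (mpred b)) a ≤ 1) := by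
  rw [mord_nd]
  split_ifs with h
  · exact iff_of_true rfl h
  · exact iff_of_false zero_ne_one h

theorem mord_mlast (a : M) : mord a = 1 → a ≠ 0 → mord (mlast a) = 1 := by
  refine sig_strong_induction (P := fun a => mord a = 1 → a ≠ 0 → mord (mlast a) = 1) ?_ a
  intro a ih h ha
  rcases zero_or_nd a with rfl | ⟨a, b, rfl⟩
  · exact absurd rfl ha
  · obtain ⟨h₁, h₂, -⟩ := mord_nd_iff.1 h
    rw [mlast_nd]
    split_ifs with hb
    · exact h₁
    · exact ih b (right_lt_nd a b) h₂ hb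

/-- Under meshing no summand is absorbed, so addition is concatenation of Cantor normal forms. The
claim is phrased with the head of `a`, because the inductive step needs the leading exponent of the
sum `b + c`: it is that of `b` if `b ≠ 0`, and it is compared with the exponent before it by
normality. -/
theorem madd_eq_nd (c a : M) : mord a = 1 → Meshes a c → a ≠ 0 →
    madd a c = nd (mfst (mpred a)) (madd (msnd (mpred a)) c) := by
  refine sig_strong_induction (P := fun a => mord a = 1 → Meshes a c → a ≠ 0 →
    madd a c = nd (mfst (mpred a)) (madd (msnd (mpred a)) c)) ?_ a
  intro a ih h hc ha
  rcases zero_or_nd a with rfl | ⟨a, b, rfl⟩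
  · exact absurd rfl ha
  obtain ⟨-, h₂, h₃⟩ := mord_nd_iff.1 h
  rw [madd_nd, mfst_mpred_nd, msnd_mpred_nd, if_pos]
  rcases eq_or_ne b 0 with rfl | hb
  · have := hc.resolve_left ha
    rwa [mlast_nd, if_pos rfl, ← madd_zero c] at this
  · rw [ih b (right_lt_nd a b) h₂ hc.of_nd hb, mfst_mpred_nd]
    exact .inr (h₃.resolve_left hb)

theorem madd_nd_of_meshes {a b c : M} (h : mord (nd a b) = 1) (hc : Meshes (nd a b) c) :
    madd (nd a b) c = nd a (madd b c) := by
  rw [madd_eq_nd c _ h hc (nd_ne_zero a b), mfst_mpred_nd, msnd_mpred_nd]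

theorem madd_ne_zero {a c : M} (h : mord a = 1) (hm : Meshes a c) (hc : c ≠ 0) : madd a c ≠ 0 := by
  rcases zero_or_nd a with rfl | ⟨a, b, rfl⟩
  · rwa [madd_zero]
  · rw [madd_nd_of_meshes h hm]
    exact nd_ne_zero _ _

theorem meshes_one (a : M) : Meshes a (nd 0 0) :=
  .inr (.inr (by rw [mfst_mpred_nd]; exact mcmp_zero_le _))

/-- Adding `1` appends a last summand and meshes with everything, so the comparison can be followed
through the summands of `e`; `p` varies, which makes this a `Π₁`-induction. -/
theorem mcmp_le_of_lt_add_one (e : M) :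
    ∀ p, mord e = 1 → mcmp p (madd e (nd 0 0)) = 0 → mcmp p e ≤ 1 := by
  refine pi_strong_induction
    (P := fun e => ∀ p, mord e = 1 → mcmp p (madd e (nd 0 0)) = 0 → mcmp p e ≤ 1) ?_ e
  intro e ih p he h
  rcases zero_or_nd p with rfl | ⟨c, d, rfl⟩
  · exact mcmp_zero_le e
  rcases zero_or_nd e with rfl | ⟨a, b, rfl⟩
  · rw [madd_zero, mcmp_nd_nd] at h
    split_ifs at h
    · exact absurd h (mcmp_zero_ne_zero d)
    · exact absurd h (mcmp_zero_ne_zero c)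
  · rw [madd_nd_of_meshes he (meshes_one _), mcmp_nd_nd] at h
    rw [mcmp_nd_nd]
    split_ifs at h ⊢
    · exact ih b (right_lt_nd a b) d (mord_nd_iff.1 he).2.1 h
    · exact h.le.trans zero_le

/-- From `c < ω ^ (a₀ + 1)` one gets that the leading exponent of `c` is below `a₀ + 1`, hence at
most `a₀`. This form is easier to preserve along descents than the official definition. -/
theorem meshes_of_mcmp {a c : M} (ha : mord a = 1)
    (h : a = 0 ∨ mcmp c (nd (madd (mlast a) (nd 0 0)) 0) = 0) : Meshes a c := by
  rcases eq_or_ne a 0 with h₀ | h₀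
  · exact .inl h₀
  have h := h.resolve_left h₀
  rcases zero_or_nd c with rfl | ⟨p, q, rfl⟩
  · exact .inr (.inl rfl)
  rw [mcmp_nd_nd] at h
  split_ifs at h
  · exact absurd h (mcmp_zero_ne_zero q)
  · refine .inr (.inr ?_)
    rw [mfst_mpred_nd]
    exact mcmp_le_of_lt_add_one _ _ (mord_mlast a ha h₀) h

/-- The last summand of `a + c` is that of `c`, as nothing is absorbed. For `c = 0` the left side
would instead act on `a`. -/
theorem mfund_madd {c : M} (hc : c ≠ 0) (n a : M) : mord a = 1 → Meshes a c →
    mfund (madd a c) n = madd a (mfund c n) := by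
  refine sig_strong_induction (P := fun a => mord a = 1 → Meshes a c →
    mfund (madd a c) n = madd a (mfund c n)) ?_ a
  intro a ih h hm
  rcases zero_or_nd a with rfl | ⟨a, b, rfl⟩
  · rw [madd_zero, madd_zero]
  have h' := (mord_nd_iff.1 h).2.1
  rw [madd_nd_of_meshes h hm, madd_nd_of_meshes h (hm.mfund n), mfund_nd,
    if_neg (madd_ne_zero h' hm.of_nd hc), ih b (right_lt_nd a b) h' hm.of_nd]

theorem Reaches.madd {a b c : M} (ha : mord a = 1) (hm : Meshes a b) (h : Reaches n b c) :
    Reaches n (madd a b) (madd a c) := by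
  obtain ⟨y, rfl⟩ := h
  -- Meshing is carried along in the induction because `mfund_madd` requires it at every iterate.
  -- Once an iterate is `0` it stays `0`, and the sum no longer moves.
  have H : Meshes a (miter y b n) ∧
      Reaches n (StepDown.madd a b) (StepDown.madd a (miter y b n)) := by
    refine sig_induction (P := fun y => Meshes a (miter y b n) ∧
      Reaches n (StepDown.madd a b) (StepDown.madd a (miter y b n))) ?_ ?_ y
    · rw [miter_zero]
      exact ⟨hm, refl _⟩
    · rintro y ⟨hm, ih⟩
      rw [miter_add_one]
      refine ⟨hm.mfund n, ?_⟩
      rcases eq_or_ne (miter y b n) 0 with h₀ | h₀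
      · rw [h₀, mfund_zero, ← h₀]
        exact ih
      · rw [← mfund_madd h₀ n a ha hm]
        exact ih.trans (fund _)
  exact H.2

end Descent

/-! ## Step-down arguments in models of `IΣ₁` -/

section Arguments

variable {M : Type} [arith.Structure M] [hM : M ⊨ ISigma1] {α : Type}

/-- The code of the expression with constructor `i` and components `a` and `b`. -/
noncomputable def arg (i a b : M) : M := mpair i (mpair a b) + 1

theorem left_lt_arg (i a b : M) : a < arg i a b :=
  lt_add_one_iff'.2 ((left_le_mpair a b).trans (right_le_mpair i _))

theorem right_lt_arg (i a b : M) : b < arg i a b :=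
  lt_add_one_iff'.2 ((right_le_mpair a b).trans (right_le_mpair i _))

theorem arg_ne_zero (i a b : M) : arg i a b ≠ 0 :=
  (lt_of_le_of_lt zero_le (left_lt_arg i a b)).ne'

theorem zero_or_arg (x : M) : x = 0 ∨ ∃ i a b, x = arg i a b := by
  rcases zero_or_nd x with h | ⟨i, c, rfl⟩
  · exact .inl h
  · exact .inr ⟨i, mfst c, msnd c, by rw [nd, arg, mpair_mfst_msnd]⟩

@[simp] theorem mfst_mpred_arg (i a b : M) : mfst (mpred (arg i a b)) = i := by simp [arg]

@[simp] theorem msnd_mpred_arg (i a b : M) : msnd (mpred (arg i a b)) = mpair a b := by simp [arg]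

section

variable {k : ℕ} (v : Fin k → M) (p : Prog k)

theorem ev_tag : ev (.tag p) v = mfst (mpred (ev p v)) := rfl

theorem ev_arg₁ : ev (.arg₁ p) v = mfst (msnd (mpred (ev p v))) := rfl

theorem ev_arg₂ : ev (.arg₂ p) v = msnd (msnd (mpred (ev p v))) := rfl

end

theorem ev_argRec_zero (f₀ f₁ f₂ f₃ : Prog 3) : ev (.argRec f₀ f₁ f₂ f₃) ![(0 : M)] = 0 := by
  rw [Prog.argRec, ev_courseRec_zero, ev_ifZero]
  simp [ev]

theorem ev_argRec_arg (f₀ f₁ f₂ f₃ : Prog 3) (i a b : M) :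
    ev (.argRec f₀ f₁ f₂ f₃) ![arg i a b] =
      let v := ![arg i a b, ev (.argRec f₀ f₁ f₂ f₃) ![a], ev (.argRec f₀ f₁ f₂ f₃) ![b] ]
      if i = 0 then ev f₀ v else if i = 1 then ev f₁ v else if i = 2 then ev f₂ v else
        if i = 3 then ev f₃ v else 0 := by
  have e₁ : ev (.arg₁ (.var 0)) ![arg i a b] = a := by
    simp [ev_arg₁, ev]
  have e₂ : ev (.arg₂ (.var 0)) ![arg i a b] = b := by
    simp [ev_arg₂, ev]
  have e₃ : (fun j : Fin 0 => ![arg i a b] j.succ) = ![] := Subsingleton.elim _ _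
  rw [Prog.argRec, ev_courseRec, ← Prog.argRec]
  simp only [Matrix.cons_val_zero, e₁, e₂, e₃, not_le.2 (left_lt_arg i a b),
    not_le.2 (right_lt_arg i a b), if_false]
  rw [ev_ifZero, if_neg (by exact arg_ne_zero i a b)]
  simp only [ev_ifEq, ev_one, ev_two, ev_three, ev_tag, ev, Matrix.cons_val_zero,
    mfst_mpred_arg]

noncomputable def mtop (s : M) : M := ev Prog.topF ![s]

noncomputable def mbot (s : M) : M := ev Prog.botF ![s]

noncomputable def mbase (s : M) : M := ev Prog.baseF ![s]

noncomputable def misArg (s : M) : M := ev Prog.isArgF ![s]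

section

variable {f : (α → M) → M} [SigF f]

instance SigF.mtop : SigF fun v => mtop (f v) :=
  inferInstanceAs (SigF fun v => StepDown.ev Prog.topF ![f v])

instance SigF.mbot : SigF fun v => mbot (f v) :=
  inferInstanceAs (SigF fun v => StepDown.ev Prog.botF ![f v])

instance SigF.mbase : SigF fun v => mbase (f v) :=
  inferInstanceAs (SigF fun v => StepDown.ev Prog.baseF ![f v])

instance SigF.misArg : SigF fun v => misArg (f v) :=
  inferInstanceAs (SigF fun v => StepDown.ev Prog.isArgF ![f v])

end

theorem ev_top {k : ℕ} (v : Fin k → M) (p : Prog k) : ev (.top p) v = mtop (ev p v) := by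
  simp only [Prog.top, ev, ev_vecCons, ev_vecEmpty, mtop]

theorem ev_bot {k : ℕ} (v : Fin k → M) (p : Prog k) : ev (.bot p) v = mbot (ev p v) := by
  simp only [Prog.bot, ev, ev_vecCons, ev_vecEmpty, mbot]

theorem mtop_arg (i a b : M) : mtop (arg i a b) = if i = 0 then b else if i = 1 then mtop b else
    if i = 2 then madd a (mtop b) else if i = 3 then nd (mtop b) 0 else 0 := by
  rw [mtop, Prog.topF, ev_argRec_arg, ← Prog.topF]
  simp only [ev_add, ev_omegaPow, ev_arg₁, ev_arg₂, ev, Matrix.cons_val, msnd_mpred_arg,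
    mfst_mpair, msnd_mpair, mtop]

theorem mbot_arg (i a b : M) : mbot (arg i a b) = if i = 0 then mfund b a else
    if i = 1 then mbot a else if i = 2 then madd a (mbot b) else
    if i = 3 then nd (mbot b) 0 else 0 := by
  rw [mbot, Prog.botF, ev_argRec_arg, ← Prog.botF]
  simp only [ev_add, ev_fund, ev_omegaPow, ev_arg₁, ev_arg₂, ev, Matrix.cons_val, msnd_mpred_arg,
    mfst_mpair, msnd_mpair, mbot]

theorem mbase_arg (i a b : M) : mbase (arg i a b) = if i = 0 then a else
    if i = 1 then if mbase a ≤ mbase b then mbase b else mbase a else if i = 2 then mbase b else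
    if i = 3 then mbase b else 0 := by
  have e : ∀ a : M, ev Prog.baseF ![a] = mbase a := fun _ => rfl
  rw [mbase, Prog.baseF, ev_argRec_arg, ← Prog.baseF]
  simp only [ev_arg₁, ev, Matrix.cons_val, msnd_mpred_arg, mfst_mpair, e]

theorem misArg_arg (i a b : M) : misArg (arg i a b) = if i = 0 then mord b else
    if i = 1 then if misArg a = 1 ∧ misArg b = 1 ∧ mtop a = mbot b then 1 else 0 else
    if i = 2 then if mord a = 1 ∧ misArg b = 1 ∧
      (a = 0 ∨ mcmp (mtop b) (nd (madd (mlast a) (nd 0 0)) 0) = 0) then 1 else 0 else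
    if i = 3 then if a = 0 ∧ misArg b = 1 then 1 else 0 else 0 := by
  have e : ∀ a : M, ev Prog.isArgF ![a] = misArg a := fun _ => rfl
  rw [misArg, Prog.isArgF, ev_argRec_arg, ← Prog.isArgF]
  simp only [ev_isOrd, ev_ifEq, ev_ifZero, ev_ifMesh, ev_one, ev_top,
    ev_bot, ev_arg₁, ev_arg₂, ev, Matrix.cons_val, msnd_mpred_arg,
    mfst_mpair, msnd_mpair, e, ite_and]

theorem misArg_zero : misArg (0 : M) = 0 := ev_argRec_zero _ _ _ _

/-- Strong induction on the code, with one closure property of `Reaches` per constructor. The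
premises are decidable by functions with `Σ₁`-graph, so the implication is still `Σ₁`. -/
theorem reaches_of_misArg (n s : M) :
    misArg s = 1 → mbase s ≤ n → Reaches n (mtop s) (mbot s) := by
  refine sig_strong_induction
    (P := fun s => misArg s = 1 → mbase s ≤ n → Reaches n (mtop s) (mbot s)) ?_ s
  intro s ih h hb
  rcases zero_or_arg s with rfl | ⟨i, a, b, rfl⟩
  · rw [misArg_zero] at h
    exact absurd h zero_ne_one
  have iha := ih a (left_lt_arg i a b)
  have ihb := ih b (right_lt_arg i a b)
  rw [misArg_arg] at h
  rw [mbase_arg] at hb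
  rw [mtop_arg, mbot_arg]
  by_cases h₀ : i = 0
  · simp only [h₀, if_true] at hb ⊢
    exact Reaches.fund_of_le hb b
  by_cases h₁ : i = 1
  · simp only [h₁, one_ne_zero, if_false, if_true, ite_eq_left_iff, zero_ne_one, imp_false,
      not_not] at h hb ⊢
    obtain ⟨ha', hb', hab⟩ := h
    have hmax : mbase a ≤ n ∧ mbase b ≤ n := by
      split_ifs at hb with hle
      · exact ⟨hle.trans hb, hb⟩
      · exact ⟨hb, (not_le.1 hle).le.trans hb⟩
    have := iha ha' hmax.1
    rw [hab] at this
    -- In `s * t` the second component is used first, and its end is the start of the first one.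
    exact (ihb hb' hmax.2).trans this
  by_cases h₂ : i = 2
  · simp only [h₀, h₁, if_false, if_pos h₂, ite_eq_left_iff, zero_ne_one, imp_false,
      not_not] at h hb ⊢
    exact (ihb h.2.1 hb).madd h.1 (meshes_of_mcmp h.1 h.2.2)
  by_cases h₃ : i = 3
  · simp only [h₀, h₁, h₂, if_false, if_pos h₃, ite_eq_left_iff, zero_ne_one, imp_false,
      not_not] at h hb ⊢
    exact (ihb h.2 hb).nd_left
  · simp only [h₀, h₁, h₂, h₃, if_false, zero_ne_one] at h

theorem realize_stepsDownF (a n b : arith.Term α) (v : α → M) :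
    (stepsDownF a n b).Realize v ↔ Reaches (n.realize v) (a.realize v) (b.realize v) := by
  have e : ∀ (β : Type) (s t u : arith.Term β) (w : β → M),
      (fun i => Term.realize w ((![s, t, u] : Fin 3 → arith.Term β) i)) =
        ![s.realize w, t.realize w, u.realize w] := by
    intro β s t u w
    funext i
    fin_cases i <;> rfl
  simp only [stepsDownF, realize_exF, Formula.realize_inf, realize_leF, realize_graph,
    realize_lift, realize_bv, e]
  constructor
  · rintro ⟨x, y, -, h⟩
    exact ⟨_, h.symm⟩
  · rintro ⟨y, h⟩
    -- The bound `x` on the number of iterations is chosen to be `y` itself.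
    exact ⟨fun _ => y, fun _ => y, le_rfl, h.symm⟩

theorem realize_argumentF (s b n a : arith.Term α) (v : α → M) : (argumentF s b n a).Realize v ↔
    misArg (s.realize v) = 1 ∧ mtop (s.realize v) = a.realize v ∧
      mbot (s.realize v) = b.realize v ∧ mbase (s.realize v) ≤ n.realize v := by
  have e : ∀ (β : Type) (s : arith.Term β) (w : β → M),
      (fun i => Term.realize w ((![s] : Fin 1 → arith.Term β) i)) = ![s.realize w] := by
    intro β s w
    funext i
    rw [Subsingleton.elim i 0]
    rfl
  simp only [argumentF, realize_conj, Fin.forall_fin_succ, Matrix.cons_val_zero,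
    Matrix.cons_val_succ, IsEmpty.forall_iff, and_true, realize_graph, e, realize_succT,
    realize_zeroT, realize_exF, Formula.realize_inf, realize_leF, realize_lift, realize_bv,
    zero_add]
  refine and_congr eq_comm (and_congr eq_comm (and_congr eq_comm ?_))
  exact ⟨fun ⟨x, h, h'⟩ => h.symm.trans_le h', fun h => ⟨fun _ => _, rfl, h⟩⟩

end Arguments

end StepDown

/-! ### From truth in all models to formal derivability. -/

theorem mainTheorem6 :
    StepDown.Provable StepDown.ISigma1 StepDown.stepDownFromArgument ∧
      StepDown.Provable StepDown.ISigma1 StepDown.stepDownToZero := by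
  constructor
  · refine StepDown.provable_of_models fun M _ _ _ => ?_
    rw [StepDown.stepDownFromArgument, StepDown.realize_univClosure]
    intro xs
    rw [FirstOrder.Language.Formula.realize_imp, StepDown.realize_argumentF,
      StepDown.realize_stepsDownF]
    rintro ⟨h, h₁, h₂, h₃⟩
    rw [← h₁, ← h₂]
    exact StepDown.reaches_of_misArg _ _ h h₃
  · refine StepDown.provable_of_models fun M _ _ _ => ?_
    rw [StepDown.stepDownToZero, StepDown.realize_univClosure]
    intro xs
    rw [FirstOrder.Language.Formula.realize_imp, StepDown.realize_stepsDownF,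
      StepDown.realize_zeroT]
    exact fun _ => StepDown.Reaches.zero _ _
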